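/- Let $h>0$ and let $s\ge 1$ be an integer. Let $D$ be the open unit disc in the plane with polar coordinates $(\rho,\theta)$, with inner product $\langle u,v\rangle_{L^2(D)}=\frac1\pi\int_D\overline{u}\,v\,dA$, and let $C=D\times(-h,0)$. Put $\sigma(z)=\frac12\left(\frac{-z}{h}\left(1+\frac zh\right)\right)^{-1/2}$ and $$\|w\|_{L^2_\sigma(C)}^2=\frac1\pi\int_C|w|^2\,\sigma(z)\,dA\,dz .$$ Let $H^s_\sigma(C)=H^s(D)\otimes H^s_\sigma((-h,0))$ (Hilbert tensor product), that is, the space of complex-valued functions $w$ on $C$ whose mixed weak derivatives $\partial_x^a\partial_y^b\partial_z^k w$ with $a+b\le s$ and $k\le s$ all lie in $L^2_\sigma(C)$, with norm $$\|w\|_{H^s_\sigma(C)}^2=\sum_{a+b\le s}\ \sum_{k\le s}\|\partial_x^a\partial_y^b\partial_z^k w\|_{L^2_\sigma(C)}^2 .$$ For $m\in\mathbb Z$ and $n\ge 0$ let $\zeta_{mn}(\rho,\theta)=\sqrt{1+|m|+2n}\;P_n^{(0,|m|)}(2\rho^2-1)\,\rho^{|m|}e^{im\theta}$ be the Zernike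 polynomials, where $P_n^{(0,|m|)}$ are the Jacobi polynomials, and set $$\mathcal P_{MN}v=\sum_{|m|\le M}\sum_{0\le n\le N}\langle\zeta_{mn},v\rangle_{L^2(D)}\,\zeta_{mn}.$$ Let $z_j=-\frac h2\left(1+\cos\frac{\pi j}{J}\right)$, $0\le j\le J$, be the Chebyshev–Lobatto points of $[-h,0]$, and let $\ell_j$ be the Lagrange polynomials with $\ell_j(z_i)=\delta_{ij}$. Every $w\in H^s_\sigma(C)$ has a representative for which $z\mapsto w(\cdot,z)\in L^2(D)$ is continuous on $[-h,0]$; its values $w(\cdot,z)$, $z\in[-h,0]$, are uniquely determined as elements of $L^2(D)$, and with them one defines the projection-interpolant $$w_{MNJ}(\rho,\theta,z)=\sum_{0\le j\le J}\big(\mathcal P_{MN}w(\cdot,z_j)\big)(\rho,\theta)\,\ell_j(z).$$ There is a constant $R_s>0$, depending only on $s$ and $h$, such that for all integers $M,N,J\ge 1$ and all $w\in H^s_\sigma(C)$, $$\|w-w_{MNJ}\|_{L^2_\sigma(C)}\le R_s\left(\min(M,2N)^{-s}+J^{-s}\right)\|w\|_{H^s_\sigma(C)} .$$ -/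

import Mathlib

open MeasureTheory Set Filter
open scoped ContDiff

noncomputable section

namespace ZernikeCylinder

/-! ### The disc, the interval and the flat cylinder -/

/-- The open unit disc `D`; the plane is `ℂ`, regarded as `ℝ²` via `x + iy`. -/
def disc : Set ℂ := Metric.ball 0 1

/-- The flat cylinder `C = D × (-h, 0)`. -/
def cylinder (h : ℝ) : Set (ℂ × ℝ) := disc ×ˢ Ioo (-h) 0

/-- The normalised Lebesgue measure `π⁻¹ dx dy = π⁻¹ ρ dρ dθ` on the disc. -/
def discMeasure : Measure ℂ := ENNReal.ofReal (1 / Real.pi) • volume.restrict disc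

/-- The Chebyshev weight `σ(z) = 1/2 ((-z/h)(1 + z/h))^(-1/2)` on `(-h, 0)`. -/
def chebWeight (h z : ℝ) : ℝ := 1 / 2 * ((-z / h) * (1 + z / h)) ^ (-(1 / 2) : ℝ)

/-- The measure `σ(z) dz` on `(-h, 0)`. -/
def axialMeasure (h : ℝ) : Measure ℝ :=
  (volume.restrict (Ioo (-h) 0)).withDensity fun z => ENNReal.ofReal (chebWeight h z)

/-- The measure `π⁻¹ σ(z) dx dy dz` on the cylinder; `L²_σ(C)` is `L²` of this measure. -/
def cylMeasure (h : ℝ) : Measure (ℂ × ℝ) := discMeasure.prod (axialMeasure h)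

/-! ### Zernike polynomials and the projection on the disc -/

/-- The Jacobi polynomial `P_n^{(α, β)}` (for natural numbers `α`, `β`), through the formula
`P_n^{(α, β)}(x) = ∑ k, C(n+α, n-k) C(n+β, k) ((x-1)/2)^k ((x+1)/2)^(n-k)`. -/
def jacobiP (α β n : ℕ) (x : ℝ) : ℝ :=
  ∑ k ∈ Finset.range (n + 1), ((n + α).choose (n - k) : ℝ) * ((n + β).choose k : ℝ) *
    ((x - 1) / 2) ^ k * ((x + 1) / 2) ^ (n - k)

/-- The Zernike polynomial
`ζ_{mn} = √(1 + |m| + 2n) P_n^{(0, |m|)}(2ρ² - 1) ρ^{|m|} e^{imθ}`, where `ρ = ‖x‖`, `θ = arg x`. -/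
def zernike (m : ℤ) (n : ℕ) (x : ℂ) : ℂ :=
  ((Real.sqrt (1 + (m.natAbs : ℝ) + 2 * (n : ℝ)) * jacobiP 0 m.natAbs n (2 * ‖x‖ ^ 2 - 1) *
    ‖x‖ ^ m.natAbs : ℝ) : ℂ) * Complex.exp ((m : ℂ) * (x.arg : ℂ) * Complex.I)

/-- The coefficient `a_{mn} = ⟨ζ_{mn}, v⟩ = π⁻¹ ∫_D conj(ζ_{mn}) v`. -/
def zernikeCoeff (m : ℤ) (n : ℕ) (v : ℂ → ℂ) : ℂ :=
  ∫ x, (starRingEnd ℂ) (zernike m n x) * v x ∂discMeasure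

/-- The projection `P_{MN} v = ∑_{|m| ≤ M} ∑_{0 ≤ n ≤ N} a_{mn} ζ_{mn}`. -/
def zernikeProj (M N : ℕ) (v : ℂ → ℂ) (x : ℂ) : ℂ :=
  ∑ m ∈ Finset.Icc (-(M : ℤ)) (M : ℤ), ∑ n ∈ Finset.range (N + 1),
    zernikeCoeff m n v * zernike m n x

/-! ### Chebyshev–Lobatto interpolation and the projection-interpolant -/

/-- The Chebyshev–Lobatto points `z_j = -(h/2)(1 + cos(πj/J))`, `0 ≤ j ≤ J`. -/
def chebNode (h : ℝ) (J j : ℕ) : ℝ := -(h / 2) * (1 + Real.cos (Real.pi * j / J))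

/-- The Lagrange polynomial `ℓ_j` with respect to the nodes `z_0, …, z_J`. -/
def lagrangeCheb (h : ℝ) (J j : ℕ) (z : ℝ) : ℝ :=
  (Lagrange.basis (Finset.range (J + 1)) (chebNode h J) j).eval z

/-- `W` is the representative of `w` that is continuous in `z`: a curve `z ↦ W z = w(·, z)` in
`L²(D)`, continuous on the closed interval `[-h, 0]`, that agrees with `w` almost everywhere.
Any two such curves coincide on `[-h, 0]`, so the values `w(·, z_j)` are determined by the
class of `w`. -/
def IsContinuousInZ (h : ℝ) (w : ℂ × ℝ → ℂ) (W : ℝ → Lp ℂ 2 discMeasure) : Prop :=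
  ContinuousOn W (Icc (-h) 0) ∧
    ∀ᵐ z ∂(volume.restrict (Ioo (-h) 0)), (W z : ℂ → ℂ) =ᵐ[discMeasure] fun x => w (x, z)

/-- The projection-interpolant `w_{MNJ}(x, z) = ∑_{0 ≤ j ≤ J} (P_{MN} w(·, z_j))(x) ℓ_j(z)`,
where `W z` is the slice `w(·, z)`. -/
def projInterp (h : ℝ) (M N J : ℕ) (W : ℝ → Lp ℂ 2 discMeasure) (p : ℂ × ℝ) : ℂ :=
  ∑ j ∈ Finset.range (J + 1),
    zernikeProj M N (W (chebNode h J j)) p.1 * (lagrangeCheb h J j p.2 : ℂ)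

/-! ### The weighted Sobolev space `H^s_σ(C) = H^s(D) ⊗ H^s_σ((-h, 0))` -/

/-- The derivative in direction `v`. -/
def dirDeriv (v : ℂ × ℝ) (φ : ℂ × ℝ → ℂ) : ℂ × ℝ → ℂ := fun p => fderiv ℝ φ p v

/-- The classical derivative `∂_x^a ∂_y^b ∂_z^k φ`. -/
def mixedDeriv (a b k : ℕ) (φ : ℂ × ℝ → ℂ) : ℂ × ℝ → ℂ :=
  (dirDeriv (1, 0))^[a] ((dirDeriv (Complex.I, 0))^[b] ((dirDeriv (0, 1))^[k] φ))

/-- `g` is the weak (distributional) derivative `∂_x^a ∂_y^b ∂_z^k w` on the cylinder. -/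
def IsWeakDeriv (h : ℝ) (a b k : ℕ) (w g : ℂ × ℝ → ℂ) : Prop :=
  LocallyIntegrableOn w (cylinder h) ∧ LocallyIntegrableOn g (cylinder h) ∧
    ∀ φ : ℂ × ℝ → ℂ, ContDiff ℝ ∞ φ → HasCompactSupport φ → tsupport φ ⊆ cylinder h →
      ∫ p in cylinder h, w p * mixedDeriv a b k φ p =
        (-1) ^ (a + b + k) * ∫ p in cylinder h, g p * φ p

/-- `w ∈ H^s_σ(C)`. The Hilbert tensor product `H^s(D) ⊗ H^s_σ((-h, 0))`, as a space of functions
on `C`, consists of the functions all of whose mixed weak derivatives `∂_x^a ∂_y^b ∂_z^k w` with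
`a + b ≤ s` and `k ≤ s` (the case `a = b = k = 0` being `w` itself) belong to `L²_σ(C)`. -/
def MemSobolev (h : ℝ) (s : ℕ) (w : ℂ × ℝ → ℂ) : Prop :=
  ∀ a b k : ℕ, a + b ≤ s → k ≤ s →
    ∃ g : ℂ × ℝ → ℂ, IsWeakDeriv h a b k w g ∧ MemLp g 2 (cylMeasure h)

open Classical in
/-- The weak derivative `∂_x^a ∂_y^b ∂_z^k w` in `L²_σ(C)` (unique almost everywhere on `C`),
and `0` if there is none. -/
def weakDeriv (h : ℝ) (a b k : ℕ) (w : ℂ × ℝ → ℂ) : ℂ × ℝ → ℂ :=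
  if H : ∃ g : ℂ × ℝ → ℂ, IsWeakDeriv h a b k w g ∧ MemLp g 2 (cylMeasure h) then H.choose else 0

/-- The tensor product norm: `‖w‖² = ∑_{a+b ≤ s} ∑_{k ≤ s} ‖∂_x^a ∂_y^b ∂_z^k w‖²_{L²_σ(C)}`.
On products it satisfies `‖u ⊗ v‖ = ‖u‖_{H^s(D)} ‖v‖_{H^s_σ((-h, 0))}`. -/
def sobolevNorm (h : ℝ) (s : ℕ) (w : ℂ × ℝ → ℂ) : ℝ :=
  Real.sqrt (∑ i ∈ Finset.range (s + 1), ∑ ab ∈ Finset.HasAntidiagonal.antidiagonal i,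
    ∑ k ∈ Finset.range (s + 1),
    ∫ p, ‖weakDeriv h ab.1 ab.2 k w p‖ ^ 2 ∂(cylMeasure h))

end ZernikeCylinder

end

/-!
# Projection-interpolation on a cylinder with Zernike and Chebyshev polynomials

In the variables `x` and `x̄` the Zernike polynomials are, up to normalisation, the polynomials
`Z_{p,q} = ∑ₖ C(p,k) C(q,k) (x x̄ - 1)^k x^(p-k) x̄^(q-k)` with `p - q = m` and `min p q = n`
(`zernike_eq_dzeta`). With `t = -(1 + 2z/h)` the weight `σ` becomes the Chebyshev weight, and the
products `Z_{p,q} T_k(t)` are orthogonal in `L²_σ(C)`. They are complete because their span is closed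
under multiplication by `x`, `x̄` and `t` (`ae_eq_zero_of_moment_eq_zero`). By Parseval's identity
(`tsum_coef_sq`) everything can therefore be expressed through the coefficients of `w`.

*Decay.* Only first-order relations are used. From `∂ₓ(Z_{p+1,q+1} - Z_{p,q}) = (p+q+2) Z_{p,q+1}`,
its conjugate, and `d/dz sin((k+1)θ) = (2/h)(k+1) σ T_{k+1}` for `t = cos θ`, integration by parts
expresses `p+q+2`, respectively `k+1`, times a coefficient of `w` through neighbouring coefficients
of its first weak derivatives. The test functions vanish on the part of the boundary crossed by the
derivative, but they are not compactly supported, and `σ` is singular; the integration by parts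
is justified by a cut-off (`HasWeakDirDeriv.integral_eq`). Induction on the order gives
`∑ (p+q+1)^(2s) |a|² ≲ ‖w‖²` and `∑ (k+1)^(2s) |a|² ≲ ‖w‖²` (`exists_disc_decay`,
`exists_axial_decay`). The same relations applied to `w = 1` yield the orthogonality.

*Representative.* Since `s ≥ 1`, the `L²(D)`-valued Chebyshev series of `w` converges absolutely and
uniformly on `[-h, 0]`. This gives the representative continuous in `z`
(`exists_isContinuousInZ`); for any such representative each disc coefficient is a continuous
function of `z` and is equal to the sum of its Chebyshev series everywhere (`eqOn_tsum_tau`).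

*Error.* On the Chebyshev–Lobatto points `T_k` coincides with `T_{k'}` for an index `k' ≤ J`
(`sum_cheb_mul_lagrangeCheb`), so the interpolation error of a disc coefficient consists of the
coefficients beyond `J` and their aliases. As each alias is taken at most once in a block of length
`J`, the Cauchy–Schwarz inequality bounds the error by `J^(-s)` (`exists_interp_error`). The disc
indices outside the range of `P_{MN}` satisfy `p + q > min(M, 2N)`, and by Parseval the two errors add
up orthogonally (`exists_error_sq`).
-/

open MeasureTheory Set Filter
open scoped ContDiff

noncomputable section

namespace ZernikeCylinder

/-! ### Measures on the disc, the interval and the cylinder -/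

/-- The affine coordinate `t = -(1 + 2z/h)`, which maps `[-h, 0]` onto `[-1, 1]` and the
Chebyshev-Lobatto points to `cos(πj/J)`. -/
def tCoord (h z : ℝ) : ℝ := -(1 + 2 * z / h)

lemma contDiff_tCoord (h : ℝ) : ContDiff ℝ ∞ (tCoord h) := by
  unfold tCoord; fun_prop

lemma continuous_tCoord (h : ℝ) : Continuous (tCoord h) := (contDiff_tCoord h).continuous

lemma one_sub_tCoord_sq {h : ℝ} (hh : 0 < h) (z : ℝ) :
    1 - tCoord h z ^ 2 = 4 / h ^ 2 * (-z * (h + z)) := by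
  unfold tCoord; field_simp; ring

lemma one_sub_tCoord_sq_pos {h z : ℝ} (hh : 0 < h) (hz : z ∈ Ioo (-h) 0) :
    0 < 1 - tCoord h z ^ 2 := by
  rw [one_sub_tCoord_sq hh]
  have h1 : 0 < -z := by linarith [hz.2]
  have h2 : 0 < h + z := by linarith [hz.1]
  positivity

lemma tCoord_mem_Ioo {h z : ℝ} (hh : 0 < h) (hz : z ∈ Ioo (-h) 0) : tCoord h z ∈ Ioo (-1) 1 := by
  have := one_sub_tCoord_sq_pos hh hz
  constructor <;> nlinarith

lemma tCoord_mem_Icc {h z : ℝ} (hh : 0 < h) (hz : z ∈ Icc (-h) 0) : tCoord h z ∈ Icc (-1) 1 := by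
  have h1 : 0 ≤ 4 / h ^ 2 * (-z * (h + z)) := by
    have h1 : 0 ≤ -z := by linarith [hz.2]
    have h2 : 0 ≤ h + z := by linarith [hz.1]
    positivity
  rw [← one_sub_tCoord_sq hh] at h1
  constructor <;> nlinarith

/-- In the coordinate `t` the weight is the Chebyshev weight `(1 - t²)^(-1/2)`. -/
lemma chebWeight_eq {h z : ℝ} (hh : 0 < h) (hz : z ∈ Ioo (-h) 0) :
    chebWeight h z = (√(1 - tCoord h z ^ 2))⁻¹ := by
  have hp := one_sub_tCoord_sq_pos hh hz
  have h1 : (-z / h) * (1 + z / h) = (1 - tCoord h z ^ 2) / 2 ^ 2 := by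
    unfold tCoord; field_simp; ring
  rw [chebWeight, h1, Real.rpow_neg (by positivity), ← Real.sqrt_eq_rpow,
    Real.sqrt_div hp.le, Real.sqrt_sq (by norm_num)]
  field_simp

lemma chebWeight_pos {h z : ℝ} (hh : 0 < h) (hz : z ∈ Ioo (-h) 0) : 0 < chebWeight h z := by
  rw [chebWeight_eq hh hz]
  exact inv_pos.2 (Real.sqrt_pos.2 (one_sub_tCoord_sq_pos hh hz))

lemma measurable_chebWeight (h : ℝ) : Measurable (chebWeight h) := by
  unfold chebWeight; fun_prop

lemma hasDerivAt_arccos_tCoord {h z : ℝ} (hh : 0 < h) (hz : z ∈ Ioo (-h) 0) :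
    HasDerivAt (fun z => Real.arccos (tCoord h z)) (2 / h * chebWeight h z) z := by
  have ht := tCoord_mem_Ioo hh hz
  have h1 := Real.hasDerivAt_arccos (x := tCoord h z) ht.1.ne' ht.2.ne
  have h2 : HasDerivAt (tCoord h) (-(2 / h)) z := by
    have := (((hasDerivAt_id z).const_mul 2).div_const h).const_add 1 |>.neg
    exact this.congr_deriv (by ring)
  exact (h1.comp z h2).congr_deriv (by rw [chebWeight_eq hh hz]; ring)

lemma integrableOn_chebWeight {h : ℝ} (hh : 0 < h) : IntegrableOn (chebWeight h) (Ioo (-h) 0) := by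
  have h1 : IntegrableOn (fun z => 2 / h * chebWeight h z) (Ioc (-h) 0) := by
    refine intervalIntegral.integrableOn_deriv_of_nonneg
      (g := fun z => Real.arccos (tCoord h z)) ?_ ?_ ?_
    · exact (Real.continuous_arccos.comp (continuous_tCoord h)).continuousOn
    · exact fun z hz => hasDerivAt_arccos_tCoord hh hz
    · intro z hz
      have := chebWeight_pos hh hz
      positivity
  have h2 := (h1.mono_set Ioo_subset_Ioc_self).const_mul (h / 2)
  refine h2.congr (ae_of_all _ fun z => ?_)
  field_simp

lemma isFiniteMeasure_axialMeasure {h : ℝ} (hh : 0 < h) : IsFiniteMeasure (axialMeasure h) :=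
  isFiniteMeasure_withDensity_ofReal (integrableOn_chebWeight hh).2

instance isProbabilityMeasure_discMeasure : IsProbabilityMeasure discMeasure := by
  constructor
  have : ENNReal.ofReal (1 / Real.pi) * NNReal.pi = 1 := by
    rw [ENNReal.ofReal_eq_coe_nnreal (by positivity), ← ENNReal.coe_mul, ENNReal.coe_eq_one]
    ext
    push_cast
    simp [Real.pi_ne_zero]
  simpa [discMeasure, disc] using this

instance sFinite_axialMeasure (h : ℝ) : SFinite (axialMeasure h) := by
  unfold axialMeasure; infer_instance

lemma isFiniteMeasure_cylMeasure {h : ℝ} (hh : 0 < h) : IsFiniteMeasure (cylMeasure h) := by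
  have := isFiniteMeasure_axialMeasure hh
  unfold cylMeasure; infer_instance

lemma isOpen_cylinder (h : ℝ) : IsOpen (cylinder h) := Metric.isOpen_ball.prod isOpen_Ioo

lemma measurableSet_cylinder (h : ℝ) : MeasurableSet (cylinder h) := (isOpen_cylinder h).measurableSet

/-- `cylMeasure h` is Lebesgue measure on the cylinder with density `σ(z)/π`. -/
lemma cylMeasure_eq (h : ℝ) : cylMeasure h =
    (volume.restrict (cylinder h)).withDensity fun p => ENNReal.ofReal (chebWeight h p.2 / Real.pi) := by
  have hm : Measurable fun z => ENNReal.ofReal (chebWeight h z) :=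
    (measurable_chebWeight h).ennreal_ofReal
  have hm' : Measurable fun p : ℂ × ℝ => ENNReal.ofReal (chebWeight h p.2) :=
    hm.comp measurable_snd
  rw [cylMeasure, discMeasure, axialMeasure, Measure.prod_smul_left, prod_withDensity_right hm,
    Measure.prod_restrict, ← Measure.volume_eq_prod, cylinder, ← withDensity_smul _ hm']
  congr 1
  ext p
  rw [Pi.smul_apply, smul_eq_mul, ← ENNReal.ofReal_mul (by positivity)]
  congr 1; ring

lemma integral_cylMeasure {h : ℝ} (hh : 0 < h) (F : ℂ × ℝ → ℂ) :
    ∫ p, F p ∂cylMeasure h =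
      (Real.pi : ℂ)⁻¹ * ∫ p in cylinder h, (chebWeight h p.2 : ℂ) * F p := by
  have hm : Measurable fun p : ℂ × ℝ => ENNReal.ofReal (chebWeight h p.2 / Real.pi) :=
    (((measurable_chebWeight h).comp measurable_snd).div_const _).ennreal_ofReal
  rw [cylMeasure_eq, integral_withDensity_eq_integral_toReal_smul hm
    (ae_of_all _ fun _ => ENNReal.ofReal_lt_top), ← integral_const_mul]
  refine setIntegral_congr_fun (measurableSet_cylinder h) fun p hp => ?_
  have := chebWeight_pos hh hp.2
  rw [ENNReal.toReal_ofReal (by positivity), Complex.real_smul]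
  push_cast; ring

lemma integrableOn_chebWeight_mul {h : ℝ} (hh : 0 < h) {F : ℂ × ℝ → ℂ}
    (hF : Integrable F (cylMeasure h)) :
    IntegrableOn (fun p => (chebWeight h p.2 : ℂ) * F p) (cylinder h) := by
  have hm : Measurable fun p : ℂ × ℝ => ENNReal.ofReal (chebWeight h p.2 / Real.pi) :=
    (((measurable_chebWeight h).comp measurable_snd).div_const _).ennreal_ofReal
  rw [cylMeasure_eq, integrable_withDensity_iff_integrable_smul' hm
    (ae_of_all _ fun _ => ENNReal.ofReal_lt_top)] at hF
  refine (hF.const_mul (Real.pi : ℂ)).congr ?_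
  filter_upwards [ae_restrict_mem (measurableSet_cylinder h)] with p hp
  have := chebWeight_pos hh hp.2
  rw [ENNReal.toReal_ofReal (by positivity), Complex.real_smul]
  have := Real.pi_ne_zero
  push_cast; field_simp

lemma ae_cylMeasure_iff {h : ℝ} (hh : 0 < h) {P : ℂ × ℝ → Prop} :
    (∀ᵐ p ∂cylMeasure h, P p) ↔ ∀ᵐ p ∂volume.restrict (cylinder h), P p := by
  have hm : Measurable fun p : ℂ × ℝ => ENNReal.ofReal (chebWeight h p.2 / Real.pi) :=
    (((measurable_chebWeight h).comp measurable_snd).div_const _).ennreal_ofReal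
  rw [cylMeasure_eq, ae_withDensity_iff hm]
  refine eventually_congr ?_
  filter_upwards [ae_restrict_mem (measurableSet_cylinder h)] with p hp
  have := chebWeight_pos hh hp.2
  have : ENNReal.ofReal (chebWeight h p.2 / Real.pi) ≠ 0 := by simp; positivity
  simp [this]

lemma ae_axialMeasure_iff {h : ℝ} (hh : 0 < h) {P : ℝ → Prop} :
    (∀ᵐ z ∂axialMeasure h, P z) ↔ ∀ᵐ z ∂volume.restrict (Ioo (-h) 0), P z := by
  rw [axialMeasure, ae_withDensity_iff (measurable_chebWeight h).ennreal_ofReal]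
  refine eventually_congr ?_
  filter_upwards [ae_restrict_mem measurableSet_Ioo] with z hz
  simp [chebWeight_pos hh hz]

lemma ae_mem_cylinder (h : ℝ) : ∀ᵐ p ∂cylMeasure h, p ∈ cylinder h := by
  rw [cylMeasure_eq]
  exact (withDensity_absolutelyContinuous _ _).ae_le (ae_restrict_mem (measurableSet_cylinder h))

lemma ae_mem_disc : ∀ᵐ x ∂discMeasure, x ∈ disc :=
  Measure.ae_smul_measure (ae_restrict_mem Metric.isOpen_ball.measurableSet) _

lemma ae_mem_Ioo (h : ℝ) : ∀ᵐ z ∂axialMeasure h, z ∈ Ioo (-h) 0 :=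
  (withDensity_absolutelyContinuous _ _).ae_le (ae_restrict_mem measurableSet_Ioo)

/-! ### Weak derivatives tested against functions that do not vanish near the boundary -/

/-- `g` is the weak derivative of `w` in direction `v` on the cylinder. -/
def HasWeakDirDeriv (h : ℝ) (v : ℂ × ℝ) (w g : ℂ × ℝ → ℂ) : Prop :=
  ∀ φ : ℂ × ℝ → ℂ, ContDiff ℝ ∞ φ → HasCompactSupport φ → tsupport φ ⊆ cylinder h →
    ∫ p in cylinder h, w p * dirDeriv v φ p = -∫ p in cylinder h, g p * φ p

/-- A polynomial `(1 - |x|²)(-z)(h + z)` that is positive on the cylinder and vanishes to first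
order on its boundary. -/
def bdryFun (h : ℝ) (p : ℂ × ℝ) : ℝ := (1 - ‖p.1‖ ^ 2) * (-p.2 * (h + p.2))

lemma contDiff_bdryFun (h : ℝ) : ContDiff ℝ ∞ (bdryFun h) := by
  have h1 : ContDiff ℝ ∞ fun p : ℂ × ℝ => ‖p.1‖ ^ 2 := (contDiff_norm_sq ℝ).comp contDiff_fst
  unfold bdryFun
  fun_prop

lemma one_sub_norm_sq_pos {x : ℂ} (hx : x ∈ disc) : 0 < 1 - ‖x‖ ^ 2 := by
  have : ‖x‖ < 1 := by simpa [disc] using hx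
  have := norm_nonneg x
  nlinarith

lemma bdryFun_pos {h : ℝ} {p : ℂ × ℝ} (hp : p ∈ cylinder h) : 0 < bdryFun h p := by
  have h1 := one_sub_norm_sq_pos hp.1
  have h2 : 0 < -p.2 := by linarith [hp.2.2]
  have h3 : 0 < h + p.2 := by linarith [hp.2.1]
  unfold bdryFun; positivity

lemma isCompact_bdryFun_ge (h : ℝ) {c : ℝ} (hc : 0 < c) :
    IsCompact {p ∈ cylinder h | c ≤ bdryFun h p} := by
  have h1 : {p ∈ cylinder h | c ≤ bdryFun h p} =
      (Metric.closedBall 0 1 ×ˢ Icc (-h) 0) ∩ {p | c ≤ bdryFun h p} := by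
    ext ⟨x, z⟩
    simp only [cylinder, disc, mem_ofPred_eq, mem_prod, Metric.mem_ball, dist_zero_right, mem_Ioo,
      mem_inter_iff, Metric.mem_closedBall, mem_Icc]
    constructor
    · rintro ⟨⟨h1, h2, h3⟩, h4⟩
      exact ⟨⟨h1.le, h2.le, h3.le⟩, h4⟩
    · rintro ⟨⟨h1, h2, h3⟩, h4⟩
      refine ⟨⟨lt_of_le_of_ne h1 ?_, lt_of_le_of_ne h2 ?_, lt_of_le_of_ne h3 ?_⟩, h4⟩
      · rintro h5; simp [bdryFun, h5] at h4; linarith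
      · rintro h5; simp [bdryFun, ← h5] at h4; linarith
      · rintro h5; simp [bdryFun, h5] at h4; linarith
  rw [h1]
  exact ((isCompact_closedBall 0 1).prod isCompact_Icc).inter_right
    (isClosed_le continuous_const (contDiff_bdryFun h).continuous)

lemma exists_bound_deriv_smoothTransition :
    ∃ B : ℝ, 0 ≤ B ∧ ∀ t, |deriv Real.smoothTransition t| ≤ B := by
  have hc : Continuous (deriv Real.smoothTransition) :=
    (Real.smoothTransition.contDiff (n := 1)).continuous_deriv le_rfl
  obtain ⟨B, hB⟩ := isCompact_Icc.exists_bound_of_continuousOn (s := Icc 0 1) hc.continuousOn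
  refine ⟨max B 0, le_max_right _ _, fun t => ?_⟩
  by_cases ht : t ∈ Icc (0 : ℝ) 1
  · exact (hB t ht).trans (le_max_left _ _)
  · have h0 : deriv Real.smoothTransition t = 0 := by
      rw [mem_Icc, not_and_or, not_le, not_le] at ht
      rcases ht with ht | ht
      · have : Real.smoothTransition =ᶠ[nhds t] fun _ => 0 := by
          filter_upwards [eventually_lt_nhds ht] with s hs
          exact Real.smoothTransition.zero_of_nonpos hs.le
        rw [this.deriv_eq]; simp
      · have : Real.smoothTransition =ᶠ[nhds t] fun _ => 1 := by
          filter_upwards [eventually_gt_nhds ht] with s hs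
          exact Real.smoothTransition.one_of_one_le hs.le
        rw [this.deriv_eq]; simp
    simp [h0]

lemma deriv_smoothTransition_of_one_lt {t : ℝ} (ht : 1 < t) :
    deriv Real.smoothTransition t = 0 := by
  have : Real.smoothTransition =ᶠ[nhds t] fun _ => 1 := by
    filter_upwards [eventually_gt_nhds ht] with s hs
    exact Real.smoothTransition.one_of_one_le hs.le
  rw [this.deriv_eq]; simp

/-- Integration by parts against a function that is smooth on the open cylinder only, without a
boundary term. The test function `f` is multiplied by the cut-off `S(n e - 1)`, `e = bdryFun h` and
`S` a smooth step; since `n S'(n e - 1)` is nonzero only where `n e ≤ 2`, the derivative of the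
cut-off is at most a constant times `|∂ᵥ e| / e`, and dominated convergence applies. -/
lemma HasWeakDirDeriv.integral_eq {h : ℝ} {v : ℂ × ℝ} {w g f : ℂ × ℝ → ℂ}
    (hwg : HasWeakDirDeriv h v w g) (hf : ContDiffOn ℝ ∞ f (cylinder h))
    (h1 : IntegrableOn (fun p => w p * fderiv ℝ f p v) (cylinder h))
    (h2 : IntegrableOn (fun p => g p * f p) (cylinder h))
    (h3 : IntegrableOn (fun p => w p * (f p * (fderiv ℝ (bdryFun h) p v / bdryFun h p : ℝ)))
      (cylinder h)) :
    ∫ p in cylinder h, w p * fderiv ℝ f p v = -∫ p in cylinder h, g p * f p := by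
  obtain ⟨B, hB0, hB⟩ := exists_bound_deriv_smoothTransition
  have he := contDiff_bdryFun h
  have hS : ContDiff ℝ ∞ Real.smoothTransition := Real.smoothTransition.contDiff
  have hS' : Continuous (deriv Real.smoothTransition) :=
    (Real.smoothTransition.contDiff (n := 1)).continuous_deriv le_rfl
  set χ : ℕ → ℂ × ℝ → ℝ := fun n p => Real.smoothTransition (n * bdryFun h p - 1) with hχ
  have hχc : ∀ n, ContDiff ℝ ∞ (χ n) := fun n =>
    hS.comp ((contDiff_const.mul he).sub contDiff_const)
  set φ : ℕ → ℂ × ℝ → ℂ := fun n => (cylinder h).indicator fun p => (χ n p : ℂ) * f p with hφ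
  have hχf : ∀ n, ContDiffOn ℝ ∞ (fun p => (χ n p : ℂ) * f p) (cylinder h) := fun n =>
    ((Complex.ofRealCLM.contDiff.comp (hχc n)).contDiffOn).mul hf
  have hsupp : ∀ n, ∃ K : Set (ℂ × ℝ), IsCompact K ∧ K ⊆ cylinder h ∧ ∀ p ∉ K, φ n p = 0 := by
    intro n
    refine ⟨{p ∈ cylinder h | 1 / ((n : ℝ) + 1) ≤ bdryFun h p},
      isCompact_bdryFun_ge h (by positivity), fun p hp => hp.1, fun p hp => ?_⟩
    by_cases hpc : p ∈ cylinder h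
    · have hlt : bdryFun h p < 1 / ((n : ℝ) + 1) := by
        by_contra hcon
        exact hp ⟨hpc, not_lt.1 hcon⟩
      have hpos := bdryFun_pos hpc
      rw [lt_div_iff₀ (by positivity)] at hlt
      have : χ n p = 0 := Real.smoothTransition.zero_of_nonpos (by nlinarith)
      simp [φ, hpc, this]
    · simp [φ, hpc]
  have hts : ∀ n, ∃ K : Set (ℂ × ℝ), IsCompact K ∧ K ⊆ cylinder h ∧ tsupport (φ n) ⊆ K := by
    intro n
    obtain ⟨K, hK, hKc, hK0⟩ := hsupp n
    refine ⟨K, hK, hKc, closure_minimal (fun p hp => ?_) hK.isClosed⟩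
    by_contra hcon
    exact hp (hK0 p hcon)
  have hφs : ∀ n, ContDiff ℝ ∞ (φ n) := by
    intro n
    obtain ⟨K, hK, hKc, hK0⟩ := hts n
    refine contDiff_iff_contDiffAt.2 fun p => ?_
    by_cases hp : p ∈ cylinder h
    · have hn := (isOpen_cylinder h).mem_nhds hp
      refine ((hχf n).contDiffAt hn).congr_of_eventuallyEq ?_
      filter_upwards [hn] with q hq
      simp [φ, hq]
    · have hn : (tsupport (φ n))ᶜ ∈ nhds p :=
        (isClosed_tsupport _).isOpen_compl.mem_nhds fun hcon => hp (hKc (hK0 hcon))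
      refine (contDiffAt_const (c := (0 : ℂ))).congr_of_eventuallyEq ?_
      filter_upwards [hn] with q hq
      exact image_eq_zero_of_notMem_tsupport hq
  have hid : ∀ n : ℕ, ∫ p in cylinder h, w p * dirDeriv v (φ n) p =
      -∫ p in cylinder h, g p * φ n p := by
    intro n
    obtain ⟨K, hK, hKc, hK0⟩ := hts n
    exact hwg (φ n) (hφs n) (hK.of_isClosed_subset (isClosed_tsupport _) hK0) (hK0.trans hKc)
  -- the derivative of the truncated test function, split by the product rule
  have hD : ∀ n : ℕ, ∀ p ∈ cylinder h, w p * dirDeriv v (φ n) p =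
      (χ n p : ℂ) * (w p * fderiv ℝ f p v) +
      ((n * deriv Real.smoothTransition (n * bdryFun h p - 1) * bdryFun h p : ℝ) : ℂ) *
        (w p * (f p * (fderiv ℝ (bdryFun h) p v / bdryFun h p : ℝ))) := by
    intro n p hp
    have hn := (isOpen_cylinder h).mem_nhds hp
    have hfd : HasFDerivAt f (fderiv ℝ f p) p :=
      ((hf.contDiffAt hn).differentiableAt (by simp)).hasFDerivAt
    have hed : HasFDerivAt (bdryFun h) (fderiv ℝ (bdryFun h) p) p :=
      (he.differentiable (by simp) p).hasFDerivAt
    have hSd : HasDerivAt Real.smoothTransition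
        (deriv Real.smoothTransition (n * bdryFun h p - 1)) (n * bdryFun h p - 1) :=
      ((hS.differentiable (by simp)) _).hasDerivAt
    have hχd := hSd.comp_hasFDerivAt p ((hed.const_mul (n : ℝ)).sub_const 1)
    have hm := (Complex.ofRealCLM.hasFDerivAt.comp p hχd).mul hfd
    have heq : φ n =ᶠ[nhds p] fun q => (χ n q : ℂ) * f q := by
      filter_upwards [hn] with q hq
      simp [φ, hq]
    have hfder : fderiv ℝ (fun q => (χ n q : ℂ) * f q) p = _ := hm.fderiv
    have hne : (bdryFun h p : ℂ) ≠ 0 := by exact_mod_cast (bdryFun_pos hp).ne'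
    rw [dirDeriv, heq.fderiv_eq, hfder]
    simp [hχ]
    field_simp
  have hlimL : Tendsto (fun n : ℕ => ∫ p in cylinder h, w p * dirDeriv v (φ n) p) atTop
      (nhds (∫ p in cylinder h, w p * fderiv ℝ f p v)) := by
    have hcongr : ∀ n, ∫ p in cylinder h, w p * dirDeriv v (φ n) p = ∫ p in cylinder h,
        ((χ n p : ℂ) * (w p * fderiv ℝ f p v) +
        ((n * deriv Real.smoothTransition (n * bdryFun h p - 1) * bdryFun h p : ℝ) : ℂ) *
          (w p * (f p * (fderiv ℝ (bdryFun h) p v / bdryFun h p : ℝ)))) := fun n =>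
      setIntegral_congr_fun (measurableSet_cylinder h) (hD n)
    simp_rw [hcongr]
    refine tendsto_integral_of_dominated_convergence
      (fun p => ‖w p * fderiv ℝ f p v‖ +
        2 * B * ‖w p * (f p * (fderiv ℝ (bdryFun h) p v / bdryFun h p : ℝ))‖)
      (fun n => ?_) (h1.norm.add (h3.norm.const_mul _)) (fun n => ?_) ?_
    · have c1 : Continuous fun p => (χ n p : ℂ) :=
        Complex.continuous_ofReal.comp (hχc n).continuous
      have c2 : Continuous fun p : ℂ × ℝ =>
          ((n * deriv Real.smoothTransition (n * bdryFun h p - 1) * bdryFun h p : ℝ) : ℂ) := by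
        have := he.continuous
        fun_prop
      exact (c1.aestronglyMeasurable.mul h1.1).add (c2.aestronglyMeasurable.mul h3.1)
    · filter_upwards [ae_restrict_mem (measurableSet_cylinder h)] with p hp
      have hpos := bdryFun_pos hp
      refine (norm_add_le _ _).trans (add_le_add ?_ ?_)
      · rw [norm_mul]
        refine mul_le_of_le_one_left (norm_nonneg _) ?_
        rw [Complex.norm_real, Real.norm_of_nonneg (Real.smoothTransition.nonneg _)]
        exact Real.smoothTransition.le_one _
      · rw [norm_mul _ (w p * _)]
        refine mul_le_mul_of_nonneg_right ?_ (norm_nonneg _)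
        rw [Complex.norm_real, Real.norm_eq_abs, abs_mul, abs_mul, Nat.abs_cast,
          abs_of_pos hpos]
        rcases le_or_gt (n * bdryFun h p) 2 with hle | hgt
        · calc (n : ℝ) * |deriv Real.smoothTransition (n * bdryFun h p - 1)| * bdryFun h p
              = (n * bdryFun h p) * |deriv Real.smoothTransition (n * bdryFun h p - 1)| := by ring
            _ ≤ 2 * B := mul_le_mul hle (hB _) (abs_nonneg _) (by norm_num)
        · rw [deriv_smoothTransition_of_one_lt (by linarith)]
          simpa using hB0
    · filter_upwards [ae_restrict_mem (measurableSet_cylinder h)] with p hp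
      have hpos := bdryFun_pos hp
      refine tendsto_const_nhds.congr' ?_
      obtain ⟨n₀, hn₀⟩ := exists_nat_gt (2 / bdryFun h p)
      filter_upwards [eventually_ge_atTop n₀] with n hn
      have hgt : 2 < n * bdryFun h p := by
        rw [div_lt_iff₀ hpos] at hn₀
        have : (n₀ : ℝ) ≤ n := by exact_mod_cast hn
        nlinarith
      have e1 : χ n p = 1 := Real.smoothTransition.one_of_one_le (by linarith)
      rw [e1, deriv_smoothTransition_of_one_lt (by linarith)]
      simp
  have hlimR : Tendsto (fun n : ℕ => -∫ p in cylinder h, g p * φ n p) atTop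
      (nhds (-∫ p in cylinder h, g p * f p)) := by
    refine Tendsto.neg ?_
    have hcongr : ∀ n, ∫ p in cylinder h, g p * φ n p = ∫ p in cylinder h,
        (χ n p : ℂ) * (g p * f p) := fun n =>
      setIntegral_congr_fun (measurableSet_cylinder h) fun p hp => by
        simp only [φ, indicator_of_mem hp]; ring
    simp_rw [hcongr]
    refine tendsto_integral_of_dominated_convergence (fun p => ‖g p * f p‖)
      (fun n => ?_) h2.norm (fun n => ?_) ?_
    · have c1 : Continuous fun p => (χ n p : ℂ) :=
        Complex.continuous_ofReal.comp (hχc n).continuous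
      exact c1.aestronglyMeasurable.mul h2.1
    · refine ae_of_all _ fun p => ?_
      rw [norm_mul]
      refine mul_le_of_le_one_left (norm_nonneg _) ?_
      rw [Complex.norm_real, Real.norm_of_nonneg (Real.smoothTransition.nonneg _)]
      exact Real.smoothTransition.le_one _
    · filter_upwards [ae_restrict_mem (measurableSet_cylinder h)] with p hp
      have hpos := bdryFun_pos hp
      refine tendsto_const_nhds.congr' ?_
      obtain ⟨n₀, hn₀⟩ := exists_nat_gt (2 / bdryFun h p)
      filter_upwards [eventually_ge_atTop n₀] with n hn
      have hgt : 2 < n * bdryFun h p := by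
        rw [div_lt_iff₀ hpos] at hn₀
        have : (n₀ : ℝ) ≤ n := by exact_mod_cast hn
        nlinarith
      have e1 : χ n p = 1 := Real.smoothTransition.one_of_one_le (by linarith)
      rw [e1]; simp
  exact tendsto_nhds_unique hlimL (by simpa only [hid] using hlimR)

lemma exists_bound_on_cylinder (h : ℝ) {A : ℂ × ℝ → ℂ} (hA : Continuous A) :
    ∃ K : ℝ, ∀ p ∈ cylinder h, ‖A p‖ ≤ K := by
  obtain ⟨K, hK⟩ := ((isCompact_closedBall (0 : ℂ) 1).prod
    (isCompact_Icc (a := -h) (b := 0))).exists_bound_of_continuousOn hA.continuousOn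
  exact ⟨K, fun p hp => hK p ⟨Metric.ball_subset_closedBall hp.1, Ioo_subset_Icc_self hp.2⟩⟩

lemma integrable_mul_continuous {h : ℝ} {w A : ℂ × ℝ → ℂ} (hw : Integrable w (cylMeasure h))
    (hA : Continuous A) : Integrable (fun p => w p * A p) (cylMeasure h) := by
  obtain ⟨K, hK⟩ := exists_bound_on_cylinder h hA
  exact hw.mul_bdd hA.aestronglyMeasurable
    ((ae_mem_cylinder h).mono hK)

/-- Integration by parts in terms of `cylMeasure h`: the test function is `f = σ B`, with
`∂ᵥ f = σ A`, and `f ∂ᵥ e / e = σ E` where `A`, `B`, `E` are continuous up to the boundary. -/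
lemma HasWeakDirDeriv.integral_cylMeasure_eq {h : ℝ} (hh : 0 < h) {v : ℂ × ℝ}
    {w g f A B E : ℂ × ℝ → ℂ} (hwg : HasWeakDirDeriv h v w g)
    (hw : Integrable w (cylMeasure h)) (hg : Integrable g (cylMeasure h))
    (hf : ContDiffOn ℝ ∞ f (cylinder h))
    (hA : Continuous A) (hB : Continuous B) (hE : Continuous E)
    (hfA : ∀ p ∈ cylinder h, fderiv ℝ f p v = (chebWeight h p.2 : ℂ) * A p)
    (hfB : ∀ p ∈ cylinder h, f p = (chebWeight h p.2 : ℂ) * B p)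
    (hfE : ∀ p ∈ cylinder h, f p * (fderiv ℝ (bdryFun h) p v / bdryFun h p : ℝ) =
      (chebWeight h p.2 : ℂ) * E p) :
    ∫ p, w p * A p ∂cylMeasure h = -∫ p, g p * B p ∂cylMeasure h := by
  have hm := measurableSet_cylinder h
  have e1 : ∀ p ∈ cylinder h, (chebWeight h p.2 : ℂ) * (w p * A p) = w p * fderiv ℝ f p v :=
    fun p hp => by rw [hfA p hp]; ring
  have e2 : ∀ p ∈ cylinder h, (chebWeight h p.2 : ℂ) * (g p * B p) = g p * f p :=
    fun p hp => by rw [hfB p hp]; ring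
  have e3 : ∀ p ∈ cylinder h, (chebWeight h p.2 : ℂ) * (w p * E p) =
      w p * (f p * (fderiv ℝ (bdryFun h) p v / bdryFun h p : ℝ)) :=
    fun p hp => by rw [hfE p hp]; ring
  have i1 := integrableOn_chebWeight_mul hh (integrable_mul_continuous hw hA)
  have i2 := integrableOn_chebWeight_mul hh (integrable_mul_continuous hg hB)
  have i3 := integrableOn_chebWeight_mul hh (integrable_mul_continuous hw hE)
  have key := hwg.integral_eq hf ((integrableOn_congr_fun e1 hm).1 i1)
    ((integrableOn_congr_fun e2 hm).1 i2) ((integrableOn_congr_fun e3 hm).1 i3)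
  rw [integral_cylMeasure hh, integral_cylMeasure hh, setIntegral_congr_fun hm e1,
    setIntegral_congr_fun hm e2, key]
  ring

/-! ### Zernike polynomials in the variables `x` and `x̄` -/

/-- The disc polynomial `∑ₖ C(p,k) C(q,k) (xy - 1)^k x^(p-k) y^(q-k)` in two independent variables.
At `y = x̄` it is the Zernike polynomial of degree `p + q` and angular frequency `p - q`, scaled to
be `e^{i(p-q)θ}` on the unit circle. -/
def discPoly (p q : ℕ) (x y : ℂ) : ℂ :=
  ∑ k ∈ Finset.range (p + 1), (p.choose k : ℂ) * (q.choose k : ℂ) *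
    (x * y - 1) ^ k * x ^ (p - k) * y ^ (q - k)

lemma discPoly_eq_sum {p q n : ℕ} (hn : p < n ∨ q < n) (x y : ℂ) :
    discPoly p q x y = ∑ k ∈ Finset.range n, (p.choose k : ℂ) * (q.choose k : ℂ) *
      (x * y - 1) ^ k * x ^ (p - k) * y ^ (q - k) := by
  have key : ∀ N, n ≤ N → (∑ k ∈ Finset.range N, (p.choose k : ℂ) * (q.choose k : ℂ) *
      (x * y - 1) ^ k * x ^ (p - k) * y ^ (q - k)) = ∑ k ∈ Finset.range n,
      (p.choose k : ℂ) * (q.choose k : ℂ) * (x * y - 1) ^ k * x ^ (p - k) * y ^ (q - k) := by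
    intro N hN
    refine (Finset.sum_subset (Finset.range_mono hN) fun k _ hk => ?_).symm
    rw [Finset.mem_range, not_lt] at hk
    rcases hn with hn | hn
    · simp [Nat.choose_eq_zero_of_lt (hn.trans_le hk)]
    · simp [Nat.choose_eq_zero_of_lt (hn.trans_le hk)]
  rw [← key (max n (p + 1)) (le_max_left _ _), discPoly]
  refine Finset.sum_subset (Finset.range_mono (le_max_right _ _)) fun k _ hk => ?_
  rw [Finset.mem_range, not_lt] at hk
  simp [Nat.choose_eq_zero_of_lt (show p < k from hk)]

lemma discPoly_comm (p q : ℕ) (x y : ℂ) : discPoly p q x y = discPoly q p y x := by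
  rw [discPoly_eq_sum (n := q + 1) (Or.inr (Nat.lt_succ_self q)), discPoly]
  refine Finset.sum_congr rfl fun k _ => ?_
  rw [mul_comm y x]; ring

lemma discPoly_zero_zero (x y : ℂ) : discPoly 0 0 x y = 1 := by simp [discPoly]

lemma discPoly_zero_right (p : ℕ) (x y : ℂ) : discPoly p 0 x y = x ^ p := by
  rw [discPoly_eq_sum (n := 1) (Or.inr one_pos)]; simp

lemma cast_sub_mul_choose (p k : ℕ) :
    ((p : ℂ) + 1 - k) * ((p + 1).choose k : ℂ) = (p + 1) * (p.choose k : ℂ) := by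
  rcases le_or_gt k (p + 1) with hk | hk
  · have h1 := Nat.choose_mul_succ_eq p k
    have h2 : ((p + 1 - k : ℕ) : ℂ) = (p : ℂ) + 1 - k := by rw [Nat.cast_sub hk]; push_cast; rfl
    rw [← h2]
    have h3 : ((p.choose k * (p + 1) : ℕ) : ℂ) = ((p + 1).choose k * (p + 1 - k) : ℕ) := by rw [h1]
    push_cast at h3 ⊢
    linear_combination -h3
  · rw [Nat.choose_eq_zero_of_lt hk, Nat.choose_eq_zero_of_lt (by omega)]; simp

lemma cast_succ_mul_choose (p k : ℕ) :
    ((k : ℂ) + 1) * ((p + 1).choose (k + 1) : ℂ) = (p + 1) * (p.choose k : ℂ) := by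
  have h3 : (((p + 1) * p.choose k : ℕ) : ℂ) = ((p + 1).choose (k + 1) * (k + 1) : ℕ) := by
    rw [Nat.add_one_mul_choose_eq]
  push_cast at h3
  linear_combination -h3

lemma cast_sub_mul_choose' (p k : ℕ) :
    ((p : ℂ) - k) * (p.choose k : ℂ) = (k + 1) * (p.choose (k + 1) : ℂ) := by
  have h1 := cast_sub_mul_choose p k
  have h2 := cast_succ_mul_choose p k
  have h3 : ((p + 1).choose (k + 1) : ℂ) = p.choose k + p.choose (k + 1) := by
    rw [Nat.choose_succ_succ]; push_cast; rfl
  rw [h3] at h2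
  linear_combination -h2

/-- Multiplication by `x` in the system of disc polynomials, for positive second index. -/
lemma mul_discPoly_succ (p q : ℕ) (x y : ℂ) :
    ((p : ℂ) + q + 2) * (x * discPoly p (q + 1) x y) =
      (p + 1) * discPoly (p + 1) (q + 1) x y + (q + 1) * discPoly p q x y := by
  set m : ℕ → ℂ := fun k => (x * y - 1) ^ k * x ^ (p + 1 - k) * y ^ (q + 1 - k) with hm
  -- all three polynomials are expanded in the functions `m k`
  have e1 : x * discPoly p (q + 1) x y =
      ∑ k ∈ Finset.range (p + 2), (p.choose k : ℂ) * ((q + 1).choose k : ℂ) * m k := by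
    rw [discPoly_eq_sum (n := p + 2) (Or.inl (by omega)), Finset.mul_sum]
    refine Finset.sum_congr rfl fun k _ => ?_
    rcases le_or_gt k p with hk | hk
    · rw [hm]; simp only [Nat.sub_add_comm hk, pow_succ x (p - k)]; ring
    · simp [Nat.choose_eq_zero_of_lt hk]
  have e2 : discPoly (p + 1) (q + 1) x y =
      ∑ k ∈ Finset.range (p + 2), ((p + 1).choose k : ℂ) * ((q + 1).choose k : ℂ) * m k := by
    rw [discPoly]
    exact Finset.sum_congr rfl fun k _ => by rw [hm]; ring
  have e3 : (q + 1) * discPoly p q x y =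
      ∑ k ∈ Finset.range (p + 2), (((p.choose k : ℂ) * ((q + 1 - k) * ((q + 1).choose k : ℂ)) -
        (k * ((p + 1).choose k : ℂ) - k * p.choose k) * ((q + 1).choose k : ℂ)) * m k) := by
    have a1 : (q + 1) * discPoly p q x y = ∑ k ∈ Finset.range (p + 2),
        (p.choose k : ℂ) * ((q + 1) * (q.choose k : ℂ)) *
          ((x * y - 1) ^ k * x ^ (p - k) * y ^ (q - k)) := by
      rw [discPoly_eq_sum (n := p + 2) (Or.inl (by omega)), Finset.mul_sum]
      exact Finset.sum_congr rfl fun k _ => by ring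
    have a2 : ∀ k, (p.choose k : ℂ) * ((q + 1) * (q.choose k : ℂ)) *
          ((x * y - 1) ^ k * x ^ (p - k) * y ^ (q - k)) =
        (p.choose k : ℂ) * ((q + 1 - k) * ((q + 1).choose k : ℂ)) * m k -
        (p.choose k : ℂ) * ((k + 1) * ((q + 1).choose (k + 1) : ℂ)) * m (k + 1) := by
      intro k
      rw [cast_sub_mul_choose, cast_succ_mul_choose]
      rcases le_or_gt k p with hk | hk
      · rcases le_or_gt k q with hk' | hk'
        · rw [hm]
          simp only [Nat.sub_add_comm hk, Nat.sub_add_comm hk', Nat.add_sub_add_right, pow_succ]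
          ring
        · simp [Nat.choose_eq_zero_of_lt hk']
      · simp [Nat.choose_eq_zero_of_lt hk]
    have a3 : ∑ k ∈ Finset.range (p + 2),
        (p.choose k : ℂ) * ((k + 1) * ((q + 1).choose (k + 1) : ℂ)) * m (k + 1) =
        ∑ k ∈ Finset.range (p + 2),
        (k * ((p + 1).choose k : ℂ) - k * p.choose k) * ((q + 1).choose k : ℂ) * m k := by
      rw [Finset.sum_range_succ, Finset.sum_range_succ' _ (p + 1)]
      simp only [Nat.choose_eq_zero_of_lt (Nat.lt_succ_self p)]
      simp only [Nat.cast_zero, zero_mul, sub_zero, add_zero]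
      refine Finset.sum_congr rfl fun k _ => ?_
      rw [Nat.choose_succ_succ p k]
      push_cast; ring
    rw [a1, Finset.sum_congr rfl fun k _ => a2 k, Finset.sum_sub_distrib, a3,
      ← Finset.sum_sub_distrib]
    exact Finset.sum_congr rfl fun k _ => by ring
  rw [e1, e2, e3, Finset.mul_sum, Finset.mul_sum, ← Finset.sum_add_distrib]
  refine Finset.sum_congr rfl fun k _ => ?_
  linear_combination (-((q + 1).choose k : ℂ) * m k) * cast_sub_mul_choose p k

/-- Multiplication by `x` in the system of disc polynomials. -/
lemma mul_discPoly (p q : ℕ) (x y : ℂ) :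
    ((p : ℂ) + q + 1) * (x * discPoly p q x y) =
      (p + 1) * discPoly (p + 1) q x y + q * discPoly p (q - 1) x y := by
  rcases q with _ | q
  · simp only [discPoly_zero_right]; push_cast; ring
  · have := mul_discPoly_succ p q x y
    simp only [Nat.add_sub_cancel]
    push_cast
    linear_combination this

lemma hasDerivAt_discPoly_succ (p q : ℕ) (x y : ℂ) :
    HasDerivAt (fun x => discPoly (p + 1) q x y)
      (∑ k ∈ Finset.range (p + 1), (p + 1) * (p.choose k : ℂ) * ((q + 1).choose (k + 1) : ℂ) *
        ((x * y - 1) ^ k * x ^ (p - k) * y ^ (q - k))) x := by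
  have h1 : ∀ k ∈ Finset.range (p + 2), HasDerivAt (fun x : ℂ => ((p + 1).choose k : ℂ) *
      (q.choose k : ℂ) * (x * y - 1) ^ k * x ^ (p + 1 - k) * y ^ (q - k))
      (((p + 1).choose k : ℂ) * (q.choose k : ℂ) * ((k : ℂ) * (x * y - 1) ^ (k - 1) * y *
        x ^ (p + 1 - k) + (x * y - 1) ^ k * ((p + 1 - k : ℕ) * x ^ (p + 1 - k - 1))) *
        y ^ (q - k)) x := by
    intro k _
    have t1 : HasDerivAt (fun x : ℂ => x * y - 1) y x := by
      simpa using ((hasDerivAt_id x).mul_const y).sub_const 1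
    have t2 := (((t1.pow k).const_mul (((p + 1).choose k : ℂ) * (q.choose k : ℂ))).mul
      (hasDerivAt_pow (p + 1 - k) x)).mul_const (y ^ (q - k))
    refine t2.congr_deriv ?_
    simp only [Pi.pow_apply]
    ring
  refine (HasDerivAt.fun_sum h1).congr_deriv ?_
  set n : ℕ → ℂ := fun k => (x * y - 1) ^ k * x ^ (p - k) * y ^ (q - k) with hn
  have h2 : ∀ k ∈ Finset.range (p + 2), (((p + 1).choose k : ℂ) * (q.choose k : ℂ) *
      ((k : ℂ) * (x * y - 1) ^ (k - 1) * y *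
        x ^ (p + 1 - k) + (x * y - 1) ^ k * ((p + 1 - k : ℕ) * x ^ (p + 1 - k - 1))) *
        y ^ (q - k)) = (k : ℂ) * ((p + 1).choose k : ℂ) * (q.choose k : ℂ) * n (k - 1) +
          (p + 1) * (p.choose k : ℂ) * (q.choose k : ℂ) * n k := by
    intro k hk
    have hk : k ≤ p + 1 := by simpa [Nat.lt_succ_iff] using hk
    rw [← cast_sub_mul_choose, Nat.cast_sub hk, Nat.sub_right_comm, hn]
    rcases le_or_gt k q with hkq | hkq
    · rcases k with _ | k
      · simp; ring
      · have e1 : q - k = q - (k + 1) + 1 := by omega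
        simp only [Nat.add_sub_cancel, e1, pow_succ y, Nat.add_sub_add_right]
        push_cast; ring
    · simp [Nat.choose_eq_zero_of_lt hkq]
  rw [Finset.sum_congr rfl h2, Finset.sum_add_distrib, Finset.sum_range_succ',
    Finset.sum_range_succ _ (p + 1)]
  simp only [Nat.choose_eq_zero_of_lt (Nat.lt_succ_self p), Nat.add_sub_cancel]
  simp only [Nat.cast_zero, zero_mul, mul_zero, add_zero]
  rw [← Finset.sum_add_distrib]
  refine Finset.sum_congr rfl fun k _ => ?_
  push_cast
  rw [cast_succ_mul_choose, Nat.choose_succ_succ q k]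
  push_cast; ring

/-- The derivative identity behind all integrations by parts on the disc:
`∂ₓ (Z_{p+1,q+1} - Z_{p,q}) = (p + q + 2) Z_{p,q+1}`. -/
lemma hasDerivAt_discPoly_sub (p q : ℕ) (x y : ℂ) :
    HasDerivAt (fun x => discPoly (p + 1) (q + 1) x y - discPoly p q x y)
      (((p : ℂ) + q + 2) * discPoly p (q + 1) x y) x := by
  set n : ℕ → ℂ := fun k => (x * y - 1) ^ k * x ^ (p - k) * y ^ (q + 1 - k) with hn
  have hp : HasDerivAt (fun x => discPoly p q x y)
      (∑ k ∈ Finset.range (p + 1), ((p - k) * (p.choose k : ℂ) * ((q + 1).choose (k + 1) : ℂ) * n k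
        - k * (p.choose k : ℂ) * ((q + 1).choose k : ℂ) * n k)) x := by
    rcases p with _ | p
    · have : (fun x => discPoly 0 q x y) = fun _ => y ^ q := by
        funext x; rw [discPoly_comm, discPoly_zero_right]
      rw [this]
      simpa using hasDerivAt_const x (y ^ q)
    · refine (hasDerivAt_discPoly_succ p q x y).congr_deriv ?_
      have a2 : ∀ k ∈ Finset.range (p + 1), (p + 1) * (p.choose k : ℂ) *
          ((q + 1).choose (k + 1) : ℂ) * ((x * y - 1) ^ k * x ^ (p - k) * y ^ (q - k)) =
          (p + 1 - k) * ((p + 1).choose k : ℂ) * ((q + 1).choose (k + 1) : ℂ) * n k -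
          (k + 1) * ((p + 1).choose (k + 1) : ℂ) * ((q + 1).choose (k + 1) : ℂ) * n (k + 1) := by
        intro k hk
        have hk : k ≤ p := by simpa [Nat.lt_succ_iff] using hk
        rw [cast_sub_mul_choose, cast_succ_mul_choose, hn]
        rcases le_or_gt k q with hk' | hk'
        · simp only [Nat.sub_add_comm hk, Nat.sub_add_comm hk', Nat.add_sub_add_right, pow_succ]
          ring
        · simp [Nat.choose_eq_zero_of_lt (show q + 1 < k + 1 by omega)]
      rw [Finset.sum_congr rfl a2, Finset.sum_sub_distrib, Finset.sum_sub_distrib,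
        Finset.sum_range_succ _ (p + 1), Finset.sum_range_succ' _ (p + 1)]
      push_cast
      simp
  refine ((hasDerivAt_discPoly_succ p (q + 1) x y).sub hp).congr_deriv ?_
  rw [discPoly, Finset.mul_sum, ← Finset.sum_sub_distrib]
  refine Finset.sum_congr rfl fun k _ => ?_
  have c1 := cast_sub_mul_choose' (q + 1) k
  rw [Nat.choose_succ_succ (q + 1) k]
  push_cast at c1 ⊢
  rw [hn]
  linear_combination (-(p.choose k : ℂ) * n k) * c1

/-- `Z_{p+1,q+1} - Z_{p,q}` vanishes on the unit circle, with a polynomial quotient by `1 - |x|²`. The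
factor `1 - |x|²` absorbs the singularity that the cut-off produces at the lateral boundary. -/
lemma exists_discPoly_sub_eq (p q : ℕ) : ∃ G : ℂ × ℂ → ℂ, Continuous G ∧
    ∀ x y, discPoly (p + 1) (q + 1) x y - discPoly p q x y = (1 - x * y) * G (x, y) := by
  refine ⟨fun z => -(z.1 ^ p * z.2 ^ q + ∑ k ∈ Finset.range (p + 1),
    ((p + 1).choose (k + 1) : ℂ) * ((q + 1).choose (k + 1) : ℂ) * (z.1 * z.2 - 1) ^ k *
      z.1 ^ (p - k) * z.2 ^ (q - k) - ∑ k ∈ Finset.range p,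
    (p.choose (k + 1) : ℂ) * (q.choose (k + 1) : ℂ) * (z.1 * z.2 - 1) ^ k *
      z.1 ^ (p - (k + 1)) * z.2 ^ (q - (k + 1))), by fun_prop, fun x y => ?_⟩
  have e1 : discPoly (p + 1) (q + 1) x y = x ^ (p + 1) * y ^ (q + 1) + (x * y - 1) *
      ∑ k ∈ Finset.range (p + 1), ((p + 1).choose (k + 1) : ℂ) * ((q + 1).choose (k + 1) : ℂ) *
        (x * y - 1) ^ k * x ^ (p - k) * y ^ (q - k) := by
    rw [discPoly, Finset.sum_range_succ', Finset.mul_sum, add_comm]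
    congr 1
    · simp
    · exact Finset.sum_congr rfl fun k _ => by simp only [Nat.add_sub_add_right]; ring
  have e2 : discPoly p q x y = x ^ p * y ^ q + (x * y - 1) *
      ∑ k ∈ Finset.range p, (p.choose (k + 1) : ℂ) * (q.choose (k + 1) : ℂ) *
        (x * y - 1) ^ k * x ^ (p - (k + 1)) * y ^ (q - (k + 1)) := by
    rw [discPoly, Finset.sum_range_succ', Finset.mul_sum, add_comm]
    congr 1
    · simp
    · exact Finset.sum_congr rfl fun k _ => by ring
  rw [e1, e2]
  ring

/-! ### Coefficients of weak derivatives -/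

/-- The Chebyshev polynomial `T_k` in the coordinate `t = tCoord h z`. -/
def cheb (h : ℝ) (k : ℕ) (z : ℝ) : ℝ := (Polynomial.Chebyshev.T ℝ k).eval (tCoord h z)

/-- The disc polynomial on the disc itself, `y = x̄`. -/
def discFun (p q : ℕ) (x : ℂ) : ℂ := discPoly p q x (starRingEnd ℂ x)

/-- The polynomial `Z_{p,q}(x, x̄) T_k(t)` on the cylinder. -/
def tensorFun (h : ℝ) (p q k : ℕ) (P : ℂ × ℝ) : ℂ := discFun p q P.1 * (cheb h k P.2 : ℂ)

/-- The moment `∫ w Z_{p,q} T_k dμ`. -/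
def moment (h : ℝ) (p q k : ℕ) (w : ℂ × ℝ → ℂ) : ℂ :=
  ∫ P, w P * tensorFun h p q k P ∂cylMeasure h

lemma continuous_cheb (h : ℝ) (k : ℕ) : Continuous (cheb h k) :=
  (Polynomial.continuous _).comp (continuous_tCoord h)

lemma contDiff_cheb (h : ℝ) (k : ℕ) : ContDiff ℝ ∞ (cheb h k) :=
  (Polynomial.contDiff_aeval (𝕜 := ℝ) (Polynomial.Chebyshev.T ℝ k) ∞).comp (contDiff_tCoord h)

lemma contDiff_discPoly (p q : ℕ) : ContDiff ℂ ∞ fun z : ℂ × ℂ => discPoly p q z.1 z.2 := by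
  unfold discPoly; fun_prop

lemma contDiff_discFun (p q : ℕ) : ContDiff ℝ ∞ (discFun p q) := by
  have hc : ContDiff ℝ ∞ (starRingEnd ℂ) := Complex.conjCLE.contDiff
  unfold discFun discPoly; fun_prop

lemma continuous_discFun (p q : ℕ) : Continuous (discFun p q) := (contDiff_discFun p q).continuous

lemma continuous_tensorFun (h : ℝ) (p q k : ℕ) : Continuous (tensorFun h p q k) := by
  have h1 := continuous_discFun p q
  have h2 := continuous_cheb h k
  unfold tensorFun; fun_prop

lemma contDiffOn_chebWeight {h : ℝ} (hh : 0 < h) : ContDiffOn ℝ ∞ (chebWeight h) (Ioo (-h) 0) := by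
  have h1 : ContDiffOn ℝ ∞ (fun z => (√(1 - tCoord h z ^ 2))⁻¹) (Ioo (-h) 0) := by
    refine ContDiffOn.inv (ContDiffOn.sqrt ?_ fun z hz => (one_sub_tCoord_sq_pos hh hz).ne')
      fun z hz => (Real.sqrt_pos.2 (one_sub_tCoord_sq_pos hh hz)).ne'
    exact (contDiff_const.sub ((contDiff_tCoord h).pow 2)).contDiffOn
  exact h1.congr fun z hz => chebWeight_eq hh hz

/-- The directional derivative of `Z_{p+1,q+1} - Z_{p,q}` on the disc. -/
lemma fderiv_discFun_sub (p q : ℕ) (x v : ℂ) :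
    fderiv ℝ (fun x => discFun (p + 1) (q + 1) x - discFun p q x) x v =
      ((p : ℂ) + q + 2) * (v * discFun p (q + 1) x +
        starRingEnd ℂ v * discFun (p + 1) q x) := by
  set F : ℂ × ℂ → ℂ := fun z => discPoly (p + 1) (q + 1) z.1 z.2 - discPoly p q z.1 z.2 with hF
  have hFd : HasFDerivAt F (fderiv ℂ F (x, starRingEnd ℂ x)) (x, starRingEnd ℂ x) :=
    ((((contDiff_discPoly _ _).sub (contDiff_discPoly _ _)).differentiable (by simp))
      _).hasFDerivAt
  set L := fderiv ℂ F (x, starRingEnd ℂ x)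
  have h1 : L (1, 0) = ((p : ℂ) + q + 2) * discFun p (q + 1) x := by
    have := hFd.comp_hasDerivAt x ((hasDerivAt_id x).prodMk (hasDerivAt_const x (starRingEnd ℂ x)))
    exact this.unique (hasDerivAt_discPoly_sub p q x (starRingEnd ℂ x))
  have h2 : L (0, 1) = ((p : ℂ) + q + 2) * discFun (p + 1) q x := by
    have := hFd.comp_hasDerivAt (starRingEnd ℂ x)
      ((hasDerivAt_const (starRingEnd ℂ x) x).prodMk (hasDerivAt_id (starRingEnd ℂ x)))
    have h3 := hasDerivAt_discPoly_sub q p (starRingEnd ℂ x) x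
    simp only [discPoly_comm q p, discPoly_comm (q + 1) (p + 1), discPoly_comm q (p + 1)] at h3
    rw [add_comm (q : ℂ)] at h3
    exact this.unique h3
  have hc : HasFDerivAt (fun x : ℂ => (x, starRingEnd ℂ x))
      ((ContinuousLinearMap.id ℝ ℂ).prod (Complex.conjCLE : ℂ →L[ℝ] ℂ)) x :=
    (hasFDerivAt_id x).prodMk Complex.conjCLE.hasFDerivAt
  have h3 := (hFd.restrictScalars ℝ).comp x hc
  have h4 : fderiv ℝ (fun x => discFun (p + 1) (q + 1) x - discFun p q x) x = _ := h3.fderiv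
  rw [h4]
  have h5 : ((v, starRingEnd ℂ v) : ℂ × ℂ) = v • (1, 0) + starRingEnd ℂ v • (0, 1) := by simp
  change L (v, starRingEnd ℂ v) = _
  rw [h5, map_add, map_smul, map_smul, h1, h2]
  simp only [smul_eq_mul]; ring

lemma fderiv_bdryFun_disc (h : ℝ) (p : ℂ × ℝ) (v : ℂ) :
    fderiv ℝ (bdryFun h) p (v, 0) = -2 * inner ℝ p.1 v * (-p.2 * (h + p.2)) := by
  have h1 : HasFDerivAt (fun P : ℂ × ℝ => ‖P.1‖ ^ 2) _ p :=
    (hasStrictFDerivAt_norm_sq p.1).hasFDerivAt.comp p hasFDerivAt_fst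
  have hs : HasFDerivAt (fun P : ℂ × ℝ => P.2) (ContinuousLinearMap.snd ℝ ℂ ℝ) p := hasFDerivAt_snd
  have h2 := (h1.const_sub 1).mul (hs.neg.mul (hs.const_add h))
  have h3 : fderiv ℝ (bdryFun h) p = _ := h2.fderiv
  rw [h3]
  simp
  ring

lemma fderiv_bdryFun_axial (h : ℝ) (p : ℂ × ℝ) :
    fderiv ℝ (bdryFun h) p (0, 1) = (1 - ‖p.1‖ ^ 2) * (-(h + 2 * p.2)) := by
  have h1 : HasFDerivAt (fun P : ℂ × ℝ => ‖P.1‖ ^ 2) _ p :=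
    (hasStrictFDerivAt_norm_sq p.1).hasFDerivAt.comp p hasFDerivAt_fst
  have hs : HasFDerivAt (fun P : ℂ × ℝ => P.2) (ContinuousLinearMap.snd ℝ ℂ ℝ) p := hasFDerivAt_snd
  have h2 := (h1.const_sub 1).mul (hs.neg.mul (hs.const_add h))
  have h3 : fderiv ℝ (bdryFun h) p = _ := h2.fderiv
  rw [h3]
  simp
  ring

lemma fderiv_comp_snd_mul_comp_fst {a : ℝ → ℂ} {b : ℂ → ℂ} {p : ℂ × ℝ} {v : ℂ × ℝ}
    (ha : DifferentiableAt ℝ a p.2) (hb : DifferentiableAt ℝ b p.1) :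
    fderiv ℝ (fun P : ℂ × ℝ => a P.2 * b P.1) p v =
      a p.2 * fderiv ℝ b p.1 v.1 + b p.1 * (v.2 * deriv a p.2) := by
  have h1 := (ha.hasFDerivAt.comp p hasFDerivAt_snd).mul (hb.hasFDerivAt.comp p hasFDerivAt_fst)
  have h2 : fderiv ℝ (fun P : ℂ × ℝ => a P.2 * b P.1) p = _ := h1.fderiv
  have h3 : fderiv ℝ a p.2 v.2 = v.2 * deriv a p.2 := by
    rw [fderiv_eq_smul_deriv, Complex.real_smul]
  rw [h2]
  simp [h3]

lemma integrable_mul_tensorFun {h : ℝ} {w : ℂ × ℝ → ℂ} (hw : Integrable w (cylMeasure h))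
    (p q k : ℕ) : Integrable (fun P => w P * tensorFun h p q k P) (cylMeasure h) :=
  integrable_mul_continuous hw (continuous_tensorFun h p q k)

/-- Integration by parts in the direction `v` of the disc. -/
lemma moment_disc_aux {h : ℝ} (hh : 0 < h) {v : ℂ} {w g : ℂ × ℝ → ℂ}
    (hwg : HasWeakDirDeriv h (v, 0) w g) (hw : Integrable w (cylMeasure h))
    (hg : Integrable g (cylMeasure h)) (p q k : ℕ) :
    ((p : ℂ) + q + 2) * (v * moment h p (q + 1) k w + starRingEnd ℂ v * moment h (p + 1) q k w) =
      -(moment h (p + 1) (q + 1) k g - moment h p q k g) := by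
  obtain ⟨G, hG, hGe⟩ := exists_discPoly_sub_eq p q
  have hcσ : ContDiffOn ℝ ∞ (fun z => ((chebWeight h z * cheb h k z : ℝ) : ℂ)) (Ioo (-h) 0) :=
    Complex.ofRealCLM.contDiff.comp_contDiffOn
      ((contDiffOn_chebWeight hh).mul (contDiff_cheb h k).contDiffOn)
  have hcD : ContDiff ℝ ∞ (fun x => discFun (p + 1) (q + 1) x - discFun p q x) :=
    (contDiff_discFun _ _).sub (contDiff_discFun _ _)
  have k1 := continuous_cheb h k
  have k2 := continuous_discFun p (q + 1)
  have k3 := continuous_discFun (p + 1) q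
  have k4 := continuous_discFun (p + 1) (q + 1)
  have k5 := continuous_discFun p q
  have key := hwg.integral_cylMeasure_eq hh hw hg
    (f := fun P => ((chebWeight h P.2 * cheb h k P.2 : ℝ) : ℂ) *
      (discFun (p + 1) (q + 1) P.1 - discFun p q P.1))
    (A := fun P => ((p : ℂ) + q + 2) * (v * discFun p (q + 1) P.1 +
        starRingEnd ℂ v * discFun (p + 1) q P.1) * (cheb h k P.2 : ℂ))
    (B := fun P => (discFun (p + 1) (q + 1) P.1 - discFun p q P.1) * (cheb h k P.2 : ℂ))
    (E := fun P => -2 * (inner ℝ P.1 v : ℝ) * G (P.1, starRingEnd ℂ P.1) * (cheb h k P.2 : ℂ))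
    ?_ ?_ ?_ ?_ ?_ ?_ ?_
  · have e1 : ∀ P, w P * (((p : ℂ) + q + 2) * (v * discFun p (q + 1) P.1 +
        starRingEnd ℂ v * discFun (p + 1) q P.1) * (cheb h k P.2 : ℂ)) =
        ((p : ℂ) + q + 2) * v * (w P * tensorFun h p (q + 1) k P) +
        ((p : ℂ) + q + 2) * starRingEnd ℂ v * (w P * tensorFun h (p + 1) q k P) := fun P => by
      unfold tensorFun; ring
    have e2 : ∀ P, g P * ((discFun (p + 1) (q + 1) P.1 - discFun p q P.1) * (cheb h k P.2 : ℂ)) =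
        g P * tensorFun h (p + 1) (q + 1) k P - g P * tensorFun h p q k P := fun P => by
      unfold tensorFun; ring
    simp only [e1, e2] at key
    rw [integral_add ((integrable_mul_tensorFun hw _ _ _).const_mul _)
      ((integrable_mul_tensorFun hw _ _ _).const_mul _),
      integral_sub (integrable_mul_tensorFun hg _ _ _) (integrable_mul_tensorFun hg _ _ _),
      integral_const_mul, integral_const_mul] at key
    unfold moment
    linear_combination key
  · exact (hcσ.comp contDiff_snd.contDiffOn fun P hP => hP.2).mul
      (hcD.comp contDiff_fst).contDiffOn
  · fun_prop
  · fun_prop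
  · have : Continuous fun P : ℂ × ℝ => (inner ℝ P.1 v : ℝ) := continuous_fst.inner continuous_const
    fun_prop
  · intro P hP
    have d1 : DifferentiableAt ℝ (fun z => ((chebWeight h z * cheb h k z : ℝ) : ℂ)) P.2 :=
      (hcσ.contDiffAt (isOpen_Ioo.mem_nhds hP.2)).differentiableAt (by simp)
    rw [fderiv_comp_snd_mul_comp_fst (a := fun z => ((chebWeight h z * cheb h k z : ℝ) : ℂ))
      (b := fun x => discFun (p + 1) (q + 1) x - discFun p q x) d1
      (hcD.differentiable (by simp) _), fderiv_discFun_sub]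
    push_cast; ring
  · intro P _
    push_cast; ring
  · intro P hP
    have h1 := one_sub_norm_sq_pos hP.1
    have h2 : -P.2 ≠ 0 := by linarith [hP.2.2]
    have h3 : h + P.2 ≠ 0 := by linarith [hP.2.1]
    have h4 : fderiv ℝ (bdryFun h) P (v, 0) / bdryFun h P =
        -2 * inner ℝ P.1 v / (1 - ‖P.1‖ ^ 2) := by
      rw [fderiv_bdryFun_disc, bdryFun]
      exact mul_div_mul_right _ _ (mul_ne_zero h2 h3)
    have h5 : (1 : ℂ) - (‖P.1‖ : ℂ) ^ 2 ≠ 0 := by exact_mod_cast h1.ne'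
    have h6 : discFun (p + 1) (q + 1) P.1 - discFun p q P.1 =
        (1 - (‖P.1‖ : ℂ) ^ 2) * G (P.1, starRingEnd ℂ P.1) := by
      rw [discFun, discFun, hGe, Complex.mul_conj']
    rw [h4, h6]
    push_cast
    field_simp

/-- The moments of `w` in terms of those of its weak derivatives `∂_x w`, `∂_y w`, for positive
second index. -/
lemma moment_succ_right {h : ℝ} (hh : 0 < h) {w g₁ g₂ : ℂ × ℝ → ℂ}
    (h1 : HasWeakDirDeriv h (1, 0) w g₁) (h2 : HasWeakDirDeriv h (Complex.I, 0) w g₂)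
    (hw : Integrable w (cylMeasure h)) (hg₁ : Integrable g₁ (cylMeasure h))
    (hg₂ : Integrable g₂ (cylMeasure h)) (p q k : ℕ) :
    ((p : ℂ) + q + 2) * moment h p (q + 1) k w =
      -(1 / 2) * ((moment h (p + 1) (q + 1) k g₁ - moment h p q k g₁) -
        Complex.I * (moment h (p + 1) (q + 1) k g₂ - moment h p q k g₂)) := by
  have e1 := moment_disc_aux hh h1 hw hg₁ p q k
  have e2 := moment_disc_aux hh h2 hw hg₂ p q k
  simp only [map_one, Complex.conj_I] at e1 e2
  linear_combination (1 / 2) * e1 - (Complex.I / 2) * e2 - (1 / 2) * ((p : ℂ) + q + 2) *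
    (moment h (p + 1) q k w - moment h p (q + 1) k w) * Complex.I_sq

/-- The moments of `w` in terms of those of its weak derivatives `∂_x w`, `∂_y w`, for positive
first index. -/
lemma moment_succ_left {h : ℝ} (hh : 0 < h) {w g₁ g₂ : ℂ × ℝ → ℂ}
    (h1 : HasWeakDirDeriv h (1, 0) w g₁) (h2 : HasWeakDirDeriv h (Complex.I, 0) w g₂)
    (hw : Integrable w (cylMeasure h)) (hg₁ : Integrable g₁ (cylMeasure h))
    (hg₂ : Integrable g₂ (cylMeasure h)) (p q k : ℕ) :
    ((p : ℂ) + q + 2) * moment h (p + 1) q k w =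
      -(1 / 2) * ((moment h (p + 1) (q + 1) k g₁ - moment h p q k g₁) +
        Complex.I * (moment h (p + 1) (q + 1) k g₂ - moment h p q k g₂)) := by
  have e1 := moment_disc_aux hh h1 hw hg₁ p q k
  have e2 := moment_disc_aux hh h2 hw hg₂ p q k
  simp only [map_one, Complex.conj_I] at e1 e2
  linear_combination (1 / 2) * e1 + (Complex.I / 2) * e2 - (1 / 2) * ((p : ℂ) + q + 2) *
    (moment h p (q + 1) k w - moment h (p + 1) q k w) * Complex.I_sq

lemma cheb_sub_cheb (h : ℝ) (k : ℕ) (z : ℝ) :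
    (1 - tCoord h z ^ 2) * (Polynomial.Chebyshev.U ℝ k).eval (tCoord h z) =
      1 / 2 * (cheb h k z - cheb h (k + 2) z) := by
  have h1 := congrArg (Polynomial.eval (tCoord h z))
    (Polynomial.Chebyshev.T_eq_X_mul_T_sub_pol_U ℝ k)
  have h2 := congrArg (Polynomial.eval (tCoord h z)) (Polynomial.Chebyshev.T_add_two ℝ k)
  simp only [Polynomial.eval_sub, Polynomial.eval_mul, Polynomial.eval_pow, Polynomial.eval_X,
    Polynomial.eval_one, Polynomial.eval_ofNat] at h1 h2
  unfold cheb
  push_cast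
  linear_combination h1 - (1 / 2) * h2

lemma cheb_eq_cos {h z : ℝ} (k : ℕ) (hz : tCoord h z ∈ Icc (-1) 1) :
    cheb h k z = Real.cos (k * Real.arccos (tCoord h z)) := by
  have h1 := Polynomial.Chebyshev.T_real_cos (Real.arccos (tCoord h z)) k
  rw [Real.cos_arccos hz.1 hz.2] at h1
  rw [cheb, h1]; norm_cast

/-- The moments of `w` in terms of those of its weak derivative `∂_z w`. The test function is
`sin((k+1)θ)` with `cos θ = t`, whose `z`-derivative is a multiple of `σ T_{k+1}`. -/
lemma moment_axial_succ {h : ℝ} (hh : 0 < h) {w g : ℂ × ℝ → ℂ}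
    (hwg : HasWeakDirDeriv h (0, 1) w g) (hw : Integrable w (cylMeasure h))
    (hg : Integrable g (cylMeasure h)) (p q k : ℕ) :
    (2 / h * (k + 1) : ℂ) * moment h p q (k + 1) w =
      -(1 / 2) * (moment h p q k g - moment h p q (k + 2) g) := by
  set θ : ℝ → ℝ := fun z => Real.arccos (tCoord h z) with hθ
  have hcs : ContDiffOn ℝ ∞ (fun z => (Real.sin ((k + 1) * θ z) : ℂ)) (Ioo (-h) 0) := by
    intro z hz
    have ht := tCoord_mem_Ioo hh hz
    have h1 : ContDiffAt ℝ ∞ θ z :=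
      (Real.contDiffAt_arccos ht.1.ne' ht.2.ne).comp z (contDiff_tCoord h).contDiffAt
    have h2 : ContDiffAt ℝ ∞ (fun z => Real.sin ((k + 1) * θ z)) z :=
      Real.contDiff_sin.contDiffAt.comp z (contDiffAt_const.mul h1)
    exact (Complex.ofRealCLM.contDiff.contDiffAt.comp z h2).contDiffWithinAt
  have hsin : ∀ z ∈ Ioo (-h) 0, Real.sin ((k + 1) * θ z) =
      chebWeight h z * ((1 - tCoord h z ^ 2) *
        (Polynomial.Chebyshev.U ℝ k).eval (tCoord h z)) := by
    intro z hz
    have ht := tCoord_mem_Ioo hh hz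
    have hp := one_sub_tCoord_sq_pos hh hz
    have h1 := Polynomial.Chebyshev.U_real_cos (θ z) k
    rw [hθ] at h1
    simp only [Real.cos_arccos ht.1.le ht.2.le, Real.sin_arccos] at h1
    rw [chebWeight_eq hh hz]
    have h2 := Real.mul_self_sqrt hp.le
    have h3 := (Real.sqrt_pos.2 hp).ne'
    push_cast at h1
    rw [hθ]
    simp only
    rw [← h1]
    field_simp
    rw [Real.sq_sqrt hp.le]
  have hderiv : ∀ z ∈ Ioo (-h) 0, deriv (fun z => (Real.sin ((k + 1) * θ z) : ℂ)) z =
      ((chebWeight h z * (2 / h * (k + 1) * cheb h (k + 1) z) : ℝ) : ℂ) := by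
    intro z hz
    have ht := tCoord_mem_Ioo hh hz
    have h1 := ((hasDerivAt_arccos_tCoord hh hz).const_mul ((k : ℝ) + 1)).sin.ofReal_comp
    have h2 : deriv (fun z => (Real.sin ((k + 1) * θ z) : ℂ)) z = _ := h1.deriv
    rw [h2, cheb_eq_cos _ ⟨ht.1.le, ht.2.le⟩]
    push_cast; ring
  have hcZ := contDiff_discFun p q
  have k1 := continuous_cheb h k
  have k2 := continuous_cheb h (k + 1)
  have k3 := continuous_cheb h (k + 2)
  have k4 := hcZ.continuous
  have key := hwg.integral_cylMeasure_eq hh hw hg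
    (f := fun P => (Real.sin ((k + 1) * θ P.2) : ℂ) * discFun p q P.1)
    (A := fun P => (2 / h * (k + 1) : ℂ) * tensorFun h p q (k + 1) P)
    (B := fun P => (1 / 2 : ℂ) * (tensorFun h p q k P - tensorFun h p q (k + 2) P))
    (E := fun P => discFun p q P.1 * ((Polynomial.Chebyshev.U ℝ k).eval (tCoord h P.2) *
      (4 / h ^ 2) * (-(h + 2 * P.2)) : ℝ))
    ?_ ?_ ?_ ?_ ?_ ?_ ?_
  · have e1 : ∀ P, w P * ((2 / h * (k + 1) : ℂ) * tensorFun h p q (k + 1) P) =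
        (2 / h * (k + 1) : ℂ) * (w P * tensorFun h p q (k + 1) P) := fun P => by ring
    have e2 : ∀ P, g P * ((1 / 2 : ℂ) * (tensorFun h p q k P - tensorFun h p q (k + 2) P)) =
        (1 / 2 : ℂ) * (g P * tensorFun h p q k P - g P * tensorFun h p q (k + 2) P) :=
      fun P => by ring
    simp only [e1, e2] at key
    rw [integral_const_mul, integral_const_mul, integral_sub (integrable_mul_tensorFun hg _ _ _)
      (integrable_mul_tensorFun hg _ _ _)] at key
    unfold moment
    rw [key]; ring
  · exact (hcs.comp contDiff_snd.contDiffOn fun P hP => hP.2).mul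
      (hcZ.comp contDiff_fst).contDiffOn
  · exact continuous_const.mul (continuous_tensorFun _ _ _ _)
  · exact continuous_const.mul ((continuous_tensorFun _ _ _ _).sub (continuous_tensorFun _ _ _ _))
  · have := (Polynomial.continuous (Polynomial.Chebyshev.U ℝ k)).comp (continuous_tCoord h)
    have h2 : Continuous fun P : ℂ × ℝ => (Polynomial.Chebyshev.U ℝ k).eval (tCoord h P.2) :=
      this.comp continuous_snd
    fun_prop
  · intro P hP
    rw [fderiv_comp_snd_mul_comp_fst (a := fun z => (Real.sin ((k + 1) * θ z) : ℂ))
      (b := discFun p q) ((hcs.contDiffAt (isOpen_Ioo.mem_nhds hP.2)).differentiableAt (by simp))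
      (hcZ.differentiable (by simp) _), hderiv _ hP.2]
    simp only [map_zero, tensorFun]
    push_cast; ring
  · intro P hP
    rw [hsin _ hP.2, cheb_sub_cheb]
    unfold tensorFun
    push_cast; ring
  · intro P hP
    have h1 := one_sub_norm_sq_pos hP.1
    have h2 : -P.2 ≠ 0 := by linarith [hP.2.2]
    have h3 : h + P.2 ≠ 0 := by linarith [hP.2.1]
    have h4 : Real.sin ((k + 1) * θ P.2) * (fderiv ℝ (bdryFun h) P (0, 1) / bdryFun h P) =
        chebWeight h P.2 * ((Polynomial.Chebyshev.U ℝ k).eval (tCoord h P.2) *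
          (4 / h ^ 2) * (-(h + 2 * P.2))) := by
      rw [fderiv_bdryFun_axial, bdryFun, mul_div_mul_left _ _ h1.ne', hsin _ hP.2,
        one_sub_tCoord_sq hh]
      have hh' := hh.ne'
      have h5 : P.2 ≠ 0 := neg_ne_zero.1 h2
      field_simp
    rw [mul_right_comm, ← Complex.ofReal_mul, h4]
    push_cast; ring

/-! ### Orthogonality -/

lemma conj_discFun (p q : ℕ) (x : ℂ) : starRingEnd ℂ (discFun p q x) = discFun q p x := by
  rw [discFun, discFun, discPoly_comm q p, discPoly, discPoly]
  simp

/-- The constant `1` has weak derivative `0`; the relations between moments, applied to this pair,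
give the integrals of all disc and Chebyshev polynomials. -/
lemma hasWeakDirDeriv_one (h : ℝ) (v : ℂ × ℝ) :
    HasWeakDirDeriv h v (fun _ => 1) (fun _ => 0) := by
  intro φ hφ hc hs
  have h0 : ∀ p, p ∉ cylinder h → dirDeriv v φ p = 0 := by
    intro p hp
    have : p ∉ tsupport (fderiv ℝ φ) := fun hcon => hp (hs (tsupport_fderiv_subset ℝ hcon))
    simp [dirDeriv, image_eq_zero_of_notMem_tsupport this]
  have hi : Integrable (fun p => fderiv ℝ φ p v) := by
    refine Continuous.integrable_of_hasCompactSupport ?_ ?_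
    · exact (hφ.continuous_fderiv (by simp)).clm_apply continuous_const
    · exact hc.fderiv_apply ℝ v
  simp only [one_mul, zero_mul, integral_zero, neg_zero]
  rw [setIntegral_eq_integral_of_forall_compl_eq_zero h0]
  have : (volume : Measure (ℂ × ℝ)).IsAddHaarMeasure := by
    rw [Measure.volume_eq_prod]; infer_instance
  have key := integral_mul_fderiv_eq_neg_fderiv_mul_of_integrable (𝕜 := ℂ) (μ := volume)
    (f := fun _ : ℂ × ℝ => (1 : ℂ)) (g := φ) (v := v) (by simp) (by simpa using hi)
    (by simpa using hφ.continuous.integrable_of_hasCompactSupport hc)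
    (fun x _ => differentiableAt_const _)
    (fun x _ => hφ.differentiable (by simp) x)
  simpa [dirDeriv] using key

lemma moment_zero (h : ℝ) (p q k : ℕ) : moment h p q k (fun _ => 0) = 0 := by simp [moment]

lemma moment_one_disc {h : ℝ} (hh : 0 < h) {p q : ℕ} (hpq : p ≠ 0 ∨ q ≠ 0) (k : ℕ) :
    moment h p q k (fun _ => 1) = 0 := by
  have := isFiniteMeasure_cylMeasure hh
  have h1 := hasWeakDirDeriv_one h (1, 0)
  have h2 := hasWeakDirDeriv_one h (Complex.I, 0)
  rcases hpq with hp | hq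
  · obtain ⟨p, rfl⟩ := Nat.exists_eq_succ_of_ne_zero hp
    have := moment_succ_left hh h1 h2 (integrable_const _) (integrable_const _)
      (integrable_const _) p q k
    have hne : (p : ℂ) + q + 2 ≠ 0 := by exact_mod_cast (by omega : p + q + 2 ≠ 0)
    simpa [moment_zero, hne] using this
  · obtain ⟨q, rfl⟩ := Nat.exists_eq_succ_of_ne_zero hq
    have := moment_succ_right hh h1 h2 (integrable_const _) (integrable_const _)
      (integrable_const _) p q k
    have hne : (p : ℂ) + q + 2 ≠ 0 := by exact_mod_cast (by omega : p + q + 2 ≠ 0)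
    simpa [moment_zero, hne] using this

lemma moment_one_axial {h : ℝ} (hh : 0 < h) (p q k : ℕ) :
    moment h p q (k + 1) (fun _ => 1) = 0 := by
  have := isFiniteMeasure_cylMeasure hh
  have := moment_axial_succ hh (hasWeakDirDeriv_one h (0, 1)) (integrable_const _)
    (integrable_const _) p q k
  have hne : (k : ℂ) + 1 ≠ 0 := by exact_mod_cast k.succ_ne_zero
  simpa [moment_zero, hne, hh.ne'] using this

/-- The total mass of the weight `σ` on `(-h, 0)`. -/
def axialMass (h : ℝ) : ℝ := (axialMeasure h).real univ

lemma axialMass_pos {h : ℝ} (hh : 0 < h) : 0 < axialMass h := by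
  have := isFiniteMeasure_axialMeasure hh
  have h0 : axialMeasure h ≠ 0 := by
    intro h0
    have h1 : ∀ᵐ z ∂axialMeasure h, False := by simp [h0]
    rw [ae_axialMeasure_iff hh, ae_iff] at h1
    simp at h1
    linarith
  have : NeZero (axialMeasure h) := ⟨h0⟩
  exact measureReal_univ_pos

lemma moment_mul {h : ℝ} (f : ℂ → ℂ) (g : ℝ → ℂ) (p q k : ℕ) :
    moment h p q k (fun P => f P.1 * g P.2) =
      (∫ x, f x * discFun p q x ∂discMeasure) * ∫ z, g z * (cheb h k z : ℂ) ∂axialMeasure h := by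
  rw [← integral_prod_mul, moment, cylMeasure]
  refine integral_congr_ae (ae_of_all _ fun P => ?_)
  simp only [tensorFun]; ring

lemma cheb_zero (h z : ℝ) : cheb h 0 z = 1 := by simp [cheb]

lemma discFun_zero_zero (x : ℂ) : discFun 0 0 x = 1 := discPoly_zero_zero _ _

lemma integral_discFun {p q : ℕ} (hpq : p ≠ 0 ∨ q ≠ 0) : ∫ x, discFun p q x ∂discMeasure = 0 := by
  -- any height of the cylinder serves here
  have h1 := moment_one_disc one_pos hpq 0
  have h2 := moment_mul (h := 1) (fun _ => 1) (fun _ => 1) p q 0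
  simp only [mul_one] at h2
  rw [h1] at h2
  have hm : (axialMeasure 1).real univ ≠ 0 := (axialMass_pos one_pos).ne'
  simpa [cheb_zero, hm] using h2.symm

lemma integral_cheb_succ {h : ℝ} (hh : 0 < h) (k : ℕ) :
    ∫ z, (cheb h (k + 1) z : ℂ) ∂axialMeasure h = 0 := by
  have h1 := moment_one_axial hh 0 0 k
  have h2 := moment_mul (h := h) (fun _ => 1) (fun _ => 1) 0 0 (k + 1)
  simp only [mul_one] at h2
  rw [h1] at h2
  simpa [discFun_zero_zero] using h2.symm

lemma integrable_of_continuous_disc {f : ℂ → ℂ} (hf : Continuous f) :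
    Integrable f discMeasure := by
  obtain ⟨K, hK⟩ := (isCompact_closedBall (0 : ℂ) 1).exists_bound_of_continuousOn hf.continuousOn
  exact Integrable.of_bound hf.aestronglyMeasurable K
    (ae_mem_disc.mono fun x hx => hK x (Metric.ball_subset_closedBall hx))

lemma mul_discFun (p q : ℕ) (x : ℂ) : ((p : ℂ) + q + 1) * (x * discFun p q x) =
    (p + 1) * discFun (p + 1) q x + q * discFun p (q - 1) x := mul_discPoly p q x _

lemma conj_mul_discFun (p q : ℕ) (x : ℂ) : ((p : ℂ) + q + 1) * (starRingEnd ℂ x * discFun p q x) =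
    (q + 1) * discFun p (q + 1) x + p * discFun (p - 1) q x := by
  have := mul_discPoly q p (starRingEnd ℂ x) x
  simp only [discFun, discPoly_comm p, discPoly_comm (p - 1)]
  linear_combination this

/-- Comparing `∫ (x Z_{p,q}) Z_{a,b}` with `∫ Z_{p,q} (x Z_{a,b})`. -/
lemma integral_discFun_mul_succ (p q a b : ℕ) :
    ((p : ℂ) + 1) * ∫ x, discFun (p + 1) q x * discFun a b x ∂discMeasure =
      -q * (∫ x, discFun p (q - 1) x * discFun a b x ∂discMeasure) +
      ((p : ℂ) + q + 1) / (a + b + 1) *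
        ((a + 1) * (∫ x, discFun p q x * discFun (a + 1) b x ∂discMeasure) +
          b * ∫ x, discFun p q x * discFun a (b - 1) x ∂discMeasure) := by
  have hi : ∀ p q a b, Integrable (fun x => discFun p q x * discFun a b x) discMeasure :=
    fun p q a b => integrable_of_continuous_disc
      ((continuous_discFun p q).mul (continuous_discFun a b))
  have hne : (a : ℂ) + b + 1 ≠ 0 := by exact_mod_cast (by omega : a + b + 1 ≠ 0)
  have e1 : ∀ x, ((p : ℂ) + 1) * (discFun (p + 1) q x * discFun a b x) +
      q * (discFun p (q - 1) x * discFun a b x) = ((p : ℂ) + q + 1) / (a + b + 1) *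
      ((a + 1) * (discFun p q x * discFun (a + 1) b x) +
        b * (discFun p q x * discFun a (b - 1) x)) := by
    intro x
    have h1 := mul_discFun p q x
    have h2 := mul_discFun a b x
    rw [div_mul_eq_mul_div, eq_div_iff hne]
    linear_combination (-((a : ℂ) + b + 1) * discFun a b x) * h1 +
      (((p : ℂ) + q + 1) * discFun p q x) * h2
  have e2 := integral_congr_ae (μ := discMeasure) (ae_of_all _ e1)
  rw [integral_add ((hi _ _ _ _).const_mul _) ((hi _ _ _ _).const_mul _), integral_const_mul,
    integral_const_mul, integral_const_mul, integral_add ((hi _ _ _ _).const_mul _)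
      ((hi _ _ _ _).const_mul _), integral_const_mul, integral_const_mul] at e2
  linear_combination e2

lemma integral_discFun_mul_symm (p q a b : ℕ) : ∫ x, discFun p q x * discFun a b x ∂discMeasure =
    starRingEnd ℂ (∫ x, discFun q p x * discFun b a x ∂discMeasure) := by
  rw [← integral_conj]
  simp [conj_discFun]

/-- The disc polynomials are orthogonal on the disc, with `‖Z_{p,q}‖² = 1/(p + q + 1)`; the conjugate
of `Z_{b,a}` is `Z_{a,b}`. -/
lemma integral_discFun_mul (p q a b : ℕ) : ∫ x, discFun p q x * discFun a b x ∂discMeasure =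
    if p = b ∧ q = a then 1 / ((p : ℂ) + q + 1) else 0 := by
  -- the algebra of one step of the recursion
  have step : ∀ p q a b : ℕ, ((p : ℂ) + 1) *
      (if p + 1 = b ∧ q = a then 1 / (((p + 1 : ℕ) : ℂ) + q + 1) else 0) =
      -q * (if p = b ∧ q - 1 = a then 1 / ((p : ℂ) + (q - 1 : ℕ) + 1) else 0) +
      ((p : ℂ) + q + 1) / (a + b + 1) *
        ((a + 1) * (if p = b ∧ q = a + 1 then 1 / ((p : ℂ) + q + 1) else 0) +
          b * (if p = b - 1 ∧ q = a then 1 / ((p : ℂ) + q + 1) else 0)) := by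
    intro p q a b
    have n1 : (a : ℂ) + b + 1 ≠ 0 := by exact_mod_cast (by omega : a + b + 1 ≠ 0)
    have n2 : (p : ℂ) + q + 1 ≠ 0 := by exact_mod_cast (by omega : p + q + 1 ≠ 0)
    have n3 : ∀ n m : ℕ, (n : ℂ) + m + 1 ≠ 0 := fun n m => by
      exact_mod_cast (by omega : n + m + 1 ≠ 0)
    by_cases c1 : p = b ∧ q = a + 1
    · obtain ⟨rfl, rfl⟩ := c1
      have := n3 p a
      have c3 : ¬ (p = p - 1 ∧ a + 1 = a) := by omega
      simp only [c3, if_false, Nat.add_sub_cancel]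
      push_cast at n1 n2 ⊢
      simp
      field_simp
      ring
    · by_cases c2 : b = p + 1 ∧ q = a
      · obtain ⟨rfl, rfl⟩ := c2
        have := n3 (p + 1) q
        have c3 : ¬ (p = p + 1 ∧ q - 1 = q) := by omega
        push_cast at this n1 ⊢
        simp only [c3, if_false, c1]
        simp
        field_simp
        ring
      · have d1 : ¬ (p + 1 = b ∧ q = a) := by omega
        have d2 : (q : ℂ) * (if p = b ∧ q - 1 = a then 1 / ((p : ℂ) + (q - 1 : ℕ) + 1) else 0)
            = 0 := by
          rcases q with _ | q
          · simp
          · have : ¬ (p = b ∧ q + 1 - 1 = a) := by omega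
            simp only [this, if_false, mul_zero]
        have d3 : (b : ℂ) * (if p = b - 1 ∧ q = a then 1 / ((p : ℂ) + q + 1) else 0) = 0 := by
          rcases b with _ | b
          · simp
          · have : ¬ (p = b + 1 - 1 ∧ q = a) := by omega
            simp only [this, if_false, mul_zero]
        rw [neg_mul, d2, d3]
        simp only [d1, c1, if_false]
        simp
  -- the case `p = 0` is the case `q = 0` conjugated, and there the recursion acts on `q`
  have base : ∀ q a b : ℕ, ∫ x, discFun 0 q x * discFun a b x ∂discMeasure =
      if 0 = b ∧ q = a then 1 / (((0 : ℕ) : ℂ) + q + 1) else 0 := by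
    intro q
    induction q with
    | zero =>
      intro a b
      simp only [discFun_zero_zero, one_mul]
      by_cases hc : 0 = b ∧ 0 = a
      · obtain ⟨rfl, rfl⟩ := hc
        simp [discFun_zero_zero]
      · rw [if_neg hc]
        exact integral_discFun (by omega)
    | succ q ih =>
      intro a b
      have ih' : ∀ a b : ℕ, ∫ x, discFun q 0 x * discFun a b x ∂discMeasure =
          if q = b ∧ 0 = a then 1 / ((q : ℂ) + ((0 : ℕ) : ℂ) + 1) else 0 := by
        intro a b
        rw [integral_discFun_mul_symm, ih]
        by_cases hc : 0 = a ∧ q = b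
        · obtain ⟨rfl, rfl⟩ := hc; simp
        · rw [if_neg hc, if_neg (by omega)]; simp
      have h1 := integral_discFun_mul_succ q 0 b a
      rw [ih' (b + 1) a, ih' b (a - 1)] at h1
      have h2 := step q 0 b a
      have h3 : ∫ x, discFun (q + 1) 0 x * discFun b a x ∂discMeasure =
          if q + 1 = a ∧ 0 = b then 1 / (((q + 1 : ℕ) : ℂ) + ((0 : ℕ) : ℂ) + 1) else 0 := by
        refine mul_left_cancel₀ (by exact_mod_cast q.succ_ne_zero) ((h1.trans ?_).trans h2.symm)
        simp
      rw [integral_discFun_mul_symm, h3]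
      by_cases hc : 0 = b ∧ q + 1 = a
      · obtain ⟨rfl, rfl⟩ := hc
        simp
      · rw [if_neg hc, if_neg (by omega)]; simp
  induction p generalizing q a b with
  | zero => exact base q a b
  | succ p ih =>
    have h1 := integral_discFun_mul_succ p q a b
    rw [ih, ih, ih] at h1
    exact mul_left_cancel₀ (by exact_mod_cast p.succ_ne_zero) (h1.trans (step p q a b).symm)

lemma integrable_of_continuous_axial {h : ℝ} (hh : 0 < h) {f : ℝ → ℂ} (hf : Continuous f) :
    Integrable f (axialMeasure h) := by
  have := isFiniteMeasure_axialMeasure hh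
  obtain ⟨K, hK⟩ := (isCompact_Icc (a := -h) (b := 0)).exists_bound_of_continuousOn hf.continuousOn
  exact Integrable.of_bound hf.aestronglyMeasurable K
    ((ae_mem_Ioo h).mono fun x hx => hK x (Ioo_subset_Icc_self hx))

lemma cheb_mul_cheb (h : ℝ) {j k : ℕ} (hjk : j ≤ k) (z : ℝ) :
    cheb h j z * cheb h k z = 1 / 2 * (cheb h (k + j) z + cheb h (k - j) z) := by
  have h1 := congrArg (Polynomial.eval (tCoord h z)) (Polynomial.Chebyshev.T_mul_T ℝ k j)
  simp only [Polynomial.eval_add, Polynomial.eval_mul, Polynomial.eval_ofNat] at h1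
  unfold cheb
  push_cast [Nat.cast_sub hjk]
  linear_combination (1 / 2) * h1

lemma integral_cheb_mul {h : ℝ} (hh : 0 < h) (j k : ℕ) :
    ∫ z, (cheb h j z : ℂ) * (cheb h k z : ℂ) ∂axialMeasure h =
      if j = k then (if k = 0 then (axialMass h : ℂ) else axialMass h / 2) else 0 := by
  wlog hjk : j ≤ k generalizing j k
  · have := this k j (by omega)
    simp only [mul_comm (cheb h k _ : ℂ)] at this
    rw [this]
    by_cases hc : j = k
    · simp [hc]
    · rw [if_neg hc, if_neg (Ne.symm hc)]
  have e1 : ∀ z, (cheb h j z : ℂ) * (cheb h k z : ℂ) =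
      1 / 2 * ((cheb h (k + j) z : ℂ) + (cheb h (k - j) z : ℂ)) := fun z => by
    have := congrArg (fun r : ℝ => (r : ℂ)) (cheb_mul_cheb h hjk z)
    push_cast at this
    exact this
  have hi : ∀ k, Integrable (fun z => (cheb h k z : ℂ)) (axialMeasure h) := fun k =>
    integrable_of_continuous_axial hh (Complex.continuous_ofReal.comp (continuous_cheb h k))
  simp_rw [e1]
  rw [integral_const_mul, integral_add (hi _) (hi _)]
  have h0 : ∫ z, (cheb h 0 z : ℂ) ∂axialMeasure h = axialMass h := by
    simp [cheb_zero, axialMass]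
  have hs : ∀ n, n ≠ 0 → ∫ z, (cheb h n z : ℂ) ∂axialMeasure h = 0 := by
    intro n hn
    obtain ⟨n, rfl⟩ := Nat.exists_eq_succ_of_ne_zero hn
    exact integral_cheb_succ hh n
  by_cases hc : j = k
  · subst hc
    by_cases hk : j = 0
    · subst hk
      simp [h0]; ring
    · rw [if_pos rfl, if_neg hk, Nat.sub_self, h0, hs _ (by omega)]; ring
  · rw [if_neg hc, hs _ (by omega), hs _ (by omega)]; simp

/-! ### Orthonormal systems -/

/-- The `L²(D)`-normalised disc polynomial. -/
def dzeta (p q : ℕ) (x : ℂ) : ℂ := (√((p : ℝ) + q + 1) : ℂ) * discFun p q x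

/-- The constant that normalises `T_k` in `L²` of the measure `σ dz`. -/
def chebNorm (h : ℝ) (k : ℕ) : ℝ := if k = 0 then √(1 / axialMass h) else √(2 / axialMass h)

/-- The `L²_σ`-normalised Chebyshev polynomial. -/
def tau (h : ℝ) (k : ℕ) (z : ℝ) : ℝ := chebNorm h k * cheb h k z

/-- The orthonormal system of `L²_σ(C)`, indexed by `((p, q), k)`. -/
def basisFun (h : ℝ) (i : (ℕ × ℕ) × ℕ) (P : ℂ × ℝ) : ℂ := dzeta i.1.1 i.1.2 P.1 * (tau h i.2 P.2 : ℂ)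

lemma chebNorm_pos {h : ℝ} (hh : 0 < h) (k : ℕ) : 0 < chebNorm h k := by
  have := axialMass_pos hh
  unfold chebNorm
  split_ifs <;> positivity

lemma conj_dzeta (p q : ℕ) (x : ℂ) : starRingEnd ℂ (dzeta p q x) = dzeta q p x := by
  rw [dzeta, dzeta, map_mul, conj_discFun, Complex.conj_ofReal, add_comm (p : ℝ)]

lemma continuous_dzeta (p q : ℕ) : Continuous (dzeta p q) :=
  continuous_const.mul (continuous_discFun p q)

lemma continuous_tau (h : ℝ) (k : ℕ) : Continuous (tau h k) :=
  continuous_const.mul (continuous_cheb h k)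

lemma continuous_basisFun (h : ℝ) (i : (ℕ × ℕ) × ℕ) : Continuous (basisFun h i) := by
  have h1 := continuous_dzeta i.1.1 i.1.2
  have h2 := continuous_tau h i.2
  unfold basisFun; fun_prop

lemma integral_dzeta (i j : ℕ × ℕ) :
    ∫ x, dzeta i.1 i.2 x * starRingEnd ℂ (dzeta j.1 j.2 x) ∂discMeasure = if i = j then 1 else 0 := by
  obtain ⟨p, q⟩ := i
  obtain ⟨a, b⟩ := j
  have e1 : ∀ x, dzeta p q x * starRingEnd ℂ (dzeta a b x) =
      ((√((p : ℝ) + q + 1) : ℂ) * (√((b : ℝ) + a + 1) : ℂ)) * (discFun p q x * discFun b a x) :=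
    fun x => by rw [conj_dzeta, dzeta, dzeta]; ring
  simp only [e1, Prod.mk.injEq]
  rw [integral_const_mul, integral_discFun_mul]
  by_cases hc : p = a ∧ q = b
  · obtain ⟨rfl, rfl⟩ := hc
    have h1 : (0 : ℝ) ≤ (p : ℝ) + q + 1 := by positivity
    have h2 : (p : ℂ) + q + 1 ≠ 0 := by exact_mod_cast (by omega : p + q + 1 ≠ 0)
    rw [add_comm (q : ℝ) p, ← Complex.ofReal_mul, Real.mul_self_sqrt h1]
    simp [h2]
  · rw [if_neg hc, if_neg hc, mul_zero]

lemma integral_tau {h : ℝ} (hh : 0 < h) (j k : ℕ) :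
    ∫ z, (tau h j z : ℂ) * (tau h k z : ℂ) ∂axialMeasure h = if j = k then 1 else 0 := by
  have e1 : ∀ z, (tau h j z : ℂ) * (tau h k z : ℂ) =
      ((chebNorm h j : ℂ) * (chebNorm h k : ℂ)) * ((cheb h j z : ℂ) * (cheb h k z : ℂ)) :=
    fun z => by unfold tau; push_cast; ring
  simp only [e1]
  rw [integral_const_mul, integral_cheb_mul hh]
  by_cases hc : j = k
  · subst hc
    have hm := axialMass_pos hh
    have hm' : (axialMass h : ℂ) ≠ 0 := by exact_mod_cast hm.ne'
    unfold chebNorm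
    by_cases hj : j = 0
    · simp only [hj, if_true]
      rw [← Complex.ofReal_mul, Real.mul_self_sqrt (by positivity)]
      push_cast; field_simp
    · simp only [hj, if_false, if_true]
      rw [← Complex.ofReal_mul, Real.mul_self_sqrt (by positivity)]
      push_cast; field_simp
  · simp [hc]

lemma integral_basisFun {h : ℝ} (hh : 0 < h) (i j : (ℕ × ℕ) × ℕ) :
    ∫ P, basisFun h i P * starRingEnd ℂ (basisFun h j P) ∂cylMeasure h = if i = j then 1 else 0 := by
  have e1 : ∀ P, basisFun h i P * starRingEnd ℂ (basisFun h j P) =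
      (dzeta i.1.1 i.1.2 P.1 * starRingEnd ℂ (dzeta j.1.1 j.1.2 P.1)) *
        ((tau h i.2 P.2 : ℂ) * (tau h j.2 P.2 : ℂ)) := fun P => by
    unfold basisFun; rw [map_mul, Complex.conj_ofReal]; ring
  simp only [e1]
  rw [cylMeasure, integral_prod_mul (fun x => dzeta i.1.1 i.1.2 x *
    starRingEnd ℂ (dzeta j.1.1 j.1.2 x)) (fun z => (tau h i.2 z : ℂ) * (tau h j.2 z : ℂ)),
    integral_dzeta, integral_tau hh]
  by_cases h1 : i.1 = j.1 <;> by_cases h2 : i.2 = j.2 <;> simp [h1, h2, Prod.ext_iff]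

/-! ### Completeness -/

/-- The complex span of the tensor polynomials `Z_{p,q} T_k`. -/
def tensorSpan (h : ℝ) : Submodule ℂ (ℂ × ℝ → ℂ) :=
  Submodule.span ℂ (range fun i : ℕ × ℕ × ℕ => tensorFun h i.1 i.2.1 i.2.2)

lemma tensorFun_mem (h : ℝ) (p q k : ℕ) : tensorFun h p q k ∈ tensorSpan h :=
  Submodule.subset_span ⟨(p, q, k), rfl⟩

lemma mul_mem_tensorSpan_of_forall {h : ℝ} {c : ℂ × ℝ → ℂ}
    (hc : ∀ p q k, c * tensorFun h p q k ∈ tensorSpan h) {F : ℂ × ℝ → ℂ} (hF : F ∈ tensorSpan h) :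
    c * F ∈ tensorSpan h := by
  induction hF using Submodule.span_induction with
  | mem F hF => obtain ⟨⟨p, q, k⟩, rfl⟩ := hF; exact hc p q k
  | zero => simp
  | add F G _ _ hF hG => rw [mul_add]; exact add_mem hF hG
  | smul a F _ hF => rw [mul_smul_comm]; exact Submodule.smul_mem _ _ hF

lemma fst_mul_mem {h : ℝ} {F : ℂ × ℝ → ℂ} (hF : F ∈ tensorSpan h) :
    (fun P : ℂ × ℝ => P.1) * F ∈ tensorSpan h := by
  refine mul_mem_tensorSpan_of_forall (fun p q k => ?_) hF
  have hne : (p : ℂ) + q + 1 ≠ 0 := by exact_mod_cast (by omega : p + q + 1 ≠ 0)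
  have e : (fun P : ℂ × ℝ => P.1) * tensorFun h p q k = ((p : ℂ) + q + 1)⁻¹ •
      (((p : ℂ) + 1) • tensorFun h (p + 1) q k + (q : ℂ) • tensorFun h p (q - 1) k) := by
    funext P
    have := mul_discFun p q P.1
    simp only [Pi.mul_apply, Pi.smul_apply, Pi.add_apply, smul_eq_mul, tensorFun]
    rw [eq_inv_mul_iff_mul_eq₀ hne]
    linear_combination (cheb h k P.2 : ℂ) * this
  rw [e]
  exact Submodule.smul_mem _ _ (add_mem (Submodule.smul_mem _ _ (tensorFun_mem _ _ _ _))
    (Submodule.smul_mem _ _ (tensorFun_mem _ _ _ _)))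

lemma conj_fst_mul_mem {h : ℝ} {F : ℂ × ℝ → ℂ} (hF : F ∈ tensorSpan h) :
    (fun P : ℂ × ℝ => starRingEnd ℂ P.1) * F ∈ tensorSpan h := by
  refine mul_mem_tensorSpan_of_forall (fun p q k => ?_) hF
  have hne : (p : ℂ) + q + 1 ≠ 0 := by exact_mod_cast (by omega : p + q + 1 ≠ 0)
  have e : (fun P : ℂ × ℝ => starRingEnd ℂ P.1) * tensorFun h p q k = ((p : ℂ) + q + 1)⁻¹ •
      (((q : ℂ) + 1) • tensorFun h p (q + 1) k + (p : ℂ) • tensorFun h (p - 1) q k) := by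
    funext P
    have := conj_mul_discFun p q P.1
    simp only [Pi.mul_apply, Pi.smul_apply, Pi.add_apply, smul_eq_mul, tensorFun]
    rw [eq_inv_mul_iff_mul_eq₀ hne]
    linear_combination (cheb h k P.2 : ℂ) * this
  rw [e]
  exact Submodule.smul_mem _ _ (add_mem (Submodule.smul_mem _ _ (tensorFun_mem _ _ _ _))
    (Submodule.smul_mem _ _ (tensorFun_mem _ _ _ _)))

lemma cheb_one (h z : ℝ) : cheb h 1 z = tCoord h z := by simp [cheb]

lemma tCoord_mul_mem {h : ℝ} {F : ℂ × ℝ → ℂ} (hF : F ∈ tensorSpan h) :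
    (fun P : ℂ × ℝ => (tCoord h P.2 : ℂ)) * F ∈ tensorSpan h := by
  refine mul_mem_tensorSpan_of_forall (fun p q k => ?_) hF
  rcases k with _ | k
  · have e : (fun P : ℂ × ℝ => (tCoord h P.2 : ℂ)) * tensorFun h p q 0 = tensorFun h p q 1 := by
      funext P
      simp [tensorFun, cheb_zero, cheb_one, mul_comm]
    rw [e]; exact tensorFun_mem _ _ _ _
  · have e : (fun P : ℂ × ℝ => (tCoord h P.2 : ℂ)) * tensorFun h p q (k + 1) =
        (1 / 2 : ℂ) • (tensorFun h p q (k + 2) + tensorFun h p q k) := by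
      funext P
      have := congrArg (fun r : ℝ => (r : ℂ)) (cheb_mul_cheb h (show 1 ≤ k + 1 by omega) P.2)
      simp only [cheb_one, Nat.add_sub_cancel] at this
      push_cast at this
      simp only [Pi.mul_apply, Pi.smul_apply, Pi.add_apply, smul_eq_mul, tensorFun]
      linear_combination (discFun p q P.1) * this
    rw [e]
    exact Submodule.smul_mem _ _ (add_mem (tensorFun_mem _ _ _ _) (tensorFun_mem _ _ _ _))

/-- A function on the cylinder whose moments all vanish is zero: the span of the tensor polynomials
is closed under multiplication by `x`, `x̄` and `t`, hence contains all polynomials, and these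
approximate continuous functions uniformly. -/
lemma ae_eq_zero_of_moment_eq_zero {h : ℝ} (hh : 0 < h) {w : ℂ × ℝ → ℂ}
    (hw : Integrable w (cylMeasure h)) (h0 : ∀ p q k, moment h p q k w = 0) :
    ∀ᵐ P ∂cylMeasure h, w P = 0 := by
  have := isFiniteMeasure_cylMeasure hh
  have hspan : ∀ F ∈ tensorSpan h, Continuous F ∧ ∫ P, w P * F P ∂cylMeasure h = 0 := by
    intro F hF
    induction hF using Submodule.span_induction with
    | mem F hF =>
      obtain ⟨⟨p, q, k⟩, rfl⟩ := hF
      exact ⟨continuous_tensorFun _ _ _ _, h0 p q k⟩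
    | zero => exact ⟨continuous_const, by simp⟩
    | add F G _ _ hF hG =>
      refine ⟨hF.1.add hG.1, ?_⟩
      simp only [Pi.add_apply, mul_add]
      rw [integral_add (integrable_mul_continuous hw hF.1) (integrable_mul_continuous hw hG.1),
        hF.2, hG.2, add_zero]
    | smul a F _ hF =>
      refine ⟨hF.1.const_smul a, ?_⟩
      simp only [Pi.smul_apply, smul_eq_mul, mul_left_comm _ a]
      rw [integral_const_mul, hF.2, mul_zero]
  let re : C(ℂ × ℝ, ℝ) := ⟨fun P => P.1.re, by fun_prop⟩
  let im : C(ℂ × ℝ, ℝ) := ⟨fun P => P.1.im, by fun_prop⟩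
  let tt : C(ℂ × ℝ, ℝ) := ⟨fun P => tCoord h P.2, (continuous_tCoord h).comp continuous_snd⟩
  let A : Subalgebra ℝ C(ℂ × ℝ, ℝ) := Algebra.adjoin ℝ {re, im, tt}
  have hA : A.SeparatesPoints := by
    rintro ⟨x, z⟩ ⟨x', z'⟩ hne
    have hm : ∀ g ∈ ({re, im, tt} : Set C(ℂ × ℝ, ℝ)), g ∈ A := fun g hg => Algebra.subset_adjoin hg
    by_cases h1 : x.re = x'.re
    · by_cases h2 : x.im = x'.im
      · refine ⟨tt, ⟨tt, hm tt (by simp), rfl⟩, ?_⟩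
        intro h3
        apply hne
        have h4 : z = z' := by
          simp only [ContinuousMap.coe_mk, tt, tCoord] at h3
          have hh' := hh.ne'
          field_simp at h3
          linarith
        rw [Complex.ext h1 h2, h4]
      · exact ⟨im, ⟨im, hm im (by simp), rfl⟩, h2⟩
    · exact ⟨re, ⟨re, hm re (by simp), rfl⟩, h1⟩
  have hmul : ∀ g ∈ A, ∀ F ∈ tensorSpan h, (fun P => (g P : ℂ)) * F ∈ tensorSpan h := by
    intro g hg
    induction hg using Algebra.adjoin_induction with
    | mem g hg =>
      intro F hF
      rcases hg with rfl | rfl | rfl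
      · have e : (fun P => (re P : ℂ)) * F = (1 / 2 : ℂ) •
            ((fun P : ℂ × ℝ => P.1) * F + (fun P : ℂ × ℝ => starRingEnd ℂ P.1) * F) := by
          funext P
          simp only [Pi.mul_apply, Pi.smul_apply, Pi.add_apply, smul_eq_mul, re,
            ContinuousMap.coe_mk]
          rw [Complex.re_eq_add_conj]; ring
        rw [e]
        exact Submodule.smul_mem _ _ (add_mem (fst_mul_mem hF) (conj_fst_mul_mem hF))
      · have e : (fun P => (im P : ℂ)) * F = (1 / (2 * Complex.I) : ℂ) •
            ((fun P : ℂ × ℝ => P.1) * F - (fun P : ℂ × ℝ => starRingEnd ℂ P.1) * F) := by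
          funext P
          simp only [Pi.mul_apply, Pi.smul_apply, Pi.sub_apply, smul_eq_mul, im,
            ContinuousMap.coe_mk]
          rw [Complex.im_eq_sub_conj]; ring
        rw [e]
        exact Submodule.smul_mem _ _ (sub_mem (fst_mul_mem hF) (conj_fst_mul_mem hF))
      · exact tCoord_mul_mem hF
    | algebraMap r =>
      intro F hF
      exact Submodule.smul_mem _ (r : ℂ) hF
    | add f g _ _ hf hg =>
      intro F hF
      have e : (fun P => ((f + g) P : ℂ)) * F = (fun P => (f P : ℂ)) * F + (fun P => (g P : ℂ)) * F := by
        funext P; simp [add_mul]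
      rw [e]; exact add_mem (hf F hF) (hg F hF)
    | mul f g _ _ hf hg =>
      intro F hF
      have e : (fun P => ((f * g) P : ℂ)) * F = (fun P => (f P : ℂ)) * ((fun P => (g P : ℂ)) * F) := by
        funext P; simp [mul_assoc]
      rw [e]; exact hf _ (hg F hF)
  have hone : (fun _ => 1 : ℂ × ℝ → ℂ) ∈ tensorSpan h := by
    have := tensorFun_mem h 0 0 0
    convert this using 1
    funext P; simp [tensorFun, discFun_zero_zero, cheb_zero]
  refine ae_eq_zero_of_integral_contDiff_smul_eq_zero hw.locallyIntegrable fun f hf _ => ?_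
  have hfc : Continuous f := hf.continuous
  set I := ∫ P, ‖w P‖ ∂cylMeasure h with hI
  have hI0 : 0 ≤ I := integral_nonneg fun _ => norm_nonneg _
  have hle : ∀ ε > 0, ‖∫ P, f P • w P ∂cylMeasure h‖ ≤ ε * I := by
    intro ε hε
    obtain ⟨g, hg, hgf⟩ :=
      ContinuousMap.exists_mem_subalgebra_near_continuous_of_isCompact_of_separatesPoints hA
        ⟨f, hfc⟩ ((isCompact_closedBall (0 : ℂ) 1).prod (isCompact_Icc (a := -h) (b := 0))) hε
    obtain ⟨hgc, hg0⟩ := hspan _ (hmul g hg _ hone)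
    have e1 : ∫ P, f P • w P ∂cylMeasure h =
        ∫ P, w P * ((f P : ℂ) - (g P : ℂ)) ∂cylMeasure h := by
      have i1 : Integrable (fun P => w P * (f P : ℂ)) (cylMeasure h) :=
        integrable_mul_continuous hw (Complex.continuous_ofReal.comp hfc)
      have i2 := integrable_mul_continuous hw hgc
      have : ∫ P, w P * ((f P : ℂ) - (g P : ℂ)) ∂cylMeasure h =
          ∫ P, (w P * (f P : ℂ) - w P * ((fun P => (g P : ℂ)) * (fun _ => 1 : ℂ × ℝ → ℂ)) P)
            ∂cylMeasure h := by
        congr 1; funext P; simp [mul_sub]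
      rw [this, integral_sub i1 i2, hg0, sub_zero]
      congr 1; funext P; rw [Complex.real_smul, mul_comm]
    rw [e1, hI, ← integral_const_mul]
    refine norm_integral_le_of_norm_le (hw.norm.const_mul ε) ?_
    filter_upwards [ae_mem_cylinder h] with P hP
    have := hgf P ⟨Metric.ball_subset_closedBall hP.1, Ioo_subset_Icc_self hP.2⟩
    rw [norm_mul, mul_comm, ← Complex.ofReal_sub, Complex.norm_real, norm_sub_rev]
    exact mul_le_mul_of_nonneg_right this.le (norm_nonneg _)
  refine norm_le_zero_iff.1 (le_of_forall_pos_le_add fun δ hδ => ?_)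
  refine (hle (δ / (I + 1)) (by positivity)).trans ?_
  rw [zero_add, div_mul_eq_mul_div, div_le_iff₀ (by positivity)]
  nlinarith

/-! ### Orthonormal bases of `L²` -/

section HilbertBasis

variable {α ι : Type*} [MeasurableSpace α] {μ : Measure α} {u : ι → α → ℂ}

lemma inner_toLp_conj (hu : ∀ i, MemLp (u i) 2 μ) (i : ι) (f : Lp ℂ 2 μ) :
    inner ℂ ((hu i).star.toLp (star (u i))) f = ∫ x, u i x * f x ∂μ := by
  rw [L2.inner_def]
  refine integral_congr_ae ?_
  filter_upwards [(hu i).star.coeFn_toLp] with x hx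
  rw [hx, RCLike.inner_apply]
  simp [mul_comm]

open Classical in
/-- The conjugates of a complete orthonormal system form a Hilbert basis, in which the coefficients
are the integrals `∫ u_i f`. -/
lemma exists_hilbertBasis_conj (hu : ∀ i, MemLp (u i) 2 μ)
    (ho : ∀ i j, ∫ x, u i x * starRingEnd ℂ (u j x) ∂μ = if i = j then 1 else 0)
    (hc : ∀ f : α → ℂ, MemLp f 2 μ → (∀ i, ∫ x, u i x * f x ∂μ = 0) → f =ᵐ[μ] 0) :
    ∃ b : HilbertBasis ι ℂ (Lp ℂ 2 μ), ∀ i (f : Lp ℂ 2 μ), b.repr f i = ∫ x, u i x * f x ∂μ := by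
  set v : ι → Lp ℂ 2 μ := fun i => (hu i).star.toLp (star (u i)) with hv
  have hon : Orthonormal ℂ v := by
    rw [orthonormal_iff_ite]
    intro i j
    rw [inner_toLp_conj hu, ← ho i j]
    refine integral_congr_ae ?_
    filter_upwards [(hu j).star.coeFn_toLp] with x hx
    rw [hx]; rfl
  have hbot : (Submodule.span ℂ (range v))ᗮ = ⊥ := by
    rw [Submodule.eq_bot_iff]
    intro f hf
    have h1 : ∀ i, ∫ x, u i x * f x ∂μ = 0 := fun i => by
      rw [← inner_toLp_conj hu]
      exact (Submodule.mem_orthogonal _ _).1 hf _ (Submodule.subset_span ⟨i, rfl⟩)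
    have h2 := hc f (Lp.memLp f) h1
    exact Lp.eq_zero_iff_ae_eq_zero.2 h2
  refine ⟨HilbertBasis.mkOfOrthogonalEqBot hon hbot, fun i f => ?_⟩
  rw [HilbertBasis.repr_apply_apply, HilbertBasis.coe_mkOfOrthogonalEqBot, inner_toLp_conj hu]

lemma tsum_enorm_repr_sq (b : HilbertBasis ι ℂ (Lp ℂ 2 μ)) (f : Lp ℂ 2 μ) :
    ∑' i, ‖b.repr f i‖ₑ ^ 2 = ‖f‖ₑ ^ 2 := by
  have h1 : HasSum (fun i => ‖b.repr f i‖ ^ 2) (‖f‖ ^ 2) := by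
    have h2 := (Complex.hasSum_iff _ _).1 (b.hasSum_inner_mul_inner f f) |>.1
    have h3 : (inner ℂ f f : ℂ).re = ‖f‖ ^ 2 := by
      have := inner_self_eq_norm_sq (𝕜 := ℂ) f
      simpa using this
    rw [h3] at h2
    refine h2.congr_fun ?_
    intro i
    rw [HilbertBasis.repr_apply_apply, ← inner_conj_symm f, Complex.conj_mul',
      ← Complex.ofReal_pow, Complex.ofReal_re]
  have h2 : ∀ x : ℂ, ‖x‖ₑ ^ 2 = ENNReal.ofReal (‖x‖ ^ 2) := fun x => by
    rw [ENNReal.ofReal_pow (norm_nonneg _), ofReal_norm]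
  have h3 : ‖f‖ₑ ^ 2 = ENNReal.ofReal (‖f‖ ^ 2) := by
    rw [ENNReal.ofReal_pow (norm_nonneg _), ofReal_norm]
  simp_rw [h2]
  rw [h3, ← h1.tsum_eq, ENNReal.ofReal_tsum_of_nonneg (fun _ => by positivity) h1.summable]

/-- Parseval's identity for the coefficients `∫ u_i f`. -/
lemma parseval_conj (hu : ∀ i, MemLp (u i) 2 μ)
    (ho : ∀ i j, ∫ x, u i x * starRingEnd ℂ (u j x) ∂μ = open Classical in if i = j then 1 else 0)
    (hc : ∀ f : α → ℂ, MemLp f 2 μ → (∀ i, ∫ x, u i x * f x ∂μ = 0) → f =ᵐ[μ] 0)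
    {f : α → ℂ} (hf : MemLp f 2 μ) :
    ∑' i, ‖∫ x, u i x * f x ∂μ‖ₑ ^ 2 = eLpNorm f 2 μ ^ 2 := by
  obtain ⟨b, hb⟩ := exists_hilbertBasis_conj hu ho hc
  have h1 := tsum_enorm_repr_sq b (hf.toLp f)
  rw [Lp.enorm_toLp] at h1
  rw [← h1]
  refine tsum_congr fun i => ?_
  rw [hb]
  congr 2
  refine integral_congr_ae ?_
  filter_upwards [hf.coeFn_toLp] with x hx
  rw [hx]

end HilbertBasis

lemma memLp_of_continuous_cyl {h : ℝ} (hh : 0 < h) {f : ℂ × ℝ → ℂ} (hf : Continuous f) :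
    MemLp f 2 (cylMeasure h) := by
  have := isFiniteMeasure_cylMeasure hh
  obtain ⟨K, hK⟩ := exists_bound_on_cylinder h hf
  exact MemLp.of_bound hf.aestronglyMeasurable K ((ae_mem_cylinder h).mono hK)

lemma memLp_of_continuous_disc {f : ℂ → ℂ} (hf : Continuous f) : MemLp f 2 discMeasure := by
  obtain ⟨K, hK⟩ := (isCompact_closedBall (0 : ℂ) 1).exists_bound_of_continuousOn hf.continuousOn
  exact MemLp.of_bound hf.aestronglyMeasurable K
    (ae_mem_disc.mono fun x hx => hK x (Metric.ball_subset_closedBall hx))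

lemma memLp_of_continuousOn_axial {h : ℝ} (hh : 0 < h) {f : ℝ → ℂ}
    (hf : ContinuousOn f (Icc (-h) 0)) : MemLp f 2 (axialMeasure h) := by
  have := isFiniteMeasure_axialMeasure hh
  obtain ⟨K, hK⟩ := (isCompact_Icc (a := -h) (b := 0)).exists_bound_of_continuousOn hf
  have hm : AEStronglyMeasurable f (axialMeasure h) :=
    ((hf.mono Ioo_subset_Icc_self).aestronglyMeasurable measurableSet_Ioo).mono_ac
      (withDensity_absolutelyContinuous _ _)
  exact MemLp.of_bound hm K ((ae_mem_Ioo h).mono fun x hx => hK x (Ioo_subset_Icc_self hx))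

/-- The coefficient `∫ e_i w dμ`, where `e_i = basisFun h i`. There is no conjugation: it is the
coefficient of `w` at the conjugate of `e_i`, and conjugation merely exchanges `p` and `q` in the
index, so the conjugates form the same system. -/
def coef (h : ℝ) (i : (ℕ × ℕ) × ℕ) (w : ℂ × ℝ → ℂ) : ℂ := ∫ P, basisFun h i P * w P ∂cylMeasure h

lemma coef_eq_moment (h : ℝ) (p q k : ℕ) (w : ℂ × ℝ → ℂ) : coef h ((p, q), k) w =
    ((√((p : ℝ) + q + 1) * chebNorm h k : ℝ) : ℂ) * moment h p q k w := by
  rw [coef, moment, ← integral_const_mul]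
  congr 1; funext P
  simp only [basisFun, dzeta, tau, tensorFun]
  push_cast; ring

lemma basisFun_complete {h : ℝ} (hh : 0 < h) (f : ℂ × ℝ → ℂ) (hf : MemLp f 2 (cylMeasure h))
    (h0 : ∀ i, ∫ P, basisFun h i P * f P ∂cylMeasure h = 0) : f =ᵐ[cylMeasure h] 0 := by
  have := isFiniteMeasure_cylMeasure hh
  refine ae_eq_zero_of_moment_eq_zero hh (hf.integrable (by norm_num)) fun p q k => ?_
  have h1 := h0 ((p, q), k)
  rw [← coef, coef_eq_moment] at h1
  refine (mul_eq_zero.1 h1).resolve_left ?_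
  have := chebNorm_pos hh k
  have h2 : 0 < √((p : ℝ) + q + 1) * chebNorm h k := by positivity
  exact_mod_cast h2.ne'

lemma tsum_coef_sq {h : ℝ} (hh : 0 < h) {w : ℂ × ℝ → ℂ} (hw : MemLp w 2 (cylMeasure h)) :
    ∑' i, ‖coef h i w‖ₑ ^ 2 = eLpNorm w 2 (cylMeasure h) ^ 2 :=
  parseval_conj (fun i => memLp_of_continuous_cyl hh (continuous_basisFun h i))
    (fun i j => by rw [integral_basisFun hh]; congr) (basisFun_complete hh) hw

lemma dzeta_complete (f : ℂ → ℂ) (hf : MemLp f 2 discMeasure)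
    (h0 : ∀ i : ℕ × ℕ, ∫ x, dzeta i.1 i.2 x * f x ∂discMeasure = 0) : f =ᵐ[discMeasure] 0 := by
  -- completeness on the disc is read off from a cylinder of height `1`
  have hh : (0 : ℝ) < 1 := one_pos
  have := isFiniteMeasure_axialMeasure hh
  have hi : Integrable f discMeasure := hf.integrable (by norm_num)
  have hm : ∀ p q k, moment 1 p q k (fun P => f P.1 * 1) = 0 := by
    intro p q k
    rw [moment_mul f (fun _ => 1)]
    have h1 := h0 (p, q)
    have e : ∀ x, dzeta p q x * f x = (√((p : ℝ) + q + 1) : ℂ) * (f x * discFun p q x) :=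
      fun x => by rw [dzeta]; ring
    simp only [e] at h1
    rw [integral_const_mul] at h1
    have h2 : (0 : ℝ) < √((p : ℝ) + q + 1) := by positivity
    rw [(mul_eq_zero.1 h1).resolve_left (by exact_mod_cast h2.ne'), zero_mul]
  have h1 := ae_eq_zero_of_moment_eq_zero hh (by simpa [cylMeasure] using hi.comp_fst (axialMeasure 1)) hm
  have h2 := Measure.ae_ae_of_ae_prod h1
  filter_upwards [h2] with x hx
  have hne : axialMeasure 1 ≠ 0 := by
    intro h0
    have := axialMass_pos hh
    simp [axialMass, h0] at this
  have : NeBot (ae (axialMeasure 1)) := ae_neBot.2 hne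
  simpa using hx.exists.choose_spec

lemma tau_complete {h : ℝ} (hh : 0 < h) (f : ℝ → ℂ) (hi : Integrable f (axialMeasure h))
    (h0 : ∀ k, ∫ z, (tau h k z : ℂ) * f z ∂axialMeasure h = 0) : f =ᵐ[axialMeasure h] 0 := by
  have := isFiniteMeasure_axialMeasure hh
  have hm : ∀ p q k, moment h p q k (fun P => 1 * f P.2) = 0 := by
    intro p q k
    rw [moment_mul (fun _ => 1) f]
    have h1 := h0 k
    have e : ∀ z, (tau h k z : ℂ) * f z = (chebNorm h k : ℂ) * (f z * (cheb h k z : ℂ)) :=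
      fun x => by rw [tau]; push_cast; ring
    simp only [e] at h1
    rw [integral_const_mul] at h1
    rw [(mul_eq_zero.1 h1).resolve_left (by exact_mod_cast (chebNorm_pos hh k).ne'), mul_zero]
  have h1 := ae_eq_zero_of_moment_eq_zero hh (by simpa [cylMeasure] using hi.comp_snd discMeasure) hm
  have h2 := Measure.ae_ae_of_ae_prod h1
  have h3 : ∃ x : ℂ, ∀ᵐ z ∂axialMeasure h, 1 * f z = 0 := h2.exists
  obtain ⟨_, h3⟩ := h3
  simpa using! h3

/-- The orthonormal basis of `L²(D)` consisting of the conjugates of the `dzeta p q`. -/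
lemma exists_discBasis : ∃ b : HilbertBasis (ℕ × ℕ) ℂ (Lp ℂ 2 discMeasure),
    ∀ i (f : Lp ℂ 2 discMeasure), b.repr f i = ∫ x, dzeta i.1 i.2 x * f x ∂discMeasure :=
  exists_hilbertBasis_conj (fun i => memLp_of_continuous_disc (continuous_dzeta i.1 i.2))
    (fun i j => by rw [integral_dzeta]; congr) dzeta_complete

/-! ### First-order relations between the weak derivatives -/

lemma contDiff_dirDeriv {φ : ℂ × ℝ → ℂ} (hφ : ContDiff ℝ ∞ φ) (v : ℂ × ℝ) :
    ContDiff ℝ ∞ (dirDeriv v φ) :=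
  (hφ.fderiv_right (m := ∞) (by simp)).clm_apply contDiff_const

lemma tsupport_dirDeriv_subset (φ : ℂ × ℝ → ℂ) (v : ℂ × ℝ) :
    tsupport (dirDeriv v φ) ⊆ tsupport φ :=
  tsupport_fderiv_apply_subset ℝ v

lemma dirDeriv_comm {φ : ℂ × ℝ → ℂ} (hφ : ContDiff ℝ ∞ φ) (u v : ℂ × ℝ) :
    dirDeriv u (dirDeriv v φ) = dirDeriv v (dirDeriv u φ) := by
  have hd : Differentiable ℝ (fderiv ℝ φ) :=
    (hφ.fderiv_right (m := 1) (by norm_cast)).differentiable (by simp)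
  have key : ∀ (u v p : ℂ × ℝ), dirDeriv u (dirDeriv v φ) p = fderiv ℝ (fderiv ℝ φ) p u v := by
    intro u v p
    unfold dirDeriv
    rw [fderiv_clm_apply (hd p) (differentiableAt_const v)]
    simp
  funext p
  rw [key, key]
  have h2 : (2 : WithTop ℕ∞) ≤ ∞ := WithTop.coe_le_coe.2 (le_top : (2 : ℕ∞) ≤ ⊤)
  exact (hφ.contDiffAt.isSymmSndFDerivAt (by simpa using h2)) u v

lemma iterate_dirDeriv_comm (u v : ℂ × ℝ) (n : ℕ) : ∀ {φ : ℂ × ℝ → ℂ}, ContDiff ℝ ∞ φ →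
    (dirDeriv u)^[n] (dirDeriv v φ) = dirDeriv v ((dirDeriv u)^[n] φ) := by
  induction n with
  | zero => intro φ _; rfl
  | succ n ih =>
    intro φ hφ
    rw [Function.iterate_succ_apply, Function.iterate_succ_apply, dirDeriv_comm hφ,
      ih (contDiff_dirDeriv hφ u)]

/-- Two weak derivatives of `w` whose multi-indices differ by one direction `v` are related by one
weak derivative. -/
lemma IsWeakDeriv.hasWeakDirDeriv {h : ℝ} {v : ℂ × ℝ} {a b k a' b' k' : ℕ} {w g g' : ℂ × ℝ → ℂ}
    (hg : IsWeakDeriv h a b k w g) (hg' : IsWeakDeriv h a' b' k' w g')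
    (hn : a' + b' + k' = a + b + k + 1)
    (hm : ∀ φ, ContDiff ℝ ∞ φ → mixedDeriv a b k (dirDeriv v φ) = mixedDeriv a' b' k' φ) :
    HasWeakDirDeriv h v g g' := by
  intro φ hφ hc hs
  have h1 := hg.2.2 (dirDeriv v φ) (contDiff_dirDeriv hφ v)
    (hc.of_isClosed_subset (isClosed_tsupport _) (tsupport_dirDeriv_subset φ v))
    ((tsupport_dirDeriv_subset φ v).trans hs)
  have h2 := hg'.2.2 φ hφ hc hs
  rw [hm φ hφ, h2, hn, pow_succ] at h1
  have h3 : ((-1 : ℂ) ^ (a + b + k)) ≠ 0 := by simp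
  refine mul_left_cancel₀ h3 ?_
  rw [← h1]; ring

lemma weakDeriv_spec {h : ℝ} {s : ℕ} {w : ℂ × ℝ → ℂ} (hw : MemSobolev h s w) {a b k : ℕ}
    (hab : a + b ≤ s) (hk : k ≤ s) : IsWeakDeriv h a b k w (weakDeriv h a b k w) ∧
      MemLp (weakDeriv h a b k w) 2 (cylMeasure h) := by
  have H := hw a b k hab hk
  rw [weakDeriv, dif_pos H]
  exact H.choose_spec

lemma hasWeakDirDeriv_x {h : ℝ} {s : ℕ} {w : ℂ × ℝ → ℂ} (hw : MemSobolev h s w) {a b : ℕ}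
    (hab : a + b < s) :
    HasWeakDirDeriv h (1, 0) (weakDeriv h a b 0 w) (weakDeriv h (a + 1) b 0 w) := by
  refine (weakDeriv_spec hw hab.le s.zero_le).1.hasWeakDirDeriv
    (weakDeriv_spec hw (by omega) s.zero_le).1 (by omega) fun φ hφ => ?_
  simp only [mixedDeriv, Function.iterate_zero, id]
  rw [iterate_dirDeriv_comm _ _ _ hφ, Function.iterate_succ_apply]

lemma hasWeakDirDeriv_y {h : ℝ} {s : ℕ} {w : ℂ × ℝ → ℂ} (hw : MemSobolev h s w) {a b : ℕ}
    (hab : a + b < s) :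
    HasWeakDirDeriv h (Complex.I, 0) (weakDeriv h a b 0 w) (weakDeriv h a (b + 1) 0 w) :=
  (weakDeriv_spec hw hab.le s.zero_le).1.hasWeakDirDeriv
    (weakDeriv_spec hw (by omega) s.zero_le).1 (by omega) fun _ _ => rfl

lemma hasWeakDirDeriv_z {h : ℝ} {s : ℕ} {w : ℂ × ℝ → ℂ} (hw : MemSobolev h s w) {k : ℕ}
    (hk : k < s) :
    HasWeakDirDeriv h (0, 1) (weakDeriv h 0 0 k w) (weakDeriv h 0 0 (k + 1) w) :=
  (weakDeriv_spec hw (by omega) hk.le).1.hasWeakDirDeriv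
    (weakDeriv_spec hw (by omega) hk).1 (by omega) fun _ _ => rfl

/-- The chosen weak derivative of order zero is `w` itself, by the fundamental lemma of the calculus
of variations. -/
lemma ae_eq_weakDeriv_zero {h : ℝ} (hh : 0 < h) {s : ℕ} {w : ℂ × ℝ → ℂ} (hw : MemSobolev h s w) :
    w =ᵐ[cylMeasure h] weakDeriv h 0 0 0 w := by
  obtain ⟨⟨h1, h2, h3⟩, -⟩ := weakDeriv_spec hw (a := 0) (b := 0) (k := 0) (by omega) (by omega)
  set g := weakDeriv h 0 0 0 w
  refine (ae_cylMeasure_iff hh).2 ?_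
  rw [ae_restrict_iff' (measurableSet_cylinder h)]
  have key := (isOpen_cylinder h).ae_eq_zero_of_integral_contDiff_smul_eq_zero (μ := volume)
    (f := fun p => w p - g p) (h1.sub h2) fun φ hφ hc hs => ?_
  · filter_upwards [key] with p hp hpc
    exact sub_eq_zero.1 (hp hpc)
  · have hc' : HasCompactSupport fun p => (φ p : ℂ) := hc.comp_left (g := fun r : ℝ => (r : ℂ)) rfl
    have hs' : tsupport (fun p => (φ p : ℂ)) ⊆ cylinder h :=
      (tsupport_comp_subset (g := fun r : ℝ => (r : ℂ)) rfl φ).trans hs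
    have h4 := h3 (fun p => (φ p : ℂ)) (Complex.ofRealCLM.contDiff.comp hφ) hc' hs'
    simp only [mixedDeriv, Function.iterate_zero, id, add_zero, pow_zero, one_mul] at h4
    have hint : ∀ u : ℂ × ℝ → ℂ, LocallyIntegrableOn u (cylinder h) →
        IntegrableOn (fun p => u p * (φ p : ℂ)) (cylinder h) := by
      intro u hu
      have i1 : IntegrableOn u (tsupport φ) := hu.integrableOn_compact_subset hs hc
      have i2 : IntegrableOn (fun p => u p * (φ p : ℂ)) (tsupport φ) :=
        i1.mul_continuousOn (Complex.continuous_ofReal.comp hφ.continuous).continuousOn hc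
      refine (integrableOn_iff_integrable_of_support_subset fun p hp => ?_).1 i2 |>.integrableOn
      by_contra hcon
      exact hp (by simp [image_eq_zero_of_notMem_tsupport hcon])
    have e1 : ∀ p, φ p • (w p - g p) = w p * (φ p : ℂ) - g p * (φ p : ℂ) := fun p => by
      rw [Complex.real_smul]; ring
    simp_rw [e1]
    rw [← setIntegral_eq_integral_of_forall_compl_eq_zero (s := cylinder h),
      integral_sub (hint w h1) (hint g h2), h4, sub_self]
    intro p hp
    simp [image_eq_zero_of_notMem_tsupport fun hcon => hp (hs hcon)]

/-! ### Decay of the coefficients -/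

lemma enorm_sq_le_of_mul_norm_le {n : ℕ} {a b c d e : ℂ}
    (H : n * ‖a‖ ≤ ‖b‖ + ‖c‖ + ‖d‖ + ‖e‖) :
    (n : ENNReal) ^ 2 * ‖a‖ₑ ^ 2 ≤ 4 * ((‖b‖ₑ ^ 2 + ‖d‖ₑ ^ 2) + (‖c‖ₑ ^ 2 + ‖e‖ₑ ^ 2)) := by
  have h1 : (n : ℝ) ^ 2 * ‖a‖ ^ 2 ≤ 4 * ((‖b‖ ^ 2 + ‖d‖ ^ 2) + (‖c‖ ^ 2 + ‖e‖ ^ 2)) := by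
    have h2 : (n * ‖a‖) ^ 2 ≤ (‖b‖ + ‖c‖ + ‖d‖ + ‖e‖) ^ 2 := by gcongr
    nlinarith [sq_nonneg (‖b‖ - ‖c‖), sq_nonneg (‖b‖ - ‖d‖), sq_nonneg (‖b‖ - ‖e‖),
      sq_nonneg (‖c‖ - ‖d‖), sq_nonneg (‖c‖ - ‖e‖), sq_nonneg (‖d‖ - ‖e‖)]
  have h2 : (n : NNReal) ^ 2 * ‖a‖₊ ^ 2 ≤
      4 * ((‖b‖₊ ^ 2 + ‖d‖₊ ^ 2) + (‖c‖₊ ^ 2 + ‖e‖₊ ^ 2)) := by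
    rw [← NNReal.coe_le_coe]; push_cast; exact h1
  simp only [enorm_eq_nnnorm]
  exact_mod_cast h2

lemma tsum_tsum_comp_le (E : ℕ → ℕ → ENNReal) {f g : ℕ → ℕ} (hf : Function.Injective f)
    (hg : Function.Injective g) : ∑' p, ∑' q, E (f p) (g q) ≤ ∑' p, ∑' q, E p q :=
  (ENNReal.tsum_le_tsum fun p => ENNReal.tsum_comp_le_tsum_of_injective hg (E (f p))).trans
    (ENNReal.tsum_comp_le_tsum_of_injective hf fun p => ∑' q, E p q)

/-- One step of the decay on the disc: a bound of `(p + q + 1) D` by neighbours in `E` gains one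
power of the degree. -/
lemma tsum_tsum_pow_succ_le {D E : ℕ → ℕ → ENNReal}
    (h1 : ∀ p q : ℕ, ((p + q + 2 : ℕ) : ENNReal) ^ 2 * D p (q + 1) ≤ E (p + 1) (q + 1) + E p q)
    (h2 : ∀ p q : ℕ, ((p + q + 2 : ℕ) : ENNReal) ^ 2 * D (p + 1) q ≤ E (p + 1) (q + 1) + E p q)
    (r : ℕ) :
    ∑' p : ℕ, ∑' q : ℕ, ((p + q + 1 : ℕ) : ENNReal) ^ (2 * (r + 1)) * D p q ≤
      D 0 0 + 2 * (1 + 4 ^ r) * ∑' p : ℕ, ∑' q : ℕ, ((p + q + 1 : ℕ) : ENNReal) ^ (2 * r) * E p q := by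
  set S := ∑' p : ℕ, ∑' q : ℕ, ((p + q + 1 : ℕ) : ENNReal) ^ (2 * r) * E p q with hS
  set F : ℕ → ℕ → ENNReal := fun p q => ((p + q + 1 : ℕ) : ENNReal) ^ (2 * (r + 1)) * D p q with hF
  have hw : ∀ p q : ℕ, ((p + q + 2 : ℕ) : ENNReal) ^ (2 * r) * (E (p + 1) (q + 1) + E p q) ≤
      ((p + 1 + (q + 1) + 1 : ℕ) : ENNReal) ^ (2 * r) * E (p + 1) (q + 1) +
      4 ^ r * (((p + q + 1 : ℕ) : ENNReal) ^ (2 * r) * E p q) := by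
    intro p q
    rw [mul_add, ← mul_assoc]
    refine add_le_add ?_ ?_
    · have : ((p + q + 2 : ℕ) : ENNReal) ≤ ((p + 1 + (q + 1) + 1 : ℕ) : ENNReal) := by
        exact_mod_cast (by omega)
      gcongr ?_ ^ (2 * r) * _
    · gcongr
      have : (4 : ENNReal) ^ r * ((p + q + 1 : ℕ) : ENNReal) ^ (2 * r) =
          ((2 * (p + q + 1) : ℕ) : ENNReal) ^ (2 * r) := by
        rw [show (4 : ENNReal) = 2 ^ 2 by norm_num, ← pow_mul, ← mul_pow]; push_cast; rfl
      rw [this]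
      gcongr; omega
  have hsum : ∀ D' : ℕ → ℕ → ENNReal,
      (∀ p q : ℕ, ((p + q + 2 : ℕ) : ENNReal) ^ 2 * D' p q ≤ E (p + 1) (q + 1) + E p q) →
      ∑' p : ℕ, ∑' q : ℕ, ((p + q + 2 : ℕ) : ENNReal) ^ (2 * (r + 1)) * D' p q ≤ (1 + 4 ^ r) * S := by
    intro D' hD'
    calc ∑' p : ℕ, ∑' q : ℕ, ((p + q + 2 : ℕ) : ENNReal) ^ (2 * (r + 1)) * D' p q
        ≤ ∑' p : ℕ, ∑' q : ℕ, (((p + 1 + (q + 1) + 1 : ℕ) : ENNReal) ^ (2 * r) *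
            E (p + 1) (q + 1) + 4 ^ r * (((p + q + 1 : ℕ) : ENNReal) ^ (2 * r) * E p q)) := by
          refine ENNReal.tsum_le_tsum fun p => ENNReal.tsum_le_tsum fun q => ?_
          refine le_trans ?_ (hw p q)
          rw [mul_add, pow_add, mul_one, mul_assoc]
          gcongr
          exact hD' p q
      _ = ∑' p : ℕ, ∑' q : ℕ, ((p + 1 + (q + 1) + 1 : ℕ) : ENNReal) ^ (2 * r) *
            E (p + 1) (q + 1) + 4 ^ r * S := by
          simp_rw [ENNReal.tsum_add, ENNReal.tsum_mul_left]
          rfl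
      _ ≤ S + 4 ^ r * S := by
          gcongr
          exact tsum_tsum_comp_le (fun p q => ((p + q + 1 : ℕ) : ENNReal) ^ (2 * r) * E p q)
            (Nat.succ_injective) (Nat.succ_injective)
      _ = (1 + 4 ^ r) * S := by ring
  have hsplit : ∑' p, ∑' q, F p q ≤ F 0 0 + ∑' p, ∑' q, F (p + 1) q + ∑' p, ∑' q, F p (q + 1) := by
    have e1 : ∀ p, ∑' q, F p q = F p 0 + ∑' q, F p (q + 1) := fun p =>
      tsum_eq_zero_add' ENNReal.summable
    simp_rw [fun p => e1 p]
    rw [ENNReal.tsum_add]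
    gcongr
    rw [tsum_eq_zero_add' ENNReal.summable]
    gcongr with p
    exact ENNReal.le_tsum 0 (f := fun q => F (p + 1) q)
      |>.trans (by rw [← e1])
  refine hsplit.trans ?_
  have t1 : ∑' p, ∑' q, F (p + 1) q ≤ (1 + 4 ^ r) * S := by
    refine le_trans (le_of_eq ?_) (hsum (fun p q => D (p + 1) q) h2)
    refine tsum_congr fun p => tsum_congr fun q => ?_
    simp only [hF]
    rw [show p + 1 + q + 1 = p + q + 2 by omega]
  have t2 : ∑' p, ∑' q, F p (q + 1) ≤ (1 + 4 ^ r) * S := by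
    refine le_trans (le_of_eq ?_) (hsum (fun p q => D p (q + 1)) h1)
    refine tsum_congr fun p => tsum_congr fun q => ?_
    simp only [hF]
    rw [show p + (q + 1) + 1 = p + q + 2 by omega]
  calc F 0 0 + ∑' p, ∑' q, F (p + 1) q + ∑' p, ∑' q, F p (q + 1)
      ≤ F 0 0 + (1 + 4 ^ r) * S + (1 + 4 ^ r) * S := by gcongr
    _ = D 0 0 + 2 * (1 + 4 ^ r) * S := by simp only [hF]; simp; ring

/-- The one-dimensional analogue of `tsum_tsum_pow_succ_le`. -/
lemma tsum_pow_succ_le {D E : ℕ → ENNReal}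
    (h1 : ∀ k : ℕ, ((k + 1 : ℕ) : ENNReal) ^ 2 * D (k + 1) ≤ E k + E (k + 2)) (r : ℕ) :
    ∑' k : ℕ, ((k + 1 : ℕ) : ENNReal) ^ (2 * (r + 1)) * D k ≤
      D 0 + 4 * (1 + 4 ^ r) * ∑' k : ℕ, ((k + 1 : ℕ) : ENNReal) ^ (2 * r) * E k := by
  set S := ∑' k : ℕ, ((k + 1 : ℕ) : ENNReal) ^ (2 * r) * E k with hS
  have h4 : ∀ n k : ℕ, (4 : ENNReal) ^ n * ((k + 1 : ℕ) : ENNReal) ^ (2 * n) =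
      ((2 * (k + 1) : ℕ) : ENNReal) ^ (2 * n) := fun n k => by
    rw [show (4 : ENNReal) = 2 ^ 2 by norm_num, ← pow_mul, ← mul_pow]; push_cast; rfl
  rw [tsum_eq_zero_add' ENNReal.summable]
  have hterm : ∀ k : ℕ, ((k + 1 + 1 : ℕ) : ENNReal) ^ (2 * (r + 1)) * D (k + 1) ≤
      4 * (4 ^ r * (((k + 1 : ℕ) : ENNReal) ^ (2 * r) * E k) +
        ((k + 2 + 1 : ℕ) : ENNReal) ^ (2 * r) * E (k + 2)) := by
    intro k
    calc ((k + 1 + 1 : ℕ) : ENNReal) ^ (2 * (r + 1)) * D (k + 1)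
        = ((k + 2 : ℕ) : ENNReal) ^ (2 * r) * (((k + 2 : ℕ) : ENNReal) ^ (2 * 1) * D (k + 1)) := by
          rw [← mul_assoc, ← pow_add]; rfl
      _ ≤ ((k + 2 : ℕ) : ENNReal) ^ (2 * r) * ((4 ^ 1 * ((k + 1 : ℕ) : ENNReal) ^ (2 * 1)) *
          D (k + 1)) := by
          rw [h4]; gcongr; omega
      _ = 4 * (((k + 2 : ℕ) : ENNReal) ^ (2 * r) * (((k + 1 : ℕ) : ENNReal) ^ 2 * D (k + 1))) := by
          ring
      _ ≤ 4 * (((k + 2 : ℕ) : ENNReal) ^ (2 * r) * (E k + E (k + 2))) := by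
          gcongr; exact h1 k
      _ ≤ _ := by
          rw [mul_add (((k + 2 : ℕ) : ENNReal) ^ (2 * r)), ← mul_assoc (4 ^ r), h4]
          have t1 : ((k + 2 : ℕ) : ENNReal) ≤ ((2 * (k + 1) : ℕ) : ENNReal) := by
            exact_mod_cast (by omega)
          have t2 : ((k + 2 : ℕ) : ENNReal) ≤ ((k + 2 + 1 : ℕ) : ENNReal) := by
            exact_mod_cast (by omega)
          gcongr 4 * (?_ ^ (2 * r) * _ + ?_ ^ (2 * r) * _)
  calc ((0 + 1 : ℕ) : ENNReal) ^ (2 * (r + 1)) * D 0 +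
        ∑' k : ℕ, ((k + 1 + 1 : ℕ) : ENNReal) ^ (2 * (r + 1)) * D (k + 1)
      ≤ D 0 + ∑' k : ℕ, 4 * (4 ^ r * (((k + 1 : ℕ) : ENNReal) ^ (2 * r) * E k) +
        ((k + 2 + 1 : ℕ) : ENNReal) ^ (2 * r) * E (k + 2)) := by
        refine add_le_add (by simp) (ENNReal.tsum_le_tsum hterm)
    _ = D 0 + 4 * (4 ^ r * S + ∑' k : ℕ, ((k + 2 + 1 : ℕ) : ENNReal) ^ (2 * r) * E (k + 2)) := by
        rw [ENNReal.tsum_mul_left, ENNReal.tsum_add, ENNReal.tsum_mul_left]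
    _ ≤ D 0 + 4 * (4 ^ r * S + S) := by
        gcongr
        exact ENNReal.tsum_comp_le_tsum_of_injective (add_left_injective 2)
          (fun k : ℕ => ((k + 1 : ℕ) : ENNReal) ^ (2 * r) * E k)
    _ = D 0 + 4 * (1 + 4 ^ r) * S := by ring

lemma sqrt_le_two_mul_sqrt {a b : ℝ} (hab : b ≤ 4 * a) : √b ≤ 2 * √a := by
  have : (2 : ℝ) * √a = √(4 * a) := by
    rw [Real.sqrt_mul (by norm_num), show (4 : ℝ) = 2 ^ 2 by norm_num, Real.sqrt_sq (by norm_num)]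
  rw [this]; exact Real.sqrt_le_sqrt hab

lemma norm_coef (h : ℝ) (hh : 0 < h) (p q k : ℕ) (w : ℂ × ℝ → ℂ) : ‖coef h ((p, q), k) w‖ =
    √((p : ℝ) + q + 1) * chebNorm h k * ‖moment h p q k w‖ := by
  have := chebNorm_pos hh k
  rw [coef_eq_moment, norm_mul, Complex.norm_real, Real.norm_of_nonneg (by positivity)]

/-- A bound for a moment of degree `n` by those of degrees `n + 1` and `n - 1`, in terms of the
normalised coefficients. -/
lemma mul_norm_coef_le {h : ℝ} (hh : 0 < h) {w g₁ g₂ : ℂ × ℝ → ℂ} {p q a b k : ℕ}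
    (hab : a + b = p + q + 1) {c : ℂ} (hc : ‖c‖ = 1)
    (H : ((p : ℂ) + q + 2) * moment h a b k w =
      -(1 / 2) * ((moment h (p + 1) (q + 1) k g₁ - moment h p q k g₁) +
        c * (moment h (p + 1) (q + 1) k g₂ - moment h p q k g₂))) :
    ((p + q + 2 : ℕ) : ℝ) * ‖coef h ((a, b), k) w‖ ≤ ‖coef h ((p + 1, q + 1), k) g₁‖ +
      ‖coef h ((p, q), k) g₁‖ + ‖coef h ((p + 1, q + 1), k) g₂‖ + ‖coef h ((p, q), k) g₂‖ := by
  have hν := chebNorm_pos hh k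
  have hab' : (a : ℝ) + b + 1 = p + q + 2 := by
    have : ((a + b : ℕ) : ℝ) = ((p + q + 1 : ℕ) : ℝ) := by rw [hab]
    push_cast at this; linarith
  simp only [norm_coef h hh]
  rw [hab']
  push_cast
  have h0 : ‖((p : ℂ) + q + 2)‖ = (p : ℝ) + q + 2 := by
    have : ((p : ℂ) + q + 2) = (((p : ℝ) + q + 2 : ℝ) : ℂ) := by push_cast; rfl
    rw [this, Complex.norm_real, Real.norm_of_nonneg (by positivity)]
  have h1 : ((p : ℝ) + q + 2) * ‖moment h a b k w‖ ≤ 1 / 2 * (‖moment h (p + 1) (q + 1) k g₁‖ +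
      ‖moment h p q k g₁‖ + ‖moment h (p + 1) (q + 1) k g₂‖ + ‖moment h p q k g₂‖) := by
    rw [← h0, ← norm_mul, H, norm_mul]
    have : ‖(-(1 / 2) : ℂ)‖ = 1 / 2 := by simp
    rw [this]
    gcongr
    refine (norm_add_le _ _).trans ?_
    rw [norm_mul, hc, one_mul]
    linarith [norm_sub_le (moment h (p + 1) (q + 1) k g₁) (moment h p q k g₁),
      norm_sub_le (moment h (p + 1) (q + 1) k g₂) (moment h p q k g₂)]
  have hp0 : (0 : ℝ) ≤ p := p.cast_nonneg
  have hq0 : (0 : ℝ) ≤ q := q.cast_nonneg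
  have s1 : √((p : ℝ) + q + 2) ≤ 2 * √((p : ℝ) + 1 + (q + 1) + 1) :=
    sqrt_le_two_mul_sqrt (by linarith)
  have s2 : √((p : ℝ) + q + 2) ≤ 2 * √((p : ℝ) + q + 1) :=
    sqrt_le_two_mul_sqrt (by linarith)
  set A := ‖moment h (p + 1) (q + 1) k g₁‖
  set B := ‖moment h p q k g₁‖
  set A' := ‖moment h (p + 1) (q + 1) k g₂‖
  set B' := ‖moment h p q k g₂‖
  calc ((p : ℝ) + q + 2) * (√((p : ℝ) + q + 2) * chebNorm h k * ‖moment h a b k w‖)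
      = √((p : ℝ) + q + 2) * chebNorm h k * (((p : ℝ) + q + 2) * ‖moment h a b k w‖) := by ring
    _ ≤ √((p : ℝ) + q + 2) * chebNorm h k * (1 / 2 * (A + B + A' + B')) := by gcongr
    _ = 1 / 2 * chebNorm h k * (√((p : ℝ) + q + 2) * A + √((p : ℝ) + q + 2) * B +
          √((p : ℝ) + q + 2) * A' + √((p : ℝ) + q + 2) * B') := by ring
    _ ≤ 1 / 2 * chebNorm h k * (2 * √((p : ℝ) + 1 + (q + 1) + 1) * A + 2 * √((p : ℝ) + q + 1) * B +
          2 * √((p : ℝ) + 1 + (q + 1) + 1) * A' + 2 * √((p : ℝ) + q + 1) * B') := by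
        gcongr
    _ = _ := by ring

/-- The part of `‖w‖²` carried by the disc index `(p, q)`. -/
def discEnergy (h : ℝ) (w : ℂ × ℝ → ℂ) (p q : ℕ) : ENNReal := ∑' k, ‖coef h ((p, q), k) w‖ₑ ^ 2

/-- The part of `‖w‖²` carried by the axial index `k`. -/
def axialEnergy (h : ℝ) (w : ℂ × ℝ → ℂ) (k : ℕ) : ENNReal :=
  ∑' i : ℕ × ℕ, ‖coef h (i, k) w‖ₑ ^ 2

lemma tsum_discEnergy {h : ℝ} (hh : 0 < h) {w : ℂ × ℝ → ℂ} (hw : MemLp w 2 (cylMeasure h)) :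
    ∑' p, ∑' q, discEnergy h w p q = eLpNorm w 2 (cylMeasure h) ^ 2 := by
  rw [← tsum_coef_sq hh hw, ENNReal.tsum_prod', ENNReal.tsum_prod']
  rfl

lemma tsum_axialEnergy {h : ℝ} (hh : 0 < h) {w : ℂ × ℝ → ℂ} (hw : MemLp w 2 (cylMeasure h)) :
    ∑' k, axialEnergy h w k = eLpNorm w 2 (cylMeasure h) ^ 2 := by
  rw [← tsum_coef_sq hh hw, ENNReal.tsum_prod', ENNReal.tsum_comm]
  rfl

/-- Coefficient decay on the disc: `r` weak derivatives in the disc directions give the weight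
`(p + q + 1)^(2r)`. -/
lemma exists_disc_decay {h : ℝ} (hh : 0 < h) (r : ℕ) : ∃ K : ENNReal, K ≠ ⊤ ∧
    ∀ (s : ℕ) (G : ℕ → ℕ → ℂ × ℝ → ℂ) (B : ENNReal),
      (∀ a b, a + b ≤ s → MemLp (G a b) 2 (cylMeasure h)) →
      (∀ a b, a + b ≤ s → eLpNorm (G a b) 2 (cylMeasure h) ^ 2 ≤ B) →
      (∀ a b, a + b < s → HasWeakDirDeriv h (1, 0) (G a b) (G (a + 1) b)) →
      (∀ a b, a + b < s → HasWeakDirDeriv h (Complex.I, 0) (G a b) (G a (b + 1))) →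
      ∀ a b, a + b + r ≤ s →
        ∑' p : ℕ, ∑' q : ℕ, ((p + q + 1 : ℕ) : ENNReal) ^ (2 * r) * discEnergy h (G a b) p q ≤
          K * B := by
  have := isFiniteMeasure_cylMeasure hh
  induction r with
  | zero =>
    refine ⟨1, by simp, fun s G B hm hB _ _ a b hab => ?_⟩
    simp only [mul_zero, pow_zero, one_mul]
    rw [tsum_discEnergy hh (hm a b hab)]
    exact hB a b hab
  | succ r ih =>
    obtain ⟨K, hK, ih⟩ := ih
    refine ⟨1 + 2 * (1 + 4 ^ r) * (4 * (K + K)), ?_, fun s G B hm hB hx hy a b hab => ?_⟩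
    · refine ENNReal.add_ne_top.2 ⟨by simp, ENNReal.mul_ne_top (ENNReal.mul_ne_top (by simp)
        (by simp)) (ENNReal.mul_ne_top (by simp) (by simp [hK]))⟩
    have hi : ∀ a b, a + b ≤ s → Integrable (G a b) (cylMeasure h) := fun a b hab =>
      (hm a b hab).integrable (by norm_num)
    have i0 := hi a b (by omega)
    have i1 := hi (a + 1) b (by omega)
    have i2 := hi a (b + 1) (by omega)
    have dx := hx a b (by omega)
    have dy := hy a b (by omega)
    set E : ℕ → ℕ → ENNReal := fun p q =>
      4 * (discEnergy h (G (a + 1) b) p q + discEnergy h (G a (b + 1)) p q) with hE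
    have hsum : ∀ {p q p' q' : ℕ}, (∀ k, ((p + q + 2 : ℕ) : ℝ) * ‖coef h ((p', q'), k) (G a b)‖ ≤
        ‖coef h ((p + 1, q + 1), k) (G (a + 1) b)‖ + ‖coef h ((p, q), k) (G (a + 1) b)‖ +
        ‖coef h ((p + 1, q + 1), k) (G a (b + 1))‖ + ‖coef h ((p, q), k) (G a (b + 1))‖) →
        ((p + q + 2 : ℕ) : ENNReal) ^ 2 * discEnergy h (G a b) p' q' ≤
          E (p + 1) (q + 1) + E p q := by
      intro p q p' q' H
      simp only [discEnergy, hE]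
      rw [← ENNReal.tsum_mul_left, ← mul_add, ← ENNReal.tsum_add, ← ENNReal.tsum_add,
        ← ENNReal.tsum_add, ← ENNReal.tsum_mul_left]
      exact ENNReal.tsum_le_tsum fun k => enorm_sq_le_of_mul_norm_le (H k)
    have key := tsum_tsum_pow_succ_le (D := discEnergy h (G a b)) (E := E)
      (fun p q => hsum fun k => mul_norm_coef_le hh (by omega) (c := -Complex.I) (by simp)
        (by rw [moment_succ_right hh dx dy i0 i1 i2]; ring))
      (fun p q => hsum fun k => mul_norm_coef_le hh (by omega) (c := Complex.I) (by simp)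
        (moment_succ_left hh dx dy i0 i1 i2 p q k)) r
    refine key.trans ?_
    have e0 : discEnergy h (G a b) 0 0 ≤ B := by
      refine le_trans ?_ (hB a b (by omega))
      rw [← tsum_discEnergy hh (hm a b (by omega))]
      exact (ENNReal.le_tsum 0 (f := fun q => discEnergy h (G a b) 0 q)).trans
        (ENNReal.le_tsum 0 (f := fun p => ∑' q, discEnergy h (G a b) p q))
    have e1 : ∑' p : ℕ, ∑' q : ℕ, ((p + q + 1 : ℕ) : ENNReal) ^ (2 * r) * E p q ≤
        4 * (K * B + K * B) := by
      have : ∀ p q : ℕ, ((p + q + 1 : ℕ) : ENNReal) ^ (2 * r) * E p q =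
          4 * (((p + q + 1 : ℕ) : ENNReal) ^ (2 * r) * discEnergy h (G (a + 1) b) p q +
          ((p + q + 1 : ℕ) : ENNReal) ^ (2 * r) * discEnergy h (G a (b + 1)) p q) := fun p q => by
        simp only [hE]; ring
      simp_rw [this, ENNReal.tsum_mul_left, ENNReal.tsum_add]
      gcongr
      · exact ih s G B hm hB hx hy (a + 1) b (by omega)
      · exact ih s G B hm hB hx hy a (b + 1) (by omega)
    calc discEnergy h (G a b) 0 0 + 2 * (1 + 4 ^ r) *
          ∑' p : ℕ, ∑' q : ℕ, ((p + q + 1 : ℕ) : ENNReal) ^ (2 * r) * E p q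
        ≤ B + 2 * (1 + 4 ^ r) * (4 * (K * B + K * B)) := by gcongr
      _ = (1 + 2 * (1 + 4 ^ r) * (4 * (K + K))) * B := by ring

lemma chebNorm_le {h : ℝ} (hh : 0 < h) (j k : ℕ) : chebNorm h j ≤ 2 * chebNorm h k := by
  have := axialMass_pos hh
  have h1 : ∀ n, √(1 / axialMass h) ≤ chebNorm h n ∧ chebNorm h n ≤ √(2 / axialMass h) := by
    intro n
    unfold chebNorm
    split_ifs
    · exact ⟨le_rfl, Real.sqrt_le_sqrt (by gcongr; norm_num)⟩
    · exact ⟨Real.sqrt_le_sqrt (by gcongr; norm_num), le_rfl⟩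
  have h2 : √(2 / axialMass h) ≤ 2 * √(1 / axialMass h) :=
    sqrt_le_two_mul_sqrt (by rw [← mul_div_assoc]; gcongr; norm_num)
  linarith [(h1 j).2, (h1 k).1]

lemma mul_norm_coef_axial_le {h : ℝ} (hh : 0 < h) {w g : ℂ × ℝ → ℂ}
    (hwg : HasWeakDirDeriv h (0, 1) w g) (hw : Integrable w (cylMeasure h))
    (hg : Integrable g (cylMeasure h)) (p q k : ℕ) :
    ((k + 1 : ℕ) : ℝ) * ‖coef h ((p, q), k + 1) w‖ ≤
      h / 2 * (‖coef h ((p, q), k) g‖ + ‖coef h ((p, q), k + 2) g‖) := by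
  have H := moment_axial_succ hh hwg hw hg p q k
  simp only [norm_coef h hh]
  have h0 : ‖(2 / h * (k + 1) : ℂ)‖ = 2 / h * (k + 1) := by
    have : (2 / h * (k + 1) : ℂ) = ((2 / h * (k + 1) : ℝ) : ℂ) := by push_cast; rfl
    rw [this, Complex.norm_real, Real.norm_of_nonneg (by positivity)]
  have h1 : 2 / h * (k + 1) * ‖moment h p q (k + 1) w‖ ≤
      1 / 2 * (‖moment h p q k g‖ + ‖moment h p q (k + 2) g‖) := by
    rw [← h0, ← norm_mul, H, norm_mul]
    have : ‖(-(1 / 2) : ℂ)‖ = 1 / 2 := by simp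
    rw [this]
    gcongr
    exact norm_sub_le _ _
  have n1 := chebNorm_le hh (k + 1) k
  have n2 := chebNorm_le hh (k + 1) (k + 2)
  have hν := chebNorm_pos hh (k + 1)
  set A := ‖moment h p q k g‖
  set B := ‖moment h p q (k + 2) g‖
  set R := √((p : ℝ) + q + 1)
  push_cast
  calc ((k : ℝ) + 1) * (R * chebNorm h (k + 1) * ‖moment h p q (k + 1) w‖)
      = h / 2 * (R * chebNorm h (k + 1)) * (2 / h * (k + 1) * ‖moment h p q (k + 1) w‖) := by
        field_simp
    _ ≤ h / 2 * (R * chebNorm h (k + 1)) * (1 / 2 * (A + B)) := by gcongr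
    _ = h / 4 * R * (chebNorm h (k + 1) * A + chebNorm h (k + 1) * B) := by ring
    _ ≤ h / 4 * R * (2 * chebNorm h k * A + 2 * chebNorm h (k + 2) * B) := by gcongr
    _ = _ := by ring

/-- Coefficient decay in the axial direction: `r` weak derivatives in `z` give the weight
`(k + 1)^(2r)`. -/
lemma exists_axial_decay {h : ℝ} (hh : 0 < h) (r : ℕ) : ∃ K : ENNReal, K ≠ ⊤ ∧
    ∀ (s : ℕ) (G : ℕ → ℂ × ℝ → ℂ) (B : ENNReal),
      (∀ a, a ≤ s → MemLp (G a) 2 (cylMeasure h)) →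
      (∀ a, a ≤ s → eLpNorm (G a) 2 (cylMeasure h) ^ 2 ≤ B) →
      (∀ a, a < s → HasWeakDirDeriv h (0, 1) (G a) (G (a + 1))) →
      ∀ a, a + r ≤ s →
        ∑' k : ℕ, ((k + 1 : ℕ) : ENNReal) ^ (2 * r) * axialEnergy h (G a) k ≤ K * B := by
  have := isFiniteMeasure_cylMeasure hh
  induction r with
  | zero =>
    refine ⟨1, by simp, fun s G B hm hB _ a ha => ?_⟩
    simp only [mul_zero, pow_zero, one_mul]
    rw [tsum_axialEnergy hh (hm a ha)]
    exact hB a ha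
  | succ r ih =>
    obtain ⟨K, hK, ih⟩ := ih
    set c : ENNReal := 2 * ENNReal.ofReal ((h / 2) ^ 2) with hc
    refine ⟨1 + 4 * (1 + 4 ^ r) * (c * K), ?_, fun s G B hm hB hz a ha => ?_⟩
    · refine ENNReal.add_ne_top.2 ⟨by simp, ENNReal.mul_ne_top (ENNReal.mul_ne_top (by simp)
        (by simp)) (ENNReal.mul_ne_top (ENNReal.mul_ne_top (by simp) (by simp)) hK)⟩
    have hi : ∀ a, a ≤ s → Integrable (G a) (cylMeasure h) := fun a ha =>
      (hm a ha).integrable (by norm_num)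
    have key := tsum_pow_succ_le (D := axialEnergy h (G a))
      (E := fun k => c * axialEnergy h (G (a + 1)) k) (fun k => ?_) r
    · refine key.trans ?_
      have e0 : axialEnergy h (G a) 0 ≤ B := by
        refine le_trans ?_ (hB a (by omega))
        rw [← tsum_axialEnergy hh (hm a (by omega))]
        exact ENNReal.le_tsum 0
      have e1 : ∑' k : ℕ, ((k + 1 : ℕ) : ENNReal) ^ (2 * r) * (c * axialEnergy h (G (a + 1)) k) ≤
          c * (K * B) := by
        simp_rw [mul_left_comm _ c]
        rw [ENNReal.tsum_mul_left]
        gcongr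
        exact ih s G B hm hB hz (a + 1) (by omega)
      calc _ ≤ B + 4 * (1 + 4 ^ r) * (c * (K * B)) := by gcongr
        _ = (1 + 4 * (1 + 4 ^ r) * (c * K)) * B := by ring
    · simp only [axialEnergy]
      rw [← mul_add, ← ENNReal.tsum_add, ← ENNReal.tsum_mul_left, ← ENNReal.tsum_mul_left]
      refine ENNReal.tsum_le_tsum fun i => ?_
      have h1 := mul_norm_coef_axial_le hh (hz a (by omega)) (hi a (by omega))
        (hi (a + 1) (by omega)) i.1 i.2 k
      set x := ‖coef h ((i.1, i.2), k + 1) (G a)‖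
      set y := ‖coef h ((i.1, i.2), k) (G (a + 1))‖
      set y' := ‖coef h ((i.1, i.2), k + 2) (G (a + 1))‖
      have h2 : (((k + 1 : ℕ) : ℝ)) ^ 2 * x ^ 2 ≤ 2 * (h / 2) ^ 2 * (y ^ 2 + y' ^ 2) := by
        have h3 : (((k + 1 : ℕ) : ℝ) * x) ^ 2 ≤ (h / 2 * (y + y')) ^ 2 := by gcongr
        nlinarith [mul_nonneg (sq_nonneg (h / 2)) (sq_nonneg (y - y'))]
      have h3 := ENNReal.ofReal_le_ofReal h2
      rw [ENNReal.ofReal_mul (by positivity), ENNReal.ofReal_mul (by positivity),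
        ENNReal.ofReal_add (by positivity) (by positivity), ENNReal.ofReal_mul (by norm_num),
        ENNReal.ofReal_pow (by positivity), ENNReal.ofReal_pow (norm_nonneg _),
        ENNReal.ofReal_pow (norm_nonneg _), ENNReal.ofReal_pow (norm_nonneg _),
        ofReal_norm, ofReal_norm, ofReal_norm, ENNReal.ofReal_natCast] at h3
      simpa [hc] using h3

/-! ### Chebyshev–Lobatto interpolation and aliasing -/

/-- The index of the Chebyshev polynomial of degree at most `J` that coincides with `T_k` in the
points `cos (πj/J)`: the distance of `k` to the nearest multiple of `2J`. -/
def aliasIndex (J k : ℕ) : ℕ := if k % (2 * J) ≤ J then k % (2 * J) else 2 * J - k % (2 * J)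

lemma aliasIndex_le {J : ℕ} (k : ℕ) : aliasIndex J k ≤ J := by
  unfold aliasIndex; split_ifs <;> omega

lemma aliasIndex_of_le {J k : ℕ} (hJ : 1 ≤ J) (hk : k ≤ J) : aliasIndex J k = k := by
  rw [aliasIndex, Nat.mod_eq_of_lt (by omega), if_pos hk]

lemma aliasIndex_block {J t : ℕ} (ht : 1 ≤ t) (htJ : t ≤ J) (l : ℕ) :
    aliasIndex J (l * J + t) = if Even l then t else J - t := by
  split_ifs with hl
  · obtain ⟨n, rfl⟩ := hl
    have : (n + n) * J + t = t + 2 * J * n := by ring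
    rw [aliasIndex, this, Nat.add_mul_mod_self_left, Nat.mod_eq_of_lt (by omega), if_pos htJ]
  · obtain ⟨n, rfl⟩ := Nat.not_even_iff_odd.1 hl
    have : (2 * n + 1) * J + t = (J + t) + 2 * J * n := by ring
    rw [aliasIndex, this, Nat.add_mul_mod_self_left]
    rcases htJ.eq_or_lt with rfl | h1
    · simp [← two_mul]
    · rw [Nat.mod_eq_of_lt (by omega), if_neg (by omega)]; omega

/-- Each block `lJ < k ≤ (l+1)J` contains at most one index with a given alias. -/
lemma aliasIndex_injective_block {J k k' : ℕ} (hJ : 1 ≤ J) (hk : 1 ≤ k) (hk' : 1 ≤ k')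
    (hb : (k - 1) / J = (k' - 1) / J) (ha : aliasIndex J k = aliasIndex J k') : k = k' := by
  have e : ∀ n, 1 ≤ n → n = (n - 1) / J * J + ((n - 1) % J + 1) := fun n hn => by
    have := Nat.div_add_mod' (n - 1) J; omega
  have m := Nat.mod_lt (k - 1) hJ
  have m' := Nat.mod_lt (k' - 1) hJ
  rw [e k hk, e k' hk', aliasIndex_block (by omega) (by omega),
    aliasIndex_block (by omega) (by omega), hb] at ha
  rw [e k hk, e k' hk', hb]
  split_ifs at ha <;> omega

lemma cos_aliasIndex {J : ℕ} (hJ : 1 ≤ J) (k j : ℕ) :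
    Real.cos (aliasIndex J k * (Real.pi * j / J)) = Real.cos (k * (Real.pi * j / J)) := by
  have hJ0 : (J : ℝ) ≠ 0 := by positivity
  have h1 : (k : ℝ) = (k % (2 * J) : ℕ) + 2 * J * (k / (2 * J) : ℕ) := by
    exact_mod_cast (Nat.mod_add_div k (2 * J)).symm
  have h2 : Real.cos (k * (Real.pi * j / J)) =
      Real.cos ((k % (2 * J) : ℕ) * (Real.pi * j / J)) := by
    rw [← Real.cos_add_nat_mul_two_pi ((k % (2 * J) : ℕ) * (Real.pi * j / J)) (k / (2 * J) * j)]
    conv_lhs => rw [h1]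
    congr 1
    push_cast
    field_simp
  rw [h2, aliasIndex]
  split_ifs
  · rfl
  · have := Nat.mod_lt k (show 0 < 2 * J by omega)
    rw [← Real.cos_neg, ← Real.cos_add_nat_mul_two_pi _ j, Nat.cast_sub this.le]
    congr 1
    push_cast
    field_simp
    ring

lemma tCoord_chebNode {h : ℝ} (hh : 0 < h) (J j : ℕ) :
    tCoord h (chebNode h J j) = Real.cos (Real.pi * j / J) := by
  unfold tCoord chebNode
  field_simp
  ring

lemma chebNode_mem {h : ℝ} (hh : 0 < h) (J j : ℕ) : chebNode h J j ∈ Icc (-h) 0 := by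
  unfold chebNode
  constructor <;> nlinarith [Real.cos_le_one (Real.pi * j / J), Real.neg_one_le_cos (Real.pi * j / J)]

lemma chebNode_injOn {h : ℝ} (hh : 0 < h) {J : ℕ} (hJ : 1 ≤ J) :
    InjOn (chebNode h J) (Finset.range (J + 1)) := by
  intro i hi j hj hij
  have hJ0 : (0 : ℝ) < J := by exact_mod_cast hJ
  have m : ∀ n ∈ Finset.range (J + 1), Real.pi * n / J ∈ Icc 0 Real.pi := by
    intro n hn
    have : (n : ℝ) ≤ J := by exact_mod_cast Nat.lt_succ_iff.1 (Finset.mem_range.1 hn)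
    refine ⟨by positivity, ?_⟩
    rw [div_le_iff₀ hJ0]
    gcongr
  have h1 := congrArg (tCoord h) hij
  rw [tCoord_chebNode hh, tCoord_chebNode hh] at h1
  have h2 := Real.injOn_cos (m i hi) (m j hj) h1
  field_simp at h2
  exact_mod_cast h2

lemma cheb_chebNode {h : ℝ} (hh : 0 < h) (J k j : ℕ) :
    cheb h k (chebNode h J j) = Real.cos (k * (Real.pi * j / J)) := by
  rw [cheb, tCoord_chebNode hh, Polynomial.Chebyshev.T_real_cos]
  norm_cast

/-- Aliasing: the interpolant of `T_k` is the Chebyshev polynomial with the aliased index. -/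
lemma sum_cheb_mul_lagrangeCheb {h : ℝ} (hh : 0 < h) {J : ℕ} (hJ : 1 ≤ J) (k : ℕ) (z : ℝ) :
    ∑ j ∈ Finset.range (J + 1), cheb h k (chebNode h J j) * lagrangeCheb h J j z =
      cheb h (aliasIndex J k) z := by
  set P : Polynomial ℝ := (Polynomial.Chebyshev.T ℝ (aliasIndex J k)).comp
    (Polynomial.C (-1) + Polynomial.C (-(2 / h)) * Polynomial.X) with hP
  have hev : ∀ z, P.eval z = cheb h (aliasIndex J k) z := fun z => by
    rw [hP, Polynomial.eval_comp, cheb, tCoord]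
    congr 1
    simp
    ring
  have hdeg : P.degree < (Finset.range (J + 1)).card := by
    refine (Polynomial.degree_le_natDegree).trans_lt ?_
    have h1 : P.natDegree ≤ J := by
      refine (Polynomial.natDegree_comp_le).trans ?_
      rw [Polynomial.Chebyshev.natDegree_T, Int.natAbs_natCast]
      have : (Polynomial.C (-1) + Polynomial.C (-(2 / h)) * Polynomial.X : Polynomial ℝ).natDegree
          ≤ 1 := by compute_degree
      exact (Nat.mul_le_mul (aliasIndex_le k) this).trans_eq (mul_one J)
    rw [Finset.card_range]
    exact_mod_cast Nat.lt_succ_of_le h1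
  have h2 := Lagrange.eq_interpolate_of_eval_eq (fun j => cheb h k (chebNode h J j))
    (chebNode_injOn hh hJ) hdeg fun j _ => by
      rw [hev, cheb_chebNode hh, cheb_chebNode hh, cos_aliasIndex hJ]
  rw [← hev z, h2, Lagrange.interpolate_apply, Polynomial.eval_finsetSum]
  simp [lagrangeCheb]

/-! ### Chebyshev series -/

lemma norm_tau_le {h : ℝ} (hh : 0 < h) (k : ℕ) {z : ℝ} (hz : z ∈ Icc (-h) 0) :
    ‖(tau h k z : ℂ)‖ ≤ 2 * chebNorm h 0 := by
  have h1 : |cheb h k z| ≤ 1 := by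
    rw [cheb_eq_cos k (tCoord_mem_Icc hh hz)]; exact Real.abs_cos_le_one _
  rw [Complex.norm_real, tau, Real.norm_eq_abs, abs_mul, abs_of_pos (chebNorm_pos hh k)]
  have := chebNorm_pos hh k
  calc chebNorm h k * |cheb h k z| ≤ chebNorm h k * 1 := by gcongr
    _ ≤ _ := by rw [mul_one]; exact chebNorm_le hh k 0

lemma summable_tau_smul {E : Type*} [NormedAddCommGroup E] [NormedSpace ℂ E] [CompleteSpace E]
    {h : ℝ} (hh : 0 < h) {e : ℕ → E} (he : Summable fun k => ‖e k‖) {z : ℝ}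
    (hz : z ∈ Icc (-h) 0) : Summable fun k => (tau h k z : ℂ) • e k := by
  refine Summable.of_norm_bounded (he.mul_left (2 * chebNorm h 0)) fun k => ?_
  rw [norm_smul]
  gcongr
  exact norm_tau_le hh k hz

lemma continuousOn_tsum_tau {E : Type*} [NormedAddCommGroup E] [NormedSpace ℂ E] [CompleteSpace E]
    {h : ℝ} (hh : 0 < h) {e : ℕ → E} (he : Summable fun k => ‖e k‖) :
    ContinuousOn (fun z => ∑' k, (tau h k z : ℂ) • e k) (Icc (-h) 0) := by
  refine continuousOn_tsum (fun k => ?_) (he.mul_left (2 * chebNorm h 0)) fun k z hz => ?_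
  · exact ((Complex.continuous_ofReal.comp (continuous_tau h k)).smul continuous_const).continuousOn
  · rw [norm_smul]
    gcongr
    exact norm_tau_le hh k hz

lemma integrable_of_continuousOn_axial {h : ℝ} (hh : 0 < h) {f : ℝ → ℂ}
    (hf : ContinuousOn f (Icc (-h) 0)) : Integrable f (axialMeasure h) := by
  have := isFiniteMeasure_axialMeasure hh
  exact (memLp_of_continuousOn_axial hh hf).integrable (by norm_num)

/-- An integrable function with absolutely summable Chebyshev coefficients is the sum of its
Chebyshev series. -/
lemma ae_eq_tsum_tau {h : ℝ} (hh : 0 < h) {F : ℝ → ℂ} (hF : Integrable F (axialMeasure h))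
    {a : ℕ → ℂ} (ha : ∀ k, ∫ z, (tau h k z : ℂ) * F z ∂axialMeasure h = a k)
    (hs : Summable fun k => ‖a k‖) :
    F =ᵐ[axialMeasure h] fun z => ∑' k, (tau h k z : ℂ) • a k := by
  have := isFiniteMeasure_axialMeasure hh
  have hν := chebNorm_pos hh 0
  have hG := continuousOn_tsum_tau hh hs
  have ht : ∀ k, Continuous fun z => (tau h k z : ℂ) :=
    fun k => Complex.continuous_ofReal.comp (continuous_tau h k)
  have hFm : ∀ k, Integrable (fun z => (tau h k z : ℂ) * F z) (axialMeasure h) := fun k =>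
    hF.bdd_mul (c := 2 * chebNorm h 0) (ht k).aestronglyMeasurable
      ((ae_mem_Ioo h).mono fun z hz => norm_tau_le hh k (Ioo_subset_Icc_self hz))
  have hGm : ∀ k, Integrable (fun z => (tau h k z : ℂ) * ∑' k, (tau h k z : ℂ) • a k)
      (axialMeasure h) := fun k => integrable_of_continuousOn_axial hh ((ht k).continuousOn.mul hG)
  have key : ∀ m, ∫ z, (tau h m z : ℂ) * ∑' k, (tau h k z : ℂ) • a k ∂axialMeasure h = a m := by
    intro m
    have hi : ∀ k, Integrable (fun z => (tau h m z : ℂ) * ((tau h k z : ℂ) • a k))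
        (axialMeasure h) := fun k =>
      integrable_of_continuous_axial hh ((ht m).mul ((ht k).smul continuous_const))
    have hsum : Summable fun k => ∫ z, ‖(tau h m z : ℂ) * ((tau h k z : ℂ) • a k)‖ ∂axialMeasure h := by
      refine Summable.of_nonneg_of_le (fun k => integral_nonneg fun z => norm_nonneg _) (fun k => ?_)
        (hs.mul_left ((2 * chebNorm h 0) * (2 * chebNorm h 0) * axialMass h))
      have h1 : ∀ᵐ z ∂axialMeasure h, ‖(tau h m z : ℂ) * ((tau h k z : ℂ) • a k)‖ ≤
          (2 * chebNorm h 0) * ((2 * chebNorm h 0) * ‖a k‖) := by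
        filter_upwards [ae_mem_Ioo h] with z hz
        have hz' := Ioo_subset_Icc_self hz
        rw [norm_mul, norm_smul]
        gcongr
        · exact norm_tau_le hh m hz'
        · exact norm_tau_le hh k hz'
      refine (integral_mono_ae (hi k).norm (integrable_const _) h1).trans_eq ?_
      rw [integral_const, smul_eq_mul, axialMass]
      ring
    have h2 := integral_tsum_of_summable_integral_norm hi hsum
    have h3 : (fun z => (tau h m z : ℂ) * ∑' k, (tau h k z : ℂ) • a k) =
        fun z => ∑' k, (tau h m z : ℂ) * ((tau h k z : ℂ) • a k) := by
      funext z; rw [tsum_mul_left]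
    rw [h3, ← h2]
    have h4 : ∀ k, ∫ z, (tau h m z : ℂ) * ((tau h k z : ℂ) • a k) ∂axialMeasure h =
        if k = m then a k else 0 := fun k => by
      simp only [smul_eq_mul, ← mul_assoc]
      rw [integral_mul_const, integral_tau hh]
      by_cases hc : m = k
      · simp [hc]
      · simp [hc, Ne.symm hc]
    simp only [h4, tsum_ite_eq]
  have h5 := tau_complete hh (fun z => F z - ∑' k, (tau h k z : ℂ) • a k)
    (hF.sub (integrable_of_continuousOn_axial hh hG)) fun k => by
      simp only [mul_sub]
      rw [integral_sub (hFm k) (hGm k), key, ha, sub_self]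
  filter_upwards [h5] with z hz using sub_eq_zero.1 hz

lemma eqOn_tsum_tau {h : ℝ} (hh : 0 < h) {f : ℝ → ℂ} (hf : ContinuousOn f (Icc (-h) 0))
    {a : ℕ → ℂ} (ha : ∀ k, ∫ z, (tau h k z : ℂ) * f z ∂axialMeasure h = a k)
    (hs : Summable fun k => ‖a k‖) :
    EqOn f (fun z => ∑' k, (tau h k z : ℂ) • a k) (Icc (-h) 0) := by
  have h1 := (ae_axialMeasure_iff hh).1
    (ae_eq_tsum_tau hh (integrable_of_continuousOn_axial hh hf) ha hs)
  rw [restrict_Ioo_eq_restrict_Icc] at h1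
  refine Measure.eqOn_of_ae_eq h1 hf (continuousOn_tsum_tau hh hs) ?_
  rw [interior_Icc, closure_Ioo (by linarith)]

/-! ### The interpolation error -/

/-- The Cauchy–Schwarz inequality for sums in `[0, ∞]`. -/
lemma tsum_mul_sq_le {ι : Type*} (f g : ι → ENNReal) :
    (∑' i, f i * g i) ^ 2 ≤ (∑' i, f i ^ 2) * ∑' i, g i ^ 2 := by
  let _ : MeasurableSpace ι := ⊤
  have h := ENNReal.lintegral_mul_le_Lp_mul_Lq (Measure.count (α := ι)) Real.HolderConjugate.two_two
    (f := f) (g := g) measurable_from_top.aemeasurable measurable_from_top.aemeasurable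
  simp only [lintegral_count, Pi.mul_apply, ENNReal.rpow_two] at h
  refine (pow_le_pow_left' h 2).trans_eq ?_
  rw [mul_pow, ← ENNReal.rpow_two, ← ENNReal.rpow_two, ← ENNReal.rpow_mul, ← ENNReal.rpow_mul]
  norm_num

lemma tsum_inv_sq_ne_top : ∑' n : ℕ, (((n + 1 : ℕ) : ENNReal)⁻¹) ^ 2 ≠ ⊤ := by
  have h1 : Summable fun n : ℕ => ((((n + 1 : ℕ) : NNReal)⁻¹) ^ 2) := by
    rw [← NNReal.summable_coe]
    have := (summable_nat_add_iff 1).2 (Real.summable_one_div_nat_pow.2 (by norm_num : 1 < 2))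
    simpa using this
  have h2 := ENNReal.tsum_coe_ne_top_iff_summable.2 h1
  convert h2 using 4 with n
  push_cast [ENNReal.coe_inv]
  rw [ENNReal.coe_inv (by positivity)]
  push_cast
  rfl

lemma add_sq_le_four_mul (a b : ENNReal) : (a + b) ^ 2 ≤ 4 * (a ^ 2 + b ^ 2) := by
  have h1 : a + b ≤ 2 * max a b := by
    rw [two_mul]; exact add_le_add (le_max_left a b) (le_max_right a b)
  refine (pow_le_pow_left' h1 2).trans ?_
  rw [mul_pow]
  norm_num
  gcongr
  rcases max_choice a b with h | h <;> rw [h]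
  · exact le_self_add
  · exact le_add_self

/-- Square-summability with the weight `(k+1)^(2s)`, `s ≥ 1`, implies absolute summability. -/
lemma summable_norm_of_weighted {E : Type*} [NormedAddCommGroup E] {s : ℕ} (hs : 1 ≤ s) {a : ℕ → E}
    (ha : ∑' k : ℕ, ((k + 1 : ℕ) : ENNReal) ^ (2 * s) * ‖a k‖ₑ ^ 2 ≠ ⊤) :
    Summable fun k => ‖a k‖ := by
  have h1 : ∑' k, ‖a k‖ₑ ≠ ⊤ := by
    have h2 := tsum_mul_sq_le (fun k : ℕ => ((k + 1 : ℕ) : ENNReal) ^ s * ‖a k‖ₑ)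
      fun k => (((k + 1 : ℕ) : ENNReal)⁻¹) ^ s
    have e1 : ∀ k : ℕ, ((k + 1 : ℕ) : ENNReal) ^ s * ‖a k‖ₑ * (((k + 1 : ℕ) : ENNReal)⁻¹) ^ s =
        ‖a k‖ₑ := fun k => by
      rw [mul_right_comm, ← mul_pow, ENNReal.mul_inv_cancel (by simp) (ENNReal.natCast_ne_top _),
        one_pow, one_mul]
    have e2 : ∀ k : ℕ, (((k + 1 : ℕ) : ENNReal) ^ s * ‖a k‖ₑ) ^ 2 =
        ((k + 1 : ℕ) : ENNReal) ^ (2 * s) * ‖a k‖ₑ ^ 2 := fun k => by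
      rw [mul_pow, ← pow_mul, mul_comm s]
    simp only [e1, e2] at h2
    have h3 : ∑' k : ℕ, ((((k + 1 : ℕ) : ENNReal)⁻¹) ^ s) ^ 2 ≠ ⊤ := by
      refine ne_top_of_le_ne_top tsum_inv_sq_ne_top (ENNReal.tsum_le_tsum fun k => ?_)
      gcongr
      exact pow_le_of_le_one (zero_le) (ENNReal.inv_le_one.2 (by simp)) (by omega)
    intro h4
    rw [h4] at h2
    exact ENNReal.mul_ne_top ha h3 (top_le_iff.1 (by simpa using h2))
  have h2 := ENNReal.tsum_coe_ne_top_iff_summable.1 h1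
  exact NNReal.summable_coe.2 h2

/-- The indices beyond `J` with a given alias occur at most once in each block of length `J`. -/
lemma tsum_aliased_inv_le {s J : ℕ} (hs : 1 ≤ s) (hJ : 1 ≤ J) (m : ℕ) :
    ∑' k : {k : ℕ // J < k ∧ aliasIndex J k = m}, (((k + 1 : ℕ) : ENNReal)⁻¹) ^ (2 * s) ≤
      ((J : ENNReal)⁻¹) ^ (2 * s) * ∑' n : ℕ, (((n + 1 : ℕ) : ENNReal)⁻¹) ^ 2 := by
  set φ : {k : ℕ // J < k ∧ aliasIndex J k = m} → ℕ := fun k => (k - 1) / J - 1 with hφ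
  have hb : ∀ k : {k : ℕ // J < k ∧ aliasIndex J k = m}, 1 ≤ ((k : ℕ) - 1) / J := fun k =>
    (Nat.one_le_div_iff hJ).2 (by have := k.2.1; omega)
  have hinj : Function.Injective φ := by
    intro k k' hk
    have := hb k
    have := hb k'
    have h1 : ((k : ℕ) - 1) / J = ((k' : ℕ) - 1) / J := by simp only [hφ] at hk; omega
    have := k.2.1
    have := k'.2.1
    exact Subtype.ext (aliasIndex_injective_block hJ (by omega) (by omega) h1
      (k.2.2.trans k'.2.2.symm))
  rw [← ENNReal.tsum_mul_left]
  refine le_trans (ENNReal.tsum_le_tsum fun k => ?_)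
    (ENNReal.tsum_comp_le_tsum_of_injective hinj _)
  have h1 : J * (φ k + 1) ≤ k + 1 := by
    have h2 : φ k + 1 = ((k : ℕ) - 1) / J := Nat.sub_add_cancel (hb k)
    rw [h2]
    have := Nat.mul_div_le ((k : ℕ) - 1) J
    omega
  calc (((k + 1 : ℕ) : ENNReal)⁻¹) ^ (2 * s) ≤ (((J * (φ k + 1) : ℕ) : ENNReal)⁻¹) ^ (2 * s) := by
        gcongr
    _ = ((J : ENNReal)⁻¹) ^ (2 * s) * ((((φ k + 1 : ℕ) : ENNReal)⁻¹) ^ (2 * s)) := by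
        rw [Nat.cast_mul, ENNReal.mul_inv (by simp) (.inl (ENNReal.natCast_ne_top _)), mul_pow]
    _ ≤ _ := by
        refine mul_le_mul_right ?_ _
        exact pow_le_pow_right_of_le_one' (ENNReal.inv_le_one.2 (by simp)) (by omega)

/-- The `m`-th coefficient of the interpolant of `τ_k`. -/
def interpCoef (h : ℝ) (J k m : ℕ) : ℝ :=
  if aliasIndex J k = m then chebNorm h k / chebNorm h (aliasIndex J k) else 0

lemma interpCoef_of_le {h : ℝ} (hh : 0 < h) {J k : ℕ} (hJ : 1 ≤ J) (hk : k ≤ J) (m : ℕ) :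
    interpCoef h J k m = if k = m then 1 else 0 := by
  rw [interpCoef, aliasIndex_of_le hJ hk, div_self (chebNorm_pos hh k).ne']

lemma continuous_lagrangeCheb (h : ℝ) (J j : ℕ) : Continuous (lagrangeCheb h J j) :=
  Polynomial.continuous _

lemma sum_tau_mul_integral {h : ℝ} (hh : 0 < h) {J : ℕ} (hJ : 1 ≤ J) (k m : ℕ) :
    ∑ j ∈ Finset.range (J + 1), (tau h k (chebNode h J j) : ℂ) *
      ∫ z, (tau h m z : ℂ) * (lagrangeCheb h J j z : ℂ) ∂axialMeasure h = interpCoef h J k m := by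
  have hi : ∀ j, Integrable (fun z => (tau h m z : ℂ) * (lagrangeCheb h J j z : ℂ))
      (axialMeasure h) := fun j => integrable_of_continuous_axial hh
    ((Complex.continuous_ofReal.comp (continuous_tau h m)).mul
      (Complex.continuous_ofReal.comp (continuous_lagrangeCheb h J j)))
  have hν := (chebNorm_pos hh (aliasIndex J k)).ne'
  have e : ∀ z, ∑ j ∈ Finset.range (J + 1), (tau h k (chebNode h J j) : ℂ) *
      ((tau h m z : ℂ) * (lagrangeCheb h J j z : ℂ)) =
      ((chebNorm h k / chebNorm h (aliasIndex J k) : ℝ) : ℂ) *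
        ((tau h m z : ℂ) * (tau h (aliasIndex J k) z : ℂ)) := fun z => by
    have h1 : chebNorm h k / chebNorm h (aliasIndex J k) * tau h (aliasIndex J k) z =
        ∑ j ∈ Finset.range (J + 1), tau h k (chebNode h J j) * lagrangeCheb h J j z := by
      simp only [tau, mul_assoc]
      rw [← Finset.mul_sum, sum_cheb_mul_lagrangeCheb hh hJ]
      field_simp
    rw [mul_left_comm, ← Complex.ofReal_mul, h1]
    push_cast
    rw [Finset.mul_sum]
    exact Finset.sum_congr rfl fun j _ => by ring
  simp only [← integral_const_mul]
  rw [← integral_finsetSum _ fun j _ => (hi j).const_mul _]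
  simp only [e]
  rw [integral_const_mul, integral_tau hh, interpCoef]
  by_cases hc : aliasIndex J k = m
  · simp [hc]
  · simp [hc, Ne.symm hc]

/-- The coefficients of the interpolant of a function with absolutely summable Chebyshev
coefficients. -/
lemma integral_tau_mul_interp {h : ℝ} (hh : 0 < h) {J : ℕ} (hJ : 1 ≤ J) {f : ℝ → ℂ}
    (hf : ContinuousOn f (Icc (-h) 0)) {a : ℕ → ℂ}
    (ha : ∀ k, ∫ z, (tau h k z : ℂ) * f z ∂axialMeasure h = a k) (hs : Summable fun k => ‖a k‖)
    (m : ℕ) :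
    HasSum (fun k => a k * (interpCoef h J k m : ℂ)) (∫ z, (tau h m z : ℂ) *
      ∑ j ∈ Finset.range (J + 1), f (chebNode h J j) * (lagrangeCheb h J j z : ℂ) ∂axialMeasure h) := by
  have hi : ∀ j, Integrable (fun z => (tau h m z : ℂ) * (lagrangeCheb h J j z : ℂ))
      (axialMeasure h) := fun j => integrable_of_continuous_axial hh
    ((Complex.continuous_ofReal.comp (continuous_tau h m)).mul
      (Complex.continuous_ofReal.comp (continuous_lagrangeCheb h J j)))
  have e : ∀ z, (tau h m z : ℂ) * ∑ j ∈ Finset.range (J + 1),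
      f (chebNode h J j) * (lagrangeCheb h J j z : ℂ) = ∑ j ∈ Finset.range (J + 1),
      f (chebNode h J j) * ((tau h m z : ℂ) * (lagrangeCheb h J j z : ℂ)) := fun z => by
    rw [Finset.mul_sum]
    exact Finset.sum_congr rfl fun j _ => by ring
  simp only [e]
  rw [integral_finsetSum _ fun j _ => (hi j).const_mul _]
  simp only [integral_const_mul]
  have h1 : ∀ k, a k * (interpCoef h J k m : ℂ) = ∑ j ∈ Finset.range (J + 1),
      ((tau h k (chebNode h J j) : ℂ) • a k) *
        ∫ z, (tau h m z : ℂ) * (lagrangeCheb h J j z : ℂ) ∂axialMeasure h := fun k => by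
    rw [← sum_tau_mul_integral hh hJ, Finset.mul_sum]
    exact Finset.sum_congr rfl fun j _ => by rw [smul_eq_mul]; ring
  simp only [h1]
  refine hasSum_sum fun j _ => HasSum.mul_right _ ?_
  rw [eqOn_tsum_tau hh hf ha hs (chebNode_mem hh J j)]
  exact (summable_tau_smul hh hs (chebNode_mem hh J j)).hasSum

/-- The error of Chebyshev–Lobatto interpolation, expressed through Chebyshev coefficients:
truncation and aliasing both involve only the coefficients beyond `J`. -/
lemma exists_interp_error {h : ℝ} (hh : 0 < h) {s : ℕ} (hs : 1 ≤ s) : ∃ C : ENNReal, C ≠ ⊤ ∧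
    ∀ (J : ℕ), 1 ≤ J → ∀ (f : ℝ → ℂ) (a : ℕ → ℂ), ContinuousOn f (Icc (-h) 0) →
      (∀ k, ∫ z, (tau h k z : ℂ) * f z ∂axialMeasure h = a k) →
      ∑' k : ℕ, ((k + 1 : ℕ) : ENNReal) ^ (2 * s) * ‖a k‖ₑ ^ 2 ≠ ⊤ →
      ∑' m, ‖a m - ∫ z, (tau h m z : ℂ) * ∑ j ∈ Finset.range (J + 1),
        f (chebNode h J j) * (lagrangeCheb h J j z : ℂ) ∂axialMeasure h‖ₑ ^ 2 ≤
      C * ((J : ENNReal)⁻¹) ^ (2 * s) *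
        ∑' k : ℕ, ((k + 1 : ℕ) : ENNReal) ^ (2 * s) * ‖a k‖ₑ ^ 2 := by
  set c : ENNReal := ∑' n : ℕ, (((n + 1 : ℕ) : ENNReal)⁻¹) ^ 2 with hc
  refine ⟨4 * (1 + 4 * c), ENNReal.mul_ne_top (by simp) (ENNReal.add_ne_top.2 ⟨by simp,
    ENNReal.mul_ne_top (by simp) tsum_inv_sq_ne_top⟩), fun J hJ f a hf ha hA => ?_⟩
  have hsum := summable_norm_of_weighted hs hA
  set A : ENNReal := ∑' k : ℕ, ((k + 1 : ℕ) : ENNReal) ^ (2 * s) * ‖a k‖ₑ ^ 2 with hAdef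
  set S : ℕ → Set ℕ := fun m => {k | J < k ∧ aliasIndex J k = m} with hS
  have hint := integral_tau_mul_interp hh hJ hf ha hsum
  -- the tail term and the aliasing term
  set α : ℕ → ENNReal := fun m => if J < m then ‖a m‖ₑ else 0 with hα
  set β : ℕ → ENNReal := fun m => ∑' k : S m, ‖a k‖ₑ with hβ
  have hd : ∀ m, ‖a m - ∫ z, (tau h m z : ℂ) * ∑ j ∈ Finset.range (J + 1),
        f (chebNode h J j) * (lagrangeCheb h J j z : ℂ) ∂axialMeasure h‖ₑ ≤ α m + 2 * β m := by
    intro m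
    -- in the series of the error coefficient the terms with `k ≤ J` cancel
    have h1 := (hasSum_ite_eq m (a m)).sub (hint m)
    rw [← h1.tsum_eq]
    refine (enorm_tsum_le_tsum_enorm).trans ?_
    have h2 : α m = ∑' k, if k = m then α m else 0 := (tsum_ite_eq m fun _ => α m).symm
    have h3 : β m = ∑' k, (S m).indicator (fun k => ‖a k‖ₑ) k := tsum_subtype (S m) fun k => ‖a k‖ₑ
    rw [h2, h3, ← ENNReal.tsum_mul_left, ← ENNReal.tsum_add]
    refine ENNReal.tsum_le_tsum fun k => ?_
    by_cases hk : k ≤ J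
    · rw [interpCoef_of_le hh hJ hk]
      by_cases hkm : k = m
      · subst hkm; simp
      · simp [hkm]
    · refine (enorm_sub_le).trans (add_le_add ?_ ?_)
      · by_cases hkm : k = m
        · subst hkm; simp [hα, not_le.1 hk]
        · simp [hkm]
      · by_cases hkm : aliasIndex J k = m
        · have hmem : k ∈ S m := ⟨not_le.1 hk, hkm⟩
          rw [indicator_of_mem hmem, enorm_mul, mul_comm]
          gcongr
          rw [interpCoef, if_pos hkm, ← ofReal_norm, Complex.norm_real, Real.norm_of_nonneg
            (div_nonneg (chebNorm_pos hh _).le (chebNorm_pos hh _).le)]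
          refine ENNReal.ofReal_le_of_le_toReal ?_
          rw [ENNReal.toReal_ofNat, div_le_iff₀ (chebNorm_pos hh _)]
          exact chebNorm_le hh _ _
        · simp [interpCoef, hkm]
  have hα2 : ∑' m, α m ^ 2 ≤ ((J : ENNReal)⁻¹) ^ (2 * s) * A := by
    rw [hAdef, ← ENNReal.tsum_mul_left]
    refine ENNReal.tsum_le_tsum fun m => ?_
    simp only [hα]
    split_ifs with hm
    · rw [← mul_assoc, ← mul_pow]
      refine le_mul_of_one_le_left' (one_le_pow_of_one_le' ?_ _)
      rw [mul_comm, ← div_eq_mul_inv, ENNReal.le_div_iff_mul_le (by simp) (by simp), one_mul]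
      exact_mod_cast (by omega : J ≤ m + 1)
    · simp
  have hβ2 : ∑' m, β m ^ 2 ≤ (((J : ENNReal)⁻¹) ^ (2 * s) * c) * A := by
    have h1 : ∀ m, β m ^ 2 ≤ (((J : ENNReal)⁻¹) ^ (2 * s) * c) *
        ∑' k : S m, ((k + 1 : ℕ) : ENNReal) ^ (2 * s) * ‖a k‖ₑ ^ 2 := by
      intro m
      have h2 := tsum_mul_sq_le (fun k : S m => (((k + 1 : ℕ) : ENNReal)⁻¹) ^ s)
        fun k : S m => ((k + 1 : ℕ) : ENNReal) ^ s * ‖a k‖ₑ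
      have e1 : ∀ k : S m, (((k + 1 : ℕ) : ENNReal)⁻¹) ^ s * (((k + 1 : ℕ) : ENNReal) ^ s * ‖a k‖ₑ) =
          ‖a k‖ₑ := fun k => by
        rw [← mul_assoc, ← mul_pow, ENNReal.inv_mul_cancel (by simp) (ENNReal.natCast_ne_top _),
          one_pow, one_mul]
      simp only [e1, mul_pow, ← pow_mul, mul_comm s 2] at h2
      refine h2.trans ?_
      gcongr
      exact tsum_aliased_inv_le hs hJ m
    refine (ENNReal.tsum_le_tsum h1).trans ?_
    rw [ENNReal.tsum_mul_left]
    gcongr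
    have e2 : ∀ m, ∑' k : S m, ((k + 1 : ℕ) : ENNReal) ^ (2 * s) * ‖a k‖ₑ ^ 2 =
        ∑' k : ℕ, (S m).indicator (fun k : ℕ => ((k + 1 : ℕ) : ENNReal) ^ (2 * s) * ‖a k‖ₑ ^ 2) k :=
      fun m => tsum_subtype (S m) fun k : ℕ => ((k + 1 : ℕ) : ENNReal) ^ (2 * s) * ‖a k‖ₑ ^ 2
    simp only [e2]
    rw [ENNReal.tsum_comm]
    refine ENNReal.tsum_le_tsum fun k => ?_
    rw [tsum_eq_single (aliasIndex J k) fun m hm => indicator_of_notMem (fun hk => hm hk.2.symm) _]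
    exact indicator_le_self _ _ _
  calc _ ≤ ∑' m, (4 * α m ^ 2 + 16 * β m ^ 2) := by
        refine ENNReal.tsum_le_tsum fun m => ?_
        refine (pow_le_pow_left' (hd m) 2).trans ((add_sq_le_four_mul _ _).trans_eq ?_)
        ring
    _ = 4 * ∑' m, α m ^ 2 + 16 * ∑' m, β m ^ 2 := by
        rw [ENNReal.tsum_add, ENNReal.tsum_mul_left, ENNReal.tsum_mul_left]
    _ ≤ 4 * (((J : ENNReal)⁻¹) ^ (2 * s) * A) + 16 * ((((J : ENNReal)⁻¹) ^ (2 * s) * c) * A) := by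
        gcongr
    _ = _ := by ring

/-! ### Slices and the representative continuous in `z` -/

/-- The coefficient `∫ dzeta i v` of `v` on the disc, without conjugation as in `coef`. -/
def discCoef (i : ℕ × ℕ) (v : ℂ → ℂ) : ℂ := ∫ x, dzeta i.1 i.2 x * v x ∂discMeasure

lemma discCoef_congr {i : ℕ × ℕ} {u v : ℂ → ℂ} (huv : u =ᵐ[discMeasure] v) :
    discCoef i u = discCoef i v :=
  integral_congr_ae (huv.mono fun x hx => by simp only [hx])

lemma integrable_dzeta_mul {h : ℝ} (hh : 0 < h) {w : ℂ × ℝ → ℂ} (hw : MemLp w 2 (cylMeasure h))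
    (i : ℕ × ℕ) : Integrable (fun P => dzeta i.1 i.2 P.1 * w P) (cylMeasure h) :=
  MemLp.integrable_mul (memLp_of_continuous_cyl hh ((continuous_dzeta i.1 i.2).comp continuous_fst)) hw

lemma integrable_discCoef_slice {h : ℝ} (hh : 0 < h) {w : ℂ × ℝ → ℂ} (hw : MemLp w 2 (cylMeasure h))
    (i : ℕ × ℕ) : Integrable (fun z => discCoef i fun x => w (x, z)) (axialMeasure h) :=
  (integrable_dzeta_mul hh hw i).integral_prod_right

lemma integral_tau_mul_discCoef_slice {h : ℝ} (hh : 0 < h) {w : ℂ × ℝ → ℂ}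
    (hw : MemLp w 2 (cylMeasure h)) (i : ℕ × ℕ) (k : ℕ) :
    ∫ z, (tau h k z : ℂ) * (discCoef i fun x => w (x, z)) ∂axialMeasure h = coef h (i, k) w := by
  have hi : Integrable (fun P => basisFun h (i, k) P * w P) (discMeasure.prod (axialMeasure h)) :=
    MemLp.integrable_mul (memLp_of_continuous_cyl hh (continuous_basisFun h (i, k))) hw
  rw [coef, cylMeasure, integral_prod_symm _ hi]
  refine integral_congr_ae (.of_forall fun z => ?_)
  simp only [discCoef, basisFun, ← integral_const_mul]
  exact integral_congr_ae (.of_forall fun x => by ring)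

lemma ae_memLp_slice {h : ℝ} {w : ℂ × ℝ → ℂ} (hw : MemLp w 2 (cylMeasure h)) :
    ∀ᵐ z ∂axialMeasure h, MemLp (fun x => w (x, z)) 2 discMeasure := by
  have h1 := (memLp_two_iff_integrable_sq_norm hw.1).1 hw
  filter_upwards [Integrable.prod_left_ae h1, AEStronglyMeasurable.prodMk_right hw.1] with z hz hm
  exact (memLp_two_iff_integrable_sq_norm hm).2 hz

lemma continuousOn_discCoef {W : ℝ → Lp ℂ 2 discMeasure} {s : Set ℝ} (hW : ContinuousOn W s)
    (i : ℕ × ℕ) : ContinuousOn (fun z => discCoef i (W z)) s := by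
  obtain ⟨b, hb⟩ := exists_discBasis
  have e : (fun z => discCoef i (W z)) = fun z => inner ℂ (b i) (W z) := by
    funext z; rw [← b.repr_apply_apply, hb, discCoef]
  rw [e]
  exact continuousOn_const.inner hW

/-- The weighted sums of the axial coefficients at a fixed disc index. -/
lemma tsum_weighted_ne_top {h : ℝ} {s : ℕ} {w : ℂ × ℝ → ℂ}
    (hA : ∑' k : ℕ, ((k + 1 : ℕ) : ENNReal) ^ (2 * s) * axialEnergy h w k ≠ ⊤) (i : ℕ × ℕ) :
    ∑' k : ℕ, ((k + 1 : ℕ) : ENNReal) ^ (2 * s) * ‖coef h (i, k) w‖ₑ ^ 2 ≠ ⊤ := by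
  refine ne_top_of_le_ne_top hA (ENNReal.tsum_le_tsum fun k => ?_)
  gcongr
  exact ENNReal.le_tsum (f := fun i : ℕ × ℕ => ‖coef h (i, k) w‖ₑ ^ 2) i

/-- The representative continuous in `z` is the `L²(D)`-valued Chebyshev series of `w`. -/
lemma exists_isContinuousInZ {h : ℝ} (hh : 0 < h) {s : ℕ} (hs : 1 ≤ s) {w : ℂ × ℝ → ℂ}
    (hw : MemLp w 2 (cylMeasure h))
    (hA : ∑' k : ℕ, ((k + 1 : ℕ) : ENNReal) ^ (2 * s) * axialEnergy h w k ≠ ⊤) :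
    ∃ W, IsContinuousInZ h w W := by
  obtain ⟨b, hb⟩ := exists_discBasis
  have hfin : ∀ k, axialEnergy h w k ≠ ⊤ := fun k => by
    refine ne_top_of_le_ne_top (b := ∑' k, axialEnergy h w k) ?_ (ENNReal.le_tsum k)
    rw [tsum_axialEnergy hh hw]
    exact ENNReal.pow_ne_top hw.2.ne
  have hmem : ∀ k, Memℓp (fun i : ℕ × ℕ => coef h (i, k) w) 2 := fun k => by
    refine memℓp_gen ?_
    have h1 : ∑' i : ℕ × ℕ, ((‖coef h (i, k) w‖₊ ^ 2 : NNReal) : ENNReal) ≠ ⊤ := by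
      have h2 := hfin k
      simp only [axialEnergy, enorm_eq_nnnorm] at h2
      exact_mod_cast h2
    simpa using NNReal.summable_coe.2 (ENNReal.tsum_coe_ne_top_iff_summable.1 h1)
  set e : ℕ → Lp ℂ 2 discMeasure := fun k => b.repr.symm ⟨_, hmem k⟩ with he
  have hrepr : ∀ k i, b.repr (e k) i = coef h (i, k) w := fun k i => by
    rw [he, LinearIsometryEquiv.apply_symm_apply]
  have hnorm : ∀ k, ‖e k‖ₑ ^ 2 = axialEnergy h w k := fun k => by
    rw [← tsum_enorm_repr_sq b]
    simp only [hrepr, axialEnergy]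
  have hsum : Summable fun k => ‖e k‖ :=
    summable_norm_of_weighted hs (by simpa only [hnorm] using hA)
  refine ⟨fun z => ∑' k, (tau h k z : ℂ) • e k, continuousOn_tsum_tau hh hsum, ?_⟩
  refine (ae_axialMeasure_iff hh).1 ?_
  have h1 : ∀ᵐ z ∂axialMeasure h, ∀ i : ℕ × ℕ, (discCoef i fun x => w (x, z)) =
      ∑' k, (tau h k z : ℂ) • coef h (i, k) w := by
    rw [ae_all_iff]
    exact fun i => ae_eq_tsum_tau hh (integrable_discCoef_slice hh hw i)
      (integral_tau_mul_discCoef_slice hh hw i)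
      (summable_norm_of_weighted hs (tsum_weighted_ne_top hA i))
  filter_upwards [h1, ae_memLp_slice hw, ae_mem_Ioo h] with z hz hm hI
  set V : Lp ℂ 2 discMeasure := ∑' k, (tau h k z : ℂ) • e k with hV
  have h2 : ∀ i, discCoef i V = discCoef i fun x => w (x, z) := by
    intro i
    rw [hz i, discCoef, ← hb, b.repr_apply_apply]
    have h3 := (innerSL ℂ (b i)).map_tsum (summable_tau_smul hh hsum (Ioo_subset_Icc_self hI))
    rw [← hV] at h3
    simp only [innerSL_apply_apply, inner_smul_right] at h3
    simp only [← b.repr_apply_apply, hrepr] at h3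
    rw [← b.repr_apply_apply, h3]
    simp only [smul_eq_mul]
  have hVm : MemLp V 2 discMeasure := Lp.memLp V
  have hint : ∀ (i : ℕ × ℕ) {f : ℂ → ℂ}, MemLp f 2 discMeasure →
      Integrable (fun x => dzeta i.1 i.2 x * f x) discMeasure := fun i f hf =>
    MemLp.integrable_mul (memLp_of_continuous_disc (continuous_dzeta i.1 i.2)) hf
  have h4 := dzeta_complete (fun x => V x - w (x, z)) (hVm.sub hm) fun i => by
    simp only [mul_sub]
    rw [integral_sub (hint i hVm) (hint i hm)]
    exact sub_eq_zero.2 (h2 i)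
  filter_upwards [h4] with x hx using sub_eq_zero.1 hx

/-- Any representative continuous in `z` has the coefficients of `w`. -/
lemma IsContinuousInZ.integral_tau_mul_discCoef {h : ℝ} (hh : 0 < h) {w : ℂ × ℝ → ℂ}
    (hw : MemLp w 2 (cylMeasure h)) {W : ℝ → Lp ℂ 2 discMeasure} (hW : IsContinuousInZ h w W)
    (i : ℕ × ℕ) (k : ℕ) :
    ∫ z, (tau h k z : ℂ) * discCoef i (W z) ∂axialMeasure h = coef h (i, k) w := by
  rw [← integral_tau_mul_discCoef_slice hh hw]
  refine integral_congr_ae ?_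
  filter_upwards [(ae_axialMeasure_iff hh).2 hW.2] with z hz
  rw [discCoef_congr hz]

/-! ### Zernike polynomials as disc polynomials -/

lemma zernike_natCast (a n : ℕ) (x : ℂ) : zernike a n x = dzeta (n + a) n x := by
  have hx : x = ‖x‖ * Complex.exp (x.arg * Complex.I) := (Complex.norm_mul_exp_arg_mul_I x).symm
  have hpow : x ^ a = (‖x‖ : ℂ) ^ a * Complex.exp (a * x.arg * Complex.I) := by
    conv_lhs => rw [hx]
    rw [mul_pow, ← Complex.exp_nat_mul, mul_assoc (a : ℂ)]
  have hn : x * starRingEnd ℂ x = (‖x‖ : ℂ) ^ 2 := Complex.mul_conj' x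
  have h1 : discFun (n + a) n x = (jacobiP 0 a n (2 * ‖x‖ ^ 2 - 1) : ℂ) * x ^ a := by
    rw [discFun, discPoly_eq_sum (n := n + 1) (.inr (by omega)), jacobiP, Complex.ofReal_sum,
      Finset.sum_mul]
    refine Finset.sum_congr rfl fun k hk => ?_
    have hk' : k ≤ n := Nat.lt_succ_iff.1 (Finset.mem_range.1 hk)
    have e1 : x ^ (n + a - k) = x ^ a * x ^ (n - k) := by
      rw [← pow_add]; congr 1; omega
    have e2 : ((2 * ‖x‖ ^ 2 - 1 - 1) / 2 : ℝ) = ‖x‖ ^ 2 - 1 := by ring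
    have e3 : ((2 * ‖x‖ ^ 2 - 1 + 1) / 2 : ℝ) = ‖x‖ ^ 2 := by ring
    rw [e1, e2, e3, hn, add_zero, Nat.choose_symm hk']
    push_cast
    rw [← hn]
    ring
  rw [zernike, dzeta, h1, hpow, Int.natAbs_natCast]
  have e4 : (1 + (a : ℝ) + 2 * n) = ((n + a : ℕ) : ℝ) + n + 1 := by push_cast; ring
  rw [e4]
  push_cast
  ring

lemma zernike_neg (m : ℤ) (n : ℕ) (x : ℂ) : zernike (-m) n x = starRingEnd ℂ (zernike m n x) := by
  rw [zernike, zernike, map_mul, Complex.conj_ofReal, ← Complex.exp_conj, Int.natAbs_neg]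
  simp

lemma zernike_eq_dzeta (m : ℤ) (n : ℕ) (x : ℂ) :
    zernike m n x = dzeta (n + m.toNat) (n + (-m).toNat) x := by
  obtain ⟨a, rfl | rfl⟩ := m.eq_nat_or_neg
  · simp [zernike_natCast]
  · rw [zernike_neg, zernike_natCast, conj_dzeta]; simp

/-- The indices `(n + m⁻, n + m⁺)`, with `|m| ≤ M` and `n ≤ N`, of the conjugates of the Zernike
polynomials onto whose span `zernikeProj M N` projects. -/
def zernikeIndices (M N : ℕ) : Finset (ℕ × ℕ) :=
  (Finset.Icc (-(M : ℤ)) M ×ˢ Finset.range (N + 1)).image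
    fun mn => (mn.2 + (-mn.1).toNat, mn.2 + mn.1.toNat)

lemma lt_of_notMem_zernikeIndices {M N p q : ℕ} (h : (p, q) ∉ zernikeIndices M N) :
    min M (2 * N) < p + q := by
  by_contra hle
  refine h (Finset.mem_image.2 ⟨((q : ℤ) - p, min p q), ?_, ?_⟩)
  · simp only [Finset.mem_product, Finset.mem_Icc, Finset.mem_range]
    omega
  · simp only [Prod.mk.injEq]
    omega

lemma zernikeProj_eq_sum (M N : ℕ) (v : ℂ → ℂ) (x : ℂ) : zernikeProj M N v x =
    ∑ i ∈ zernikeIndices M N, discCoef i v * starRingEnd ℂ (dzeta i.1 i.2 x) := by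
  rw [zernikeIndices, Finset.sum_image, Finset.sum_product, zernikeProj]
  · refine Finset.sum_congr rfl fun m _ => Finset.sum_congr rfl fun n _ => ?_
    simp only [zernikeCoeff, discCoef, zernike_eq_dzeta, conj_dzeta]
  · rintro ⟨m, n⟩ - ⟨m', n'⟩ - h
    simp only [Prod.mk.injEq] at h ⊢
    omega

/-! ### The projection-interpolant -/

lemma projInterp_eq_sum (h : ℝ) (M N J : ℕ) (W : ℝ → Lp ℂ 2 discMeasure) (P : ℂ × ℝ) :
    projInterp h M N J W P = ∑ i ∈ zernikeIndices M N, starRingEnd ℂ (dzeta i.1 i.2 P.1) *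
      ∑ j ∈ Finset.range (J + 1), discCoef i (W (chebNode h J j)) * (lagrangeCheb h J j P.2 : ℂ) := by
  simp only [projInterp, zernikeProj_eq_sum, Finset.sum_mul, Finset.mul_sum]
  rw [Finset.sum_comm]
  exact Finset.sum_congr rfl fun i _ => Finset.sum_congr rfl fun j _ => by ring

lemma continuous_projInterp (h : ℝ) (M N J : ℕ) (W : ℝ → Lp ℂ 2 discMeasure) :
    Continuous (projInterp h M N J W) := by
  have e : projInterp h M N J W = _ := funext (projInterp_eq_sum h M N J W)
  rw [e]
  refine continuous_finsetSum _ fun i _ => ?_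
  refine (Complex.continuous_conj.comp ((continuous_dzeta _ _).comp continuous_fst)).mul ?_
  refine continuous_finsetSum _ fun j _ => continuous_const.mul ?_
  exact Complex.continuous_ofReal.comp ((continuous_lagrangeCheb h J j).comp continuous_snd)

/-- The coefficients of the projection-interpolant are those of the one-dimensional interpolants
of the disc coefficients. -/
lemma coef_projInterp {h : ℝ} (hh : 0 < h) (M N J : ℕ) (W : ℝ → Lp ℂ 2 discMeasure)
    (i : ℕ × ℕ) (k : ℕ) : coef h (i, k) (projInterp h M N J W) =
      if i ∈ zernikeIndices M N then ∫ z, (tau h k z : ℂ) * ∑ j ∈ Finset.range (J + 1),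
        discCoef i (W (chebNode h J j)) * (lagrangeCheb h J j z : ℂ) ∂axialMeasure h else 0 := by
  set g : ℕ × ℕ → ℝ → ℂ := fun i z => ∑ j ∈ Finset.range (J + 1),
    discCoef i (W (chebNode h J j)) * (lagrangeCheb h J j z : ℂ) with hg
  have hgc : ∀ i, Continuous (g i) := fun i => continuous_finsetSum _ fun j _ =>
    continuous_const.mul (Complex.continuous_ofReal.comp (continuous_lagrangeCheb h J j))
  have e : ∀ P, basisFun h (i, k) P * projInterp h M N J W P = ∑ i' ∈ zernikeIndices M N,
      (dzeta i.1 i.2 P.1 * starRingEnd ℂ (dzeta i'.1 i'.2 P.1)) * ((tau h k P.2 : ℂ) * g i' P.2) := by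
    intro P
    rw [projInterp_eq_sum, Finset.mul_sum]
    exact Finset.sum_congr rfl fun i' _ => by simp only [basisFun, hg]; ring
  have hi : ∀ i' ∈ zernikeIndices M N, Integrable (fun P : ℂ × ℝ =>
      (dzeta i.1 i.2 P.1 * starRingEnd ℂ (dzeta i'.1 i'.2 P.1)) * ((tau h k P.2 : ℂ) * g i' P.2))
      (cylMeasure h) := fun i' _ => by
    have h1 := continuous_dzeta i.1 i.2
    have h2 := Complex.continuous_conj.comp (continuous_dzeta i'.1 i'.2)
    have h3 := Complex.continuous_ofReal.comp (continuous_tau h k)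
    exact (integrable_of_continuous_disc (h1.mul h2)).mul_prod
      (integrable_of_continuous_axial hh (h3.mul (hgc i')))
  rw [coef]
  simp only [e]
  rw [integral_finsetSum _ hi]
  have h1 : ∀ i', ∫ P, (dzeta i.1 i.2 P.1 * starRingEnd ℂ (dzeta i'.1 i'.2 P.1)) *
      ((tau h k P.2 : ℂ) * g i' P.2) ∂cylMeasure h =
      if i = i' then ∫ z, (tau h k z : ℂ) * g i' z ∂axialMeasure h else 0 := fun i' => by
    rw [cylMeasure, integral_prod_mul (fun x => dzeta i.1 i.2 x * starRingEnd ℂ (dzeta i'.1 i'.2 x))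
      (fun z => (tau h k z : ℂ) * g i' z), integral_dzeta, ite_mul, one_mul, zero_mul]
  simp only [h1]
  rw [Finset.sum_ite_eq]

/-- The squared error splits orthogonally into the interpolation errors of the disc coefficients
with index in `zernikeIndices M N` and the energies of the remaining disc indices. -/
lemma exists_error_sq {h : ℝ} (hh : 0 < h) {s : ℕ} (hs : 1 ≤ s) : ∃ C : ENNReal, C ≠ ⊤ ∧
    ∀ (w : ℂ × ℝ → ℂ) (W : ℝ → Lp ℂ 2 discMeasure), MemLp w 2 (cylMeasure h) →
      ∑' k : ℕ, ((k + 1 : ℕ) : ENNReal) ^ (2 * s) * axialEnergy h w k ≠ ⊤ →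
      IsContinuousInZ h w W → ∀ M N J : ℕ, 1 ≤ J →
      eLpNorm (fun P => w P - projInterp h M N J W P) 2 (cylMeasure h) ^ 2 ≤
        C * ((J : ENNReal)⁻¹) ^ (2 * s) *
          ∑' k : ℕ, ((k + 1 : ℕ) : ENNReal) ^ (2 * s) * axialEnergy h w k +
        (((min M (2 * N) : ℕ) : ENNReal)⁻¹) ^ (2 * s) *
          ∑' p : ℕ, ∑' q : ℕ, ((p + q + 1 : ℕ) : ENNReal) ^ (2 * s) * discEnergy h w p q := by
  obtain ⟨C, hC, H⟩ := exists_interp_error hh hs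
  refine ⟨C, hC, fun w W hw hA hW M N J hJ => ?_⟩
  have hpm : MemLp (projInterp h M N J W) 2 (cylMeasure h) :=
    memLp_of_continuous_cyl hh (continuous_projInterp h M N J W)
  have hbi : ∀ (i) {f : ℂ × ℝ → ℂ}, MemLp f 2 (cylMeasure h) →
      Integrable (fun P => basisFun h i P * f P) (cylMeasure h) := fun i f hf =>
    MemLp.integrable_mul (memLp_of_continuous_cyl hh (continuous_basisFun h i)) hf
  have hcoef : ∀ i, coef h i (fun P => w P - projInterp h M N J W P) =
      coef h i w - coef h i (projInterp h M N J W) := fun i => by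
    simp only [coef, mul_sub]
    exact integral_sub (hbi i hw) (hbi i hpm)
  have hd : MemLp (fun P => w P - projInterp h M N J W P) 2 (cylMeasure h) := hw.sub hpm
  rw [← tsum_coef_sq hh hd, ENNReal.tsum_prod']
  simp only [hcoef, coef_projInterp hh]
  have hB : ∑' p : ℕ, ∑' q : ℕ, ((p + q + 1 : ℕ) : ENNReal) ^ (2 * s) * discEnergy h w p q =
      ∑' i : ℕ × ℕ, ((i.1 + i.2 + 1 : ℕ) : ENNReal) ^ (2 * s) * discEnergy h w i.1 i.2 :=
    (ENNReal.tsum_prod' (f := fun i : ℕ × ℕ =>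
      ((i.1 + i.2 + 1 : ℕ) : ENNReal) ^ (2 * s) * discEnergy h w i.1 i.2)).symm
  have hAx : ∑' k : ℕ, ((k + 1 : ℕ) : ENNReal) ^ (2 * s) * axialEnergy h w k =
      ∑' i : ℕ × ℕ, ∑' k : ℕ, ((k + 1 : ℕ) : ENNReal) ^ (2 * s) * ‖coef h (i, k) w‖ₑ ^ 2 := by
    rw [ENNReal.tsum_comm]
    simp only [axialEnergy, ENNReal.tsum_mul_left]
  rw [hB, hAx, ← ENNReal.tsum_mul_left, ← ENNReal.tsum_mul_left, ← ENNReal.tsum_add]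
  refine ENNReal.tsum_le_tsum fun i => ?_
  by_cases hi : i ∈ zernikeIndices M N
  · simp only [if_pos hi]
    exact (H J hJ (fun z => discCoef i (W z)) (fun k => coef h (i, k) w)
      (continuousOn_discCoef hW.1 i) (hW.integral_tau_mul_discCoef hh hw i)
      (tsum_weighted_ne_top hA i)).trans le_self_add
  · simp only [if_neg hi, sub_zero]
    refine le_trans ?_ le_add_self
    change discEnergy h w i.1 i.2 ≤ _
    rw [← mul_assoc, ← mul_pow]
    refine le_mul_of_one_le_left' (one_le_pow_of_one_le' ?_ _)
    have h1 := lt_of_notMem_zernikeIndices hi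
    rw [mul_comm, ← div_eq_mul_inv, ENNReal.le_div_iff_mul_le (by simp) (by simp), one_mul]
    exact_mod_cast (by omega : min M (2 * N) ≤ i.1 + i.2 + 1)

/-! ### The Sobolev norm and the final estimate -/

lemma le_sum_multiIndices (T : ℕ → ℕ → ℕ → ℝ) (hT : ∀ a b k, 0 ≤ T a b k) {s a b k : ℕ}
    (hab : a + b ≤ s) (hk : k ≤ s) : T a b k ≤ ∑ i ∈ Finset.range (s + 1),
      ∑ ab ∈ Finset.HasAntidiagonal.antidiagonal i, ∑ k ∈ Finset.range (s + 1), T ab.1 ab.2 k := by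
  have h1 : ∀ ab : ℕ × ℕ, 0 ≤ ∑ k ∈ Finset.range (s + 1), T ab.1 ab.2 k :=
    fun ab => Finset.sum_nonneg fun k _ => hT _ _ k
  calc T a b k ≤ ∑ k ∈ Finset.range (s + 1), T a b k :=
        Finset.single_le_sum (fun k _ => hT a b k) (Finset.mem_range.2 (by omega))
    _ ≤ ∑ ab ∈ Finset.HasAntidiagonal.antidiagonal (a + b), ∑ k ∈ Finset.range (s + 1),
        T ab.1 ab.2 k := Finset.single_le_sum (f := fun ab : ℕ × ℕ => ∑ k ∈ Finset.range (s + 1),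
          T ab.1 ab.2 k) (fun ab _ => h1 ab) (a := (a, b)) (Finset.HasAntidiagonal.mem_antidiagonal.2 rfl)
    _ ≤ _ := Finset.single_le_sum (f := fun i => ∑ ab ∈ Finset.HasAntidiagonal.antidiagonal i,
        ∑ k ∈ Finset.range (s + 1), T ab.1 ab.2 k) (fun _ _ => Finset.sum_nonneg fun ab _ => h1 ab)
          (Finset.mem_range.2 (by omega))

lemma eLpNorm_weakDeriv_sq_le {h : ℝ} {s : ℕ} {w : ℂ × ℝ → ℂ} (hw : MemSobolev h s w)
    {a b k : ℕ} (hab : a + b ≤ s) (hk : k ≤ s) :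
    eLpNorm (weakDeriv h a b k w) 2 (cylMeasure h) ^ 2 ≤ ENNReal.ofReal (sobolevNorm h s w ^ 2) := by
  have hm := (weakDeriv_spec hw hab hk).2
  have h0 : ∀ ab : ℕ × ℕ, ∀ k, 0 ≤ ∫ p, ‖weakDeriv h ab.1 ab.2 k w p‖ ^ 2 ∂(cylMeasure h) :=
    fun _ _ => integral_nonneg fun _ => by positivity
  have h1 : ∫ p, ‖weakDeriv h a b k w p‖ ^ 2 ∂(cylMeasure h) ≤ sobolevNorm h s w ^ 2 := by
    rw [sobolevNorm, Real.sq_sqrt (Finset.sum_nonneg fun _ _ => Finset.sum_nonneg fun ab _ =>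
      Finset.sum_nonneg fun k _ => h0 ab k)]
    exact le_sum_multiIndices (fun a b k => ∫ p, ‖weakDeriv h a b k w p‖ ^ 2 ∂(cylMeasure h))
      (fun a b k => h0 (a, b) k) hab hk
  refine le_trans (le_of_eq ?_) (ENNReal.ofReal_le_ofReal h1)
  rw [ofReal_integral_eq_lintegral_ofReal ((memLp_two_iff_integrable_sq_norm hm.1).1 hm)
    (.of_forall fun _ => by positivity), eLpNorm_eq_lintegral_rpow_enorm_toReal (by simp) (by simp)]
  simp only [ENNReal.toReal_ofNat, ENNReal.rpow_two]
  rw [← ENNReal.rpow_two, ← ENNReal.rpow_mul]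
  norm_num

lemma memLp_of_memSobolev {h : ℝ} (hh : 0 < h) {s : ℕ} {w : ℂ × ℝ → ℂ} (hw : MemSobolev h s w) :
    MemLp w 2 (cylMeasure h) :=
  (memLp_congr_ae (ae_eq_weakDeriv_zero hh hw)).2
    (weakDeriv_spec hw (a := 0) (b := 0) (by omega) (by omega)).2

/-- The decay of the coefficients of a function in `H^s_σ(C)`. -/
lemma exists_sobolev_decay {h : ℝ} (hh : 0 < h) (s : ℕ) : ∃ K : ENNReal, K ≠ ⊤ ∧
    ∀ w, MemSobolev h s w →
      ∑' p : ℕ, ∑' q : ℕ, ((p + q + 1 : ℕ) : ENNReal) ^ (2 * s) * discEnergy h w p q ≤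
        K * ENNReal.ofReal (sobolevNorm h s w ^ 2) ∧
      ∑' k : ℕ, ((k + 1 : ℕ) : ENNReal) ^ (2 * s) * axialEnergy h w k ≤
        K * ENNReal.ofReal (sobolevNorm h s w ^ 2) := by
  obtain ⟨K₁, hK₁, H₁⟩ := exists_disc_decay hh s
  obtain ⟨K₂, hK₂, H₂⟩ := exists_axial_decay hh s
  refine ⟨K₁ + K₂, ENNReal.add_ne_top.2 ⟨hK₁, hK₂⟩, fun w hw => ?_⟩
  have hc : ∀ i, coef h i w = coef h i (weakDeriv h 0 0 0 w) := fun i =>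
    integral_congr_ae ((ae_eq_weakDeriv_zero hh hw).mono fun P hP => by
      show basisFun h i P * w P = basisFun h i P * weakDeriv h 0 0 0 w P
      rw [hP])
  have h1 := H₁ s (fun a b => weakDeriv h a b 0 w) _
    (fun a b hab => (weakDeriv_spec hw hab s.zero_le).2)
    (fun a b hab => eLpNorm_weakDeriv_sq_le hw hab s.zero_le)
    (fun a b hab => hasWeakDirDeriv_x hw hab) (fun a b hab => hasWeakDirDeriv_y hw hab) 0 0 (by omega)
  have h2 := H₂ s (fun k => weakDeriv h 0 0 k w) _
    (fun k hk => (weakDeriv_spec hw (by omega) hk).2)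
    (fun k hk => eLpNorm_weakDeriv_sq_le hw (by omega) hk)
    (fun k hk => hasWeakDirDeriv_z hw hk) 0 (by omega)
  simp only [discEnergy, axialEnergy, hc]
  exact ⟨h1.trans (by gcongr; exact le_self_add), h2.trans (by gcongr; exact le_add_self)⟩

end ZernikeCylinder

end

theorem mainTheorem2 (h : ℝ) (hh : 0 < h) (s : ℕ) (hs : 1 ≤ s) :
    ∃ R : ℝ, 0 < R ∧
      ∀ w : ℂ × ℝ → ℂ, ZernikeCylinder.MemSobolev h s w →
        (∃ W : ℝ → Lp ℂ 2 ZernikeCylinder.discMeasure, ZernikeCylinder.IsContinuousInZ h w W) ∧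
        ∀ W : ℝ → Lp ℂ 2 ZernikeCylinder.discMeasure, ZernikeCylinder.IsContinuousInZ h w W →
          ∀ M N J : ℕ, 1 ≤ M → 1 ≤ N → 1 ≤ J →
            eLpNorm (fun p => w p - ZernikeCylinder.projInterp h M N J W p) 2
                (ZernikeCylinder.cylMeasure h) ≤
              ENNReal.ofReal
                (R * (((min M (2 * N) : ℕ) : ℝ) ^ (-(s : ℤ)) + (J : ℝ) ^ (-(s : ℤ))) *
                  ZernikeCylinder.sobolevNorm h s w) := by
  obtain ⟨C, hC, H⟩ := ZernikeCylinder.exists_error_sq hh hs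
  obtain ⟨K, hK, D⟩ := ZernikeCylinder.exists_sobolev_decay hh s
  have hCK : (C + 1) * (K + 1) ≠ ⊤ := ENNReal.mul_ne_top (by finiteness) (by finiteness)
  have hCK1 : 1 ≤ (C + 1) * (K + 1) := one_le_mul le_add_self le_add_self
  -- `C + 1` and `K + 1` in place of `C` and `K` make the constant positive
  set R := √((C + 1) * (K + 1)).toReal with hR
  have hRpos : 0 < R := Real.sqrt_pos.2 (ENNReal.toReal_pos (one_pos.trans_le hCK1).ne' hCK)
  refine ⟨R, hRpos, fun w hw => ?_⟩
  obtain ⟨D₁, D₂⟩ := D w hw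
  have hA := ne_top_of_le_ne_top (ENNReal.mul_ne_top hK ENNReal.ofReal_ne_top) D₂
  have hwm := ZernikeCylinder.memLp_of_memSobolev hh hw
  refine ⟨ZernikeCylinder.exists_isContinuousInZ hh hs hwm hA, fun W hW M N J hM hN hJ => ?_⟩
  set B := ZernikeCylinder.sobolevNorm h s w with hB
  have hB0 : 0 ≤ B := Real.sqrt_nonneg _
  set m := min M (2 * N) with hm
  have hm1 : 1 ≤ m := by omega
  have hinv : ∀ n : ℕ, 1 ≤ n → ((n : ENNReal)⁻¹) ^ (2 * s) =
      ENNReal.ofReal (((n : ℝ) ^ (-(s : ℤ))) ^ 2) := fun n hn => by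
    have hn0 : (0 : ℝ) < n := by exact_mod_cast hn
    rw [zpow_neg, zpow_natCast, ← inv_pow, ← pow_mul, mul_comm s,
      ENNReal.ofReal_pow (inv_nonneg.2 hn0.le), ENNReal.ofReal_inv_of_pos hn0, ENNReal.ofReal_natCast]
  set x := (m : ℝ) ^ (-(s : ℤ)) with hx
  set y := (J : ℝ) ^ (-(s : ℤ)) with hy
  have hx0 : 0 ≤ x := by positivity
  have hy0 : 0 ≤ y := by positivity
  -- the estimate is proved for the squares, where Parseval's identity applies
  rw [← ENNReal.pow_le_pow_left_iff two_ne_zero]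
  calc _ ≤ C * ENNReal.ofReal (y ^ 2) * (K * ENNReal.ofReal (B ^ 2)) +
        ENNReal.ofReal (x ^ 2) * (K * ENNReal.ofReal (B ^ 2)) := by
        refine (H w W hwm hA hW M N J hJ).trans ?_
        rw [hinv J hJ, hinv m hm1]
        gcongr
    _ ≤ (C + 1) * ENNReal.ofReal (y ^ 2) * ((K + 1) * ENNReal.ofReal (B ^ 2)) +
        (C + 1) * ENNReal.ofReal (x ^ 2) * ((K + 1) * ENNReal.ofReal (B ^ 2)) := by
        gcongr
        · exact le_self_add
        · exact le_self_add
        · exact le_mul_of_one_le_left' le_add_self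
        · exact le_self_add
    _ = (C + 1) * (K + 1) * (ENNReal.ofReal (x ^ 2 + y ^ 2) * ENNReal.ofReal (B ^ 2)) := by
        rw [ENNReal.ofReal_add (by positivity) (by positivity)]
        ring
    _ = ENNReal.ofReal (R ^ 2) * (ENNReal.ofReal (x ^ 2 + y ^ 2) * ENNReal.ofReal (B ^ 2)) := by
        rw [hR, Real.sq_sqrt ENNReal.toReal_nonneg, ENNReal.ofReal_toReal hCK]
    _ ≤ ENNReal.ofReal (R ^ 2) * (ENNReal.ofReal ((x + y) ^ 2) * ENNReal.ofReal (B ^ 2)) := by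
        gcongr
        nlinarith [mul_nonneg hx0 hy0]
    _ = _ := by
        rw [← ENNReal.ofReal_pow (by positivity), ← ENNReal.ofReal_mul (by positivity),
          ← ENNReal.ofReal_mul (by positivity)]
        congr 1
        ring
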